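/- Let $\mathcal G$ be a connected semisimple linear algebraic group over $\mathbb Q$ (i.e. $\mathcal G$ is connected and $\mathcal G_{\overline{\mathbb Q}}$ has no nontrivial closed connected solvable normal subgroup), and let $G=\mathcal G(\mathbb R)$ with its usual topology. For a parabolic $\mathbb Q$-subgroup $\mathcal P\subseteq\mathcal G$ (a closed $\mathbb Q$-subgroup such that $\mathcal G/\mathcal P$ is complete) put $$P^1=\{p\in\mathcal P(\mathbb R) : |\chi(p)|=1 \text{ for every rational character } \chi:\mathcal P\to \mathrm{GL}_1 \text{ defined over } \mathbb Q\}.$$ A virtual representation of $G$ is a $\mathbb Z/2\mathbb Z$-graded finite-dimensional continuous complex representation $\psi=\psi_+\oplus\psi_-$, and its virtual character is the function $\operatorname{tr}\psi(x)=\operatorname{tr}\psi_+(x)-\operatorname{tr}\psi_-(x)$ on $G$. Then there is a virtual representation $\psi$ of $G$ such that $\operatorname{tr}\psi$ is not identically zero on $G$ and $\operatorname{tr}\psi$ is parabolically regular, that is, $\operatorname{tr}\psi$ vanishes on $xP^1x^{-1}$ for every parabolic $\mathbb Q$-subgroup $\mathcal P\neq\mathcal G$ and every $x\in G$. -/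

import Mathlib

open CategoryTheory AlgebraicGeometry TensorProduct

/-!
A linear algebraic group `G` over a field `k` is given by its coordinate ring: a commutative Hopf
algebra `A` of finite type over `k`, with `G = Spec A`. Closed `k`-subgroups of `G` correspond to
Hopf ideals `I` of `A`, the subgroup being `Spec (A ⧸ I)`; in characteristic zero all these group
schemes are reduced, so this is the same thing as the classical notion.
-/

namespace LinAlgGroup

noncomputable section

section Points

variable (k : Type*) [CommRing k] (A : Type*) [CommRing A] [HopfAlgebra k A]
  (E : Type*) [CommRing E] [Algebra k E]

/-- The points `G(E)` of `G = Spec A` with values in a commutative `k`-algebra `E`; the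
multiplication is the convolution product. -/
abbrev Points : Type _ := WithConv (A →ₐ[k] E)

/-- `G(E)` is a group; the inverse is composition with the antipode. -/
instance instGroupPoints : Group (Points k A E) where
  inv g := WithConv.toConv (g.ofConv.comp (HopfAlgebra.antipodeAlgHom k A))
  inv_mul_cancel g := by
    apply WithConv.ofConv_injective
    apply AlgHom.ext
    intro a
    change (Algebra.TensorProduct.lmul' k) ((Algebra.TensorProduct.map
      (g.ofConv.comp (HopfAlgebra.antipodeAlgHom k A)) g.ofConv) (Coalgebra.comul a)) =
        algebraMap k E (Coalgebra.counit a)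
    have h : ∀ z : A ⊗[k] A, (Algebra.TensorProduct.lmul' k) ((Algebra.TensorProduct.map
        (g.ofConv.comp (HopfAlgebra.antipodeAlgHom k A)) g.ofConv) z) =
        g.ofConv (LinearMap.mul' k A ((HopfAlgebra.antipode k).rTensor A z)) := by
      intro z
      induction z with
      | zero => simp
      | add x y hx hy => simp only [map_add, hx, hy]
      | tmul x y => simp
    rw [h, HopfAlgebra.mul_antipode_rTensor_comul_apply, AlgHom.commutes]

end Points

/-- The inclusion `H(E) → G(E)` for the closed subgroup `H = Spec (A ⧸ I)` of `G = Spec A`. -/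
def subgroupInclusion {k : Type*} [CommRing k] {A : Type*} [CommRing A] [HopfAlgebra k A]
    {E : Type*} [CommRing E] [Algebra k E] (I : Ideal A) [I.IsHopfIdeal k] (h : Points k (A ⧸ I) E) : Points k A E :=
  WithConv.toConv (h.ofConv.comp (Ideal.Quotient.mkₐ k I))

section Semisimple

/-- For an algebraically closed field `K` of characteristic zero: the closed subgroup
`Spec (B ⧸ I)` of `Spec B` is normal. -/
def IsNormalSubgroup (K : Type*) [Field K] {B : Type*} [CommRing B] [HopfAlgebra K B]
    (I : Ideal B) [I.IsHopfIdeal K] : Prop :=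
  ∀ (g : Points K B K) (h : Points K (B ⧸ I) K),
    g * subgroupInclusion I h * g⁻¹ ∈ Set.range (subgroupInclusion (E := K) I)

/-- For an algebraically closed field `K` of characteristic zero: the radical of the group
`Spec B` is trivial, i.e. every closed connected solvable normal subgroup `Spec (B ⧸ I)` is the
trivial subgroup (which is cut out by the augmentation ideal). -/
def HasTrivialRadical (K : Type*) [Field K] (B : Type*) [CommRing B] [HopfAlgebra K B] : Prop :=
  ∀ (I : Ideal B) [I.IsHopfIdeal K], ConnectedSpace (PrimeSpectrum (B ⧸ I)) →
    Group.IsSolvable (Points K (B ⧸ I) K) → IsNormalSubgroup K I →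
      I = RingHom.ker (Bialgebra.counitAlgHom K B)

/-- `G = Spec A` is a connected semisimple linear algebraic group over `ℚ`: it is of finite type,
connected, and its base change to an algebraic closure of `ℚ` has trivial radical. -/
structure IsConnectedSemisimple (A : Type) [CommRing A] [HopfAlgebra ℚ A] : Prop where
  finiteType : Algebra.FiniteType ℚ A
  connected : ConnectedSpace (PrimeSpectrum A)
  radical : HasTrivialRadical (AlgebraicClosure ℚ) (AlgebraicClosure ℚ ⊗[ℚ] A)

end Semisimple

section Parabolic

variable {A : Type} [CommRing A] [HopfAlgebra ℚ A]

/-- The projection `G × P → G` for the closed subgroup `P = Spec (A ⧸ I)` of `G = Spec A`. -/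
def projection (I : Ideal A) : Spec (.of (A ⊗[ℚ] (A ⧸ I))) ⟶ Spec (.of A) :=
  Spec.map (CommRingCat.ofHom
    (Algebra.TensorProduct.includeLeft : A →ₐ[ℚ] A ⊗[ℚ] (A ⧸ I)).toRingHom)

/-- The right translation action `G × P → G`, `(g, p) ↦ g p`, for the closed subgroup
`P = Spec (A ⧸ I)` of `G = Spec A`. -/
def translation (I : Ideal A) : Spec (.of (A ⊗[ℚ] (A ⧸ I))) ⟶ Spec (.of A) :=
  Spec.map (CommRingCat.ofHom
    ((Algebra.TensorProduct.map (AlgHom.id ℚ A) (Ideal.Quotient.mkₐ ℚ I)).comp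
      (Bialgebra.comulAlgHom ℚ A)).toRingHom)

/-- The `ℚ`-scheme `X` together with `π : G ⟶ X` is the quotient `G / P`, where `G = Spec A` and
`P = Spec (A ⧸ I)`: the morphism `π` is faithfully flat and of finite presentation, and
`(g, p) ↦ (g, g p)` identifies `G × P` with `G ×_X G`. -/
structure IsQuotientBy (I : Ideal A) {X : Scheme.{0}} (s : X ⟶ Spec (.of ℚ))
    (π : Spec (.of A) ⟶ X) : Prop where
  comm : π ≫ s = Spec.map (CommRingCat.ofHom (algebraMap ℚ A))
  flat : Flat π
  surjective : Surjective π
  finitePresentation : LocallyOfFinitePresentation π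
  isPullback : IsPullback (projection I) (translation I) π π

/-- The closed `ℚ`-subgroup `P = Spec (A ⧸ I)` of `G = Spec A` is parabolic: the quotient `G / P`
is a complete variety, i.e. proper over `ℚ`. -/
def IsParabolic (I : Ideal A) [I.IsHopfIdeal ℚ] : Prop :=
  ∃ (X : Scheme.{0}) (s : X ⟶ Spec (.of ℚ)) (π : Spec (.of A) ⟶ X),
    IsQuotientBy I s π ∧ IsProper s

end Parabolic

section Real

/-- The usual topology on the real points: the coarsest one for which all regular functions
`g ↦ g a` are continuous. (For any closed embedding of `G` in an affine space it is the subspace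
topology of `G(ℝ)` in `ℝⁿ`.) -/
instance instTopologicalSpaceRealPoints (A : Type) [CommRing A] [HopfAlgebra ℚ A] :
    TopologicalSpace (Points ℚ A ℝ) :=
  TopologicalSpace.induced (fun (g : Points ℚ A ℝ) (a : A) => g.ofConv a) inferInstance

/-- The subgroup `H(ℝ)¹` of `H(ℝ)`, for `H = Spec B`: all `h` such that `|χ(h)| = 1` for every
rational character `χ : H → GL₁` defined over `ℚ`. These characters are the group-like elements of
the coordinate ring `B`. -/
def pointsOne (B : Type) [CommRing B] [HopfAlgebra ℚ B] : Set (Points ℚ B ℝ) :=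
  {h | ∀ χ : B, IsGroupLikeElem ℚ χ → |h.ofConv χ| = 1}

/-- A function on `G(ℝ)`, `G = Spec A`, is parabolically regular if it vanishes on `x P¹ x⁻¹` for
every parabolic `ℚ`-subgroup `P = Spec (A ⧸ I)` other than `G` and every `x ∈ G(ℝ)`. -/
def IsParabolicallyRegular {A : Type} [CommRing A] [HopfAlgebra ℚ A]
    (f : Points ℚ A ℝ → ℂ) : Prop :=
  ∀ (I : Ideal A) [I.IsHopfIdeal ℚ], IsParabolic I → I ≠ ⊥ →
    ∀ (x : Points ℚ A ℝ), ∀ p ∈ pointsOne (A ⧸ I), f (x * subgroupInclusion I p * x⁻¹) = 0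

end Real

/-- A virtual representation of a topological group: a pair `ψ = ψ₊ ⊕ ψ₋` of (continuous)
finite-dimensional complex representations, regarded as a `ℤ/2ℤ`-graded representation. -/
structure VirtualRepresentation (G : Type*) [Group G] [TopologicalSpace G] where
  dimPos : ℕ
  dimNeg : ℕ
  pos : G →ₜ* GL (Fin dimPos) ℂ
  neg : G →ₜ* GL (Fin dimNeg) ℂ

/-- The virtual character `tr ψ = tr ψ₊ - tr ψ₋`. -/
def VirtualRepresentation.tr {G : Type*} [Group G] [TopologicalSpace G]
    (ψ : VirtualRepresentation G) (x : G) : ℂ :=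
  Matrix.trace (ψ.pos x : Matrix (Fin ψ.dimPos) (Fin ψ.dimPos) ℂ) -
    Matrix.trace (ψ.neg x : Matrix (Fin ψ.dimNeg) (Fin ψ.dimNeg) ℂ)

end

end LinAlgGroup

namespace LinAlgGroup

noncomputable section

/-! ### Vanishing to infinite order and the Euler operator -/

section Jets

variable {k R ι : Type*} [Field k] [CommRing R] [Algebra k R] [Fintype ι]
  [DecidableEq ι]

/-! The virtual character is the lowest nonzero coefficient of a polynomial `Φ` over the ring of
virtual characters. Let `p_k(x; T)` be the characteristic polynomial of the `k`-th exterior power of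
the adjoint representation at `x`, and let `Φ = ∏_k p_k(T + 1) p_k(T - 1)`. Its coefficients are
virtual characters, because those of a characteristic polynomial are, up to sign, traces of exterior
powers. Its specializations are monic, so `Φ ≠ 0` and its trailing coefficient is not identically
zero.

Let `P` be a proper parabolic subgroup of dimension `n` and `χ` its modular character, the
determinant of `Ad` on `Lie P`. The wedge of a basis of `Lie P` shows that `χ(y)` is an eigenvalue
of `Λⁿ Ad(y)` for `y ∈ P(ℝ)`. For `p ∈ P¹` the value `η = χ(p)` is `±1`, so `u = χ(y) - η` is a root
of `Φ` specialized at `y`. If `dχ(X) ≠ 0` for some `X ∈ Lie P`, then along `y = p exp(sX)`, `s ≠ 0`,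
this root is nonzero, and it tends to `0` as `s → 0`. After division by the lowest power of `T` it
is still a root, and in the limit the trailing coefficient vanishes at `p`
(`trailingCoeff_apply_eq_zero`). Conjugation invariance does the rest.

It remains to see that `dχ ≠ 0` for proper `P` (`IsParabolic.exists_apply_det_ne_zero`). As `G/P` is
complete and `G` connected, a function on `G` killed by `Lie P` is constant
(`IsParabolic.eq_algebraMap`). Suppose `dχ = 0`. The Plücker coordinates of `Ad(g) Lie P` are then
killed by `Lie P`, hence constant, so `Lie P` is an ideal of `Lie G`. It follows, by the argument of
Lie's theorem, that every semi-invariant of `Lie P` which vanishes at the identity is zero. Applied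
to the Plücker coordinates of a finite dimensional space of generators of the ideal `I` of `P`, as
in Chevalley's theorem, this makes `I` stable under all invariant derivations. Functions in `I`
vanish at the identity, so `I = 0` and `P = G`.

The geometry is done with jets in characteristic zero: a family of functions that vanishes at the
identity and is stable under invariant derivations vanishes to infinite order there, hence is zero
on a connected group (`eq_zero_of_stable`). -/

theorem euler_sub_mem_pow {𝔪 : Ideal R} {x : ι → R} (hx : ∀ i, x i ∈ 𝔪)
    (hgen : 𝔪 ≤ Ideal.span (Set.range x) ⊔ 𝔪 ^ 2) {D : ι → Derivation k R R}
    (hD : ∀ i j, D i (x j) - (if i = j then 1 else 0) ∈ 𝔪) (n : ℕ) {f : R} (hf : f ∈ 𝔪 ^ n) :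
    ∑ i, x i * D i f - n * f ∈ 𝔪 ^ (n + 1) := by
  -- The Euler operator `E = ∑ xᵢ Dᵢ` is a derivation that acts as the identity on `𝔪 / 𝔪²`; hence
  -- it acts as multiplication by `n` on `𝔪ⁿ / 𝔪ⁿ⁺¹`.
  have hE : ∀ a b : R, ∑ i, x i * D i (a * b) =
      a * (∑ i, x i * D i b) + b * (∑ i, x i * D i a) := by
    intro a b
    simp only [Derivation.leibniz, smul_eq_mul, Finset.mul_sum, ← Finset.sum_add_distrib]
    exact Finset.sum_congr rfl fun i _ => by ring
  have hEm : ∀ a : R, ∑ i, x i * D i a ∈ 𝔪 := fun a =>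
    Ideal.sum_mem _ fun i _ => Ideal.mul_mem_right _ _ (hx i)
  have h2 : ∀ a ∈ 𝔪 ^ 2, ∑ i, x i * D i a ∈ 𝔪 ^ 2 := by
    intro a ha
    rw [pow_two] at ha ⊢
    refine Submodule.mul_induction_on ha (fun p hp q hq => ?_) (fun p q hp hq => ?_)
    · rw [hE]
      exact Ideal.add_mem _ (Ideal.mul_mem_mul hp (hEm q)) (Ideal.mul_mem_mul hq (hEm p))
    · simp only [map_add, mul_add, Finset.sum_add_distrib]
      exact Ideal.add_mem _ hp hq
  have h1 : ∀ a ∈ 𝔪, ∑ i, x i * D i a - a ∈ 𝔪 ^ 2 := by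
    intro a ha
    obtain ⟨b, hb, c, hc, rfl⟩ := Submodule.mem_sup.1 (hgen ha)
    have hb' : ∑ i, x i * D i b - b ∈ 𝔪 ^ 2 := by
      refine Submodule.span_induction (p := fun b _ => ∑ i, x i * D i b - b ∈ 𝔪 ^ 2)
        ?_ (by simp) ?_ ?_ hb
      · rintro _ ⟨j, rfl⟩
        have : ∑ i, x i * D i (x j) - x j =
            ∑ i, x i * (D i (x j) - (if i = j then 1 else 0)) := by
          simp [mul_sub, Finset.sum_sub_distrib]
        rw [this, pow_two]
        exact Ideal.sum_mem _ fun i _ => Ideal.mul_mem_mul (hx i) (hD i j)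
      · intro p q _ _ hp hq
        have : ∑ i, x i * D i (p + q) - (p + q) =
            (∑ i, x i * D i p - p) + (∑ i, x i * D i q - q) := by
          simp only [map_add, mul_add, Finset.sum_add_distrib]; ring
        rw [this]
        exact Ideal.add_mem _ hp hq
      · intro r p hp' hp
        have hpm : p ∈ 𝔪 := (Ideal.span_le.2 (by rintro _ ⟨j, rfl⟩; exact hx j)) hp'
        have : ∑ i, x i * D i (r • p) - r • p =
            r * (∑ i, x i * D i p - p) + p * (∑ i, x i * D i r) := by
          rw [smul_eq_mul, hE]; ring
        rw [this]
        refine Ideal.add_mem _ (Ideal.mul_mem_left _ _ hp) ?_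
        rw [pow_two]
        exact Ideal.mul_mem_mul hpm (hEm r)
    have : ∑ i, x i * D i (b + c) - (b + c) =
        (∑ i, x i * D i b - b) + (∑ i, x i * D i c - c) := by
      simp only [map_add, mul_add, Finset.sum_add_distrib]; ring
    rw [this]
    exact Ideal.add_mem _ hb' (Ideal.sub_mem _ (h2 c hc) hc)
  induction n generalizing f with
  | zero => simpa using hEm f
  | succ n ih =>
    rw [pow_succ] at hf
    refine Submodule.mul_induction_on hf (fun p hp q hq => ?_) (fun p q hp hq => ?_)
    · have : ∑ i, x i * D i (p * q) - ((n + 1 : ℕ) : R) * (p * q) =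
          p * (∑ i, x i * D i q - q) + (∑ i, x i * D i p - n * p) * q := by
        rw [hE]; push_cast; ring
      rw [this]
      refine Ideal.add_mem _ ?_ ?_
      · rw [show n + 1 + 1 = n + 2 from rfl, pow_add]
        exact Ideal.mul_mem_mul hp (h1 q hq)
      · rw [pow_succ]
        exact Ideal.mul_mem_mul (ih hp) hq
    · have : ∑ i, x i * D i (p + q) - ((n + 1 : ℕ) : R) * (p + q) =
          (∑ i, x i * D i p - ((n + 1 : ℕ) : R) * p) +
            (∑ i, x i * D i q - ((n + 1 : ℕ) : R) * q) := by
        simp only [map_add, mul_add, Finset.sum_add_distrib]; ring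
      rw [this]
      exact Ideal.add_mem _ hp hq

/-- A set of functions vanishing at a point and stable under a system of derivations which spans
the tangent space there consists of functions which vanish to infinite order. -/
theorem mem_iInf_pow_of_stable [CharZero k] {𝔪 : Ideal R} {x : ι → R} (hx : ∀ i, x i ∈ 𝔪)
    (hgen : 𝔪 ≤ Ideal.span (Set.range x) ⊔ 𝔪 ^ 2) {D : ι → Derivation k R R}
    (hD : ∀ i j, D i (x j) - (if i = j then 1 else 0) ∈ 𝔪) {N : Set R}
    (hN : ∀ f ∈ N, f ∈ 𝔪) (hDN : ∀ i, ∀ f ∈ N, D i f ∈ N) {f : R} (hf : f ∈ N) :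
    f ∈ ⨅ n : ℕ, 𝔪 ^ n := by
  have key : ∀ n : ℕ, ∀ f ∈ N, f ∈ 𝔪 ^ (n + 1) := by
    intro n
    induction n with
    | zero => simpa using hN
    | succ n ih =>
      intro f hf
      -- Modulo `𝔪ⁿ⁺²` the Euler operator multiplies `f` by `n + 1`, but it also sends `f` into
      -- `𝔪ⁿ⁺²`, since the derivatives of `f` stay in `N` and so in `𝔪ⁿ⁺¹`. In characteristic zero
      -- one can divide by `n + 1`.
      have h1 := euler_sub_mem_pow hx hgen hD (n + 1) (ih f hf)
      have h2 : ∑ i, x i * D i f ∈ 𝔪 ^ (n + 1 + 1) := by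
        refine Ideal.sum_mem _ fun i _ => ?_
        rw [pow_succ']
        exact Ideal.mul_mem_mul (hx i) (ih _ (hDN i f hf))
      have h3 : ((n + 1 : ℕ) : R) * f ∈ 𝔪 ^ (n + 1 + 1) := by
        have := Ideal.sub_mem _ h2 h1
        simpa using this
      have h4 : f = algebraMap k R ((n + 1 : ℕ) : k)⁻¹ * (((n + 1 : ℕ) : R) * f) := by
        rw [← mul_assoc, ← map_natCast (algebraMap k R), ← map_mul, inv_mul_cancel₀, map_one,
          one_mul]
        exact_mod_cast Nat.succ_ne_zero n
      rw [h4]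
      exact Ideal.mul_mem_left _ _ h3
  rw [Ideal.mem_iInf]
  rintro (_ | n)
  · simp
  · exact key n f hf

/-- Krull's intersection theorem for a single element. -/
theorem exists_sub_one_mem_mul_eq_zero [IsNoetherianRing R] {𝔪 : Ideal R} {f : R}
    (hf : f ∈ ⨅ n : ℕ, 𝔪 ^ n) : ∃ s : R, 1 - s ∈ 𝔪 ∧ s * f = 0 := by
  have : f ∈ (⨅ i : ℕ, 𝔪 ^ i • ⊤ : Submodule R R) := by
    simpa using hf
  obtain ⟨r, hr⟩ := (Ideal.mem_iInf_smul_pow_eq_bot_iff 𝔪 f).1 this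
  refine ⟨1 - r, by simp, ?_⟩
  rw [sub_mul, one_mul, sub_eq_zero]
  exact hr.symm

end Jets

/-! ### The Lie algebra and invariant derivations -/

section PointDerivations

variable (k : Type*) [Field k] (A : Type*) [CommRing A] [HopfAlgebra k A]

/-- The Lie algebra of `Spec A`: the derivations `A → k` at the neutral element. -/
def pointDerivations : Submodule k (A →ₗ[k] k) where
  carrier := {X | ∀ a b : A, X (a * b) =
    Coalgebra.counit (R := k) a * X b + X a * Coalgebra.counit (R := k) b}
  add_mem' := by
    intro X Y hX hY a b
    simp only [LinearMap.add_apply, hX a b, hY a b]; ring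
  zero_mem' := by intro a b; simp
  smul_mem' := by
    intro c X hX a b
    simp only [LinearMap.smul_apply, hX a b, smul_eq_mul]; ring

variable {k A}

theorem pointDerivations_one {X : A →ₗ[k] k} (hX : X ∈ pointDerivations k A) : X 1 = 0 := by
  have := hX 1 1
  simpa using this

/-- The contraction `f ↦ f₍₁₎ X(f₍₂₎)`, which commutes with left translations. -/
def contract (X : A →ₗ[k] k) : A →ₗ[k] A :=
  (TensorProduct.rid k A).toLinearMap ∘ₗ X.lTensor A ∘ₗ Coalgebra.comul

theorem contract_apply (X : A →ₗ[k] k) (f : A) :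
    contract X f = TensorProduct.rid k A (X.lTensor A (Coalgebra.comul f)) := rfl

theorem contract_repr (X : A →ₗ[k] k) {f : A} {ι : Type*} (r : Coalgebra.Repr k f ι) :
    contract X f = ∑ i ∈ r.index, X (r.right i) • r.left i := by
  rw [contract_apply, ← r.eq]
  simp

theorem counit_contract (X : A →ₗ[k] k) (f : A) :
    Coalgebra.counit (R := k) (contract X f) = X f := by
  rw [contract_repr X (Coalgebra.Repr.arbitrary k f)]
  have := congrArg X (Coalgebra.sum_counit_smul (Coalgebra.Repr.arbitrary k f))
  rw [← this]
  simp [mul_comm]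

theorem contract_counit (f : A) : contract (Coalgebra.counit (R := k)) f = f := by
  rw [contract_apply, Coalgebra.lTensor_counit_comul]
  simp

/-- This is coassociativity; it expresses that contraction on the right factor commutes with left
translations. -/
theorem comul_contract (X : A →ₗ[k] k) (f : A) :
    Coalgebra.comul (R := k) (contract X f) = (contract X).lTensor A (Coalgebra.comul f) := by
  have h1 : ∀ z : A ⊗[k] A, Coalgebra.comul (R := k) (TensorProduct.rid k A (X.lTensor A z)) =
      TensorProduct.rid k (A ⊗[k] A) (X.lTensor (A ⊗[k] A)
        ((Coalgebra.comul (R := k)).rTensor A z)) := by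
    intro z
    induction z with
    | zero => simp
    | add x y hx hy => simp only [map_add, hx, hy]
    | tmul x y => simp
  have h2 : ∀ w : (A ⊗[k] A) ⊗[k] A, TensorProduct.rid k (A ⊗[k] A) (X.lTensor (A ⊗[k] A) w) =
      ((TensorProduct.rid k A).toLinearMap ∘ₗ X.lTensor A).lTensor A
        (TensorProduct.assoc k A A A w) := by
    intro w
    induction w with
    | zero => simp
    | add x y hx hy => simp only [map_add, hx, hy]
    | tmul x y =>
      induction x with
      | zero => simp
      | add x y hx hy => simp only [map_add, hx, hy, add_tmul]
      | tmul p q => simp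
  rw [contract_apply, h1, h2, Coalgebra.coassoc_apply]
  rw [← LinearMap.lTensor_comp_apply]
  rfl

theorem contract_contract (X Y : A →ₗ[k] k) (f : A) :
    contract X (contract Y f) = contract (X ∘ₗ contract Y) f := by
  rw [contract_apply, comul_contract, contract_apply, LinearMap.lTensor_comp_apply]

/-- The left invariant derivation attached to a point derivation. -/
def invDer (X : pointDerivations k A) : Derivation k A A :=
  Derivation.mk' (contract X.1) (by
    intro a b
    have h : ∀ z w : A ⊗[k] A, TensorProduct.rid k A (X.1.lTensor A (z * w)) =
        TensorProduct.rid k A ((Coalgebra.counit (R := k)).lTensor A z) *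
          TensorProduct.rid k A (X.1.lTensor A w) +
        TensorProduct.rid k A ((Coalgebra.counit (R := k)).lTensor A w) *
          TensorProduct.rid k A (X.1.lTensor A z) := by
      intro z w
      induction z with
      | zero => simp
      | add x y hx hy => simp only [map_add, hx, hy, add_mul]; ring
      | tmul x y =>
        induction w with
        | zero => simp
        | add x y hx hy => simp only [map_add, hx, hy, mul_add]; ring
        | tmul p q =>
          simp only [Algebra.TensorProduct.tmul_mul_tmul, LinearMap.lTensor_tmul,
            TensorProduct.rid_tmul, X.2 y q, add_smul, smul_mul_smul_comm, mul_comm p x]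
          rw [mul_comm (X.1 y)]
    rw [contract_apply, Bialgebra.comul_mul, h, Coalgebra.lTensor_counit_comul,
      Coalgebra.lTensor_counit_comul]
    simp [contract_apply])

theorem invDer_apply (X : pointDerivations k A) (f : A) : invDer X f = contract X.1 f := rfl

@[simp]
theorem counit_invDer (X : pointDerivations k A) (f : A) :
    Coalgebra.counit (R := k) (invDer X f) = X.1 f := counit_contract _ _

/-- The commutator of two point derivations. -/
def pointBracket (X Y : pointDerivations k A) : pointDerivations k A :=
  ⟨X.1 ∘ₗ contract Y.1 - Y.1 ∘ₗ contract X.1, by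
    intro a b
    have hX := (invDer X).leibniz a b
    have hY := (invDer Y).leibniz a b
    simp only [invDer_apply, smul_eq_mul] at hX hY
    simp only [LinearMap.sub_apply, LinearMap.comp_apply, hX, hY, map_add, X.2 _ _, Y.2 _ _,
      counit_contract]
    ring⟩

theorem pointBracket_apply (X Y : pointDerivations k A) (f : A) :
    (pointBracket X Y).1 f = X.1 (invDer Y f) - Y.1 (invDer X f) := rfl

theorem invDer_pointBracket (X Y : pointDerivations k A) (f : A) :
    invDer (pointBracket X Y) f = invDer X (invDer Y f) - invDer Y (invDer X f) := by
  simp only [invDer_apply, contract_contract]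
  simp [contract_apply, pointBracket, LinearMap.lTensor_sub]

end PointDerivations

/-! ### Coordinates at the identity -/

section Coordinates

variable (k : Type*) [Field k] (A : Type*) [CommRing A] [HopfAlgebra k A]

/-- The augmentation ideal. -/
abbrev augIdeal : Ideal A := RingHom.ker (Bialgebra.counitAlgHom k A)

variable {k A}

theorem mem_augIdeal {a : A} : a ∈ augIdeal k A ↔ Coalgebra.counit (R := k) a = 0 := Iff.rfl

theorem sub_counit_mem_augIdeal (a : A) :
    a - algebraMap k A (Coalgebra.counit (R := k) a) ∈ augIdeal k A := by
  rw [mem_augIdeal]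
  simp

variable (k A) in
/-- A system of coordinates at the neutral element with the dual basis of the Lie algebra. -/
structure Coordinates (ι : Type*) [Fintype ι] [DecidableEq ι] where
  x : ι → A
  Y : ι → pointDerivations k A
  mem : ∀ i, x i ∈ augIdeal k A
  dual : ∀ i j, (Y i).1 (x j) = if i = j then 1 else 0
  expand : ∀ a ∈ augIdeal k A, a - ∑ i, (Y i).1 a • x i ∈ augIdeal k A ^ 2

theorem exists_basis_sum {V : Type*} [AddCommGroup V] [Module k V] [FiniteDimensional k V]
    (U : Submodule k V) :
    ∃ (n n' : ℕ) (b : Module.Basis (Fin n ⊕ Fin n') k V),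
      (∀ i, b (Sum.inl i) ∈ U) ∧ ∀ v ∈ U, ∀ j, b.repr v (Sum.inr j) = 0 := by
  obtain ⟨U', hU⟩ := Submodule.exists_isCompl U
  let b := ((Module.finBasis k U).prod (Module.finBasis k U')).map (U.prodEquivOfIsCompl U' hU)
  refine ⟨_, _, b, fun i => by simp [b], fun v hv j => ?_⟩
  have : (U.prodEquivOfIsCompl U' hU).symm v = (⟨v, hv⟩, 0) := by
    rw [LinearEquiv.symm_apply_eq]
    simp
  simp [b, this]

/-- The projection of `A` onto the augmentation ideal along the constants. -/
def toAugIdeal : A →ₗ[k] augIdeal k A where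
  toFun a := ⟨a - algebraMap k A (Coalgebra.counit (R := k) a), sub_counit_mem_augIdeal a⟩
  map_add' a b := by ext; simp; ring
  map_smul' c a := by ext; simp [Algebra.smul_def, mul_sub]

theorem toAugIdeal_of_mem {a : A} (ha : a ∈ augIdeal k A) : toAugIdeal (k := k) a = ⟨a, ha⟩ := by
  ext
  simp [toAugIdeal, mem_augIdeal.1 ha]

/-- `A` acts on the cotangent space through the counit, so finitely many generators over `A` already
generate over `k`. -/
theorem finite_cotangent [Algebra.FiniteType k A] :
    Module.Finite k (augIdeal k A).Cotangent := by
  have : IsNoetherianRing A := Algebra.FiniteType.isNoetherianRing k A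
  have hfin : Module.Finite A (augIdeal k A).Cotangent :=
    Module.Finite.of_surjective _ (Ideal.toCotangent_surjective (augIdeal k A))
  obtain ⟨S, hS⟩ := hfin
  refine ⟨⟨S, ?_⟩⟩
  have hsm : ∀ (a : A) (v : (augIdeal k A).Cotangent),
      a • v = Coalgebra.counit (R := k) a • v := by
    intro a v
    obtain ⟨v, rfl⟩ := Ideal.toCotangent_surjective _ v
    have h1 : a • v = (⟨a - algebraMap k A (Coalgebra.counit (R := k) a),
        sub_counit_mem_augIdeal a⟩ : augIdeal k A).1 • v + Coalgebra.counit (R := k) a • v := by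
      ext
      simp [Algebra.smul_def, sub_mul]
    rw [← map_smul, h1, map_add]
    have h2 : (augIdeal k A).toCotangent ((⟨a - algebraMap k A (Coalgebra.counit (R := k) a),
        sub_counit_mem_augIdeal a⟩ : augIdeal k A).1 • v) = 0 := by
      rw [Ideal.toCotangent_eq_zero, pow_two]
      exact Ideal.mul_mem_mul (sub_counit_mem_augIdeal a) v.2
    rw [h2, zero_add]
    rfl
  rw [eq_top_iff]
  intro v _
  have hv : v ∈ Submodule.span A (S : Set (augIdeal k A).Cotangent) := hS ▸ Submodule.mem_top
  refine Submodule.span_induction (fun x hx => Submodule.subset_span hx) (Submodule.zero_mem _)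
    (fun x y _ _ hx hy => Submodule.add_mem _ hx hy) (fun a x _ hx => ?_) hv
  rw [hsm]
  exact Submodule.smul_mem _ _ hx

/-- Coordinates adapted to a closed subscheme `V(I)` through the neutral element. -/
theorem exists_coordinates [Algebra.FiniteType k A] {I : Ideal A} (hI : I ≤ augIdeal k A) :
    ∃ (n n' : ℕ) (c : Coordinates k A (Fin n ⊕ Fin n')),
      (∀ j, c.x (Sum.inr j) ∈ I) ∧ ∀ i, ∀ a ∈ I, (c.Y (Sum.inl i)).1 a = 0 := by
  have := finite_cotangent (k := k) (A := A)
  let T : augIdeal k A →ₗ[k] (augIdeal k A).Cotangent := (augIdeal k A).toCotangent.restrictScalars k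
  have hT : ∀ z : augIdeal k A, T z = 0 ↔ z.1 ∈ augIdeal k A ^ 2 := fun z =>
    Ideal.toCotangent_eq_zero _ z
  -- `U` is the conormal space of `V(I)` at the identity. A basis of `U` lifts to the coordinates
  -- indexed by `Sum.inr`; the derivations dual to the other basis vectors kill `U`, so they are
  -- tangent to `V(I)`.
  let U : Submodule k (augIdeal k A).Cotangent :=
    ((I.restrictScalars k).comap ((augIdeal k A).subtype.restrictScalars k)).map T
  obtain ⟨n', n, b', hb1, hb2⟩ := exists_basis_sum U
  let b := b'.reindex (Equiv.sumComm _ _)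
  have hlift : ∀ i : Fin n ⊕ Fin n', ∃ x : augIdeal k A, T x = b i ∧
      ∀ j, i = Sum.inr j → x.1 ∈ I := by
    rintro (i | j)
    · obtain ⟨x, hx⟩ := Ideal.toCotangent_surjective _ (b (Sum.inl i))
      exact ⟨x, hx, by simp⟩
    · obtain ⟨x, hx, hx'⟩ := hb1 j
      exact ⟨x, by simpa [b] using hx', fun _ _ => hx⟩
  choose x hx hxI using hlift
  have hder : ∀ i, (b.coord i) ∘ₗ T ∘ₗ toAugIdeal ∈ pointDerivations k A := by
    intro i p q
    have : T (toAugIdeal (k := k) (p * q)) = Coalgebra.counit (R := k) p • T (toAugIdeal q) +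
        Coalgebra.counit (R := k) q • T (toAugIdeal p) := by
      rw [← sub_eq_zero, ← T.map_smul, ← T.map_smul, ← map_add, ← map_sub, hT]
      have : (toAugIdeal (k := k) (p * q) - (Coalgebra.counit (R := k) p • toAugIdeal q +
        Coalgebra.counit (R := k) q • toAugIdeal p) : augIdeal k A).1 =
        (toAugIdeal (k := k) p).1 * (toAugIdeal (k := k) q).1 := by
        simp [toAugIdeal, Algebra.smul_def]
        ring
      rw [this, pow_two]
      exact Ideal.mul_mem_mul (toAugIdeal p).2 (toAugIdeal q).2
    simp only [LinearMap.comp_apply, this, map_add, map_smul, smul_eq_mul]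
    ring
  refine ⟨n, n', ⟨fun i => x i, fun i => ⟨_, hder i⟩, fun i => (x i).2, fun i j => ?_,
    fun a ha => ?_⟩, fun j => hxI _ j rfl, fun i a ha => ?_⟩
  · simp only [LinearMap.comp_apply, toAugIdeal_of_mem (x j).2, Subtype.coe_eta, hx]
    simp [Finsupp.single_apply, eq_comm]
  · have h1 : T (⟨a, ha⟩ - ∑ i, b.coord i (T ⟨a, ha⟩) • x i) = 0 := by
      simp only [map_sub, map_sum, map_smul, hx, Module.Basis.coord_apply, b.sum_repr, sub_self]
    have h2 := (hT _).1 h1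
    simpa [toAugIdeal_of_mem ha] using h2
  · have h1 : T ⟨a, hI ha⟩ ∈ U := ⟨⟨a, hI ha⟩, ha, rfl⟩
    change b.coord (Sum.inl i) (T (toAugIdeal a)) = 0
    rw [toAugIdeal_of_mem (hI ha), Module.Basis.coord_apply, Module.Basis.repr_reindex_apply]
    exact hb2 _ h1 i

theorem Coordinates.augIdeal_le {ι : Type*} [Fintype ι] [DecidableEq ι] (c : Coordinates k A ι) :
    augIdeal k A ≤ Ideal.span (Set.range c.x) ⊔ augIdeal k A ^ 2 := by
  intro a ha
  rw [← add_sub_cancel (∑ i, (c.Y i).1 a • c.x i) a]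
  refine Ideal.add_mem _ ?_ (Ideal.mem_sup_right (c.expand a ha))
  refine Ideal.sum_mem _ fun i _ => Ideal.mem_sup_left ?_
  rw [Algebra.smul_def]
  exact Ideal.mul_mem_left _ _ (Ideal.subset_span ⟨i, rfl⟩)

theorem Coordinates.invDer_sub_mem {ι : Type*} [Fintype ι] [DecidableEq ι]
    (c : Coordinates k A ι) (i j : ι) :
    invDer (c.Y i) (c.x j) - (if i = j then 1 else 0) ∈ augIdeal k A := by
  rw [mem_augIdeal, map_sub, counit_invDer, c.dual]
  split_ifs <;> simp

/-- A point derivation with values in an algebra is determined by its values on coordinates. -/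
theorem Coordinates.sum_smul {ι : Type*} [Fintype ι] [DecidableEq ι] (c : Coordinates k A ι)
    {E : Type*} [CommRing E] [Algebra k E] {δ : A →ₗ[k] E}
    (hδ : ∀ a b : A, δ (a * b) = Coalgebra.counit (R := k) a • δ b +
      Coalgebra.counit (R := k) b • δ a) (a : A) :
    δ a = ∑ i, (c.Y i).1 a • δ (c.x i) := by
  have h1 : δ 1 = 0 := by simpa using hδ 1 1
  have h2 : ∀ z ∈ augIdeal k A ^ 2, δ z = 0 := by
    intro z hz
    rw [pow_two] at hz
    refine Submodule.mul_induction_on hz (fun p hp q hq => ?_) (fun p q hp hq => ?_)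
    · rw [hδ, mem_augIdeal.1 hp, mem_augIdeal.1 hq]; simp
    · rw [map_add, hp, hq, add_zero]
  have h3 := h2 _ (c.expand _ (sub_counit_mem_augIdeal (k := k) a))
  simp only [map_sub, map_sum, map_smul, Algebra.algebraMap_eq_smul_one, h1, smul_zero,
    pointDerivations_one (c.Y _).2, sub_zero, sub_eq_zero] at h3
  exact h3

end Coordinates

/-! ### Slices of tensors -/

section Slices

variable {k : Type*} [Field k] {M N : Type*} [AddCommGroup M] [Module k M] [AddCommGroup N]
  [Module k N]

/-- Contraction of the right factor of a tensor with a linear form. -/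
def slice : Module.Dual k N →ₗ[k] (M ⊗[k] N) →ₗ[k] M where
  toFun φ := (TensorProduct.rid k M).toLinearMap ∘ₗ φ.lTensor M
  map_add' φ ψ := by ext; simp
  map_smul' c φ := by ext; simp

@[simp]
theorem slice_tmul (φ : Module.Dual k N) (m : M) (n : N) :
    slice φ (m ⊗ₜ[k] n) = φ n • m := by simp [slice]

theorem eq_zero_of_slice_eq_zero {z : M ⊗[k] N} (h : ∀ φ : Module.Dual k N, slice φ z = 0) :
    z = 0 := by
  classical
  let b := Module.Basis.ofVectorSpace k N
  obtain ⟨c, rfl⟩ := TensorProduct.eq_repr_basis_right b z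
  have : c = 0 := by
    ext i
    have := h (b.coord i)
    rw [Finsupp.sum, map_sum] at this
    simpa [Finsupp.single_apply] using this
  simp [this]

theorem finite_range_slice (z : M ⊗[k] N) :
    FiniteDimensional k (LinearMap.range (slice.flip z : Module.Dual k N →ₗ[k] M)) := by
  induction z with
  | zero => rw [map_zero, LinearMap.range_zero]; infer_instance
  | tmul m n =>
    refine Submodule.finiteDimensional_of_le (S₂ := Submodule.span k {m}) ?_
    rintro _ ⟨φ, rfl⟩
    simpa using Submodule.smul_mem _ _ (Submodule.mem_span_singleton_self m)
  | add x y hx hy =>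
    refine Submodule.finiteDimensional_of_le (S₂ := LinearMap.range (slice.flip x) ⊔
      LinearMap.range (slice.flip y)) ?_
    rintro _ ⟨φ, rfl⟩
    rw [map_add]
    exact Submodule.add_mem_sup ⟨φ, rfl⟩ ⟨φ, rfl⟩

end Slices

/-! ### Translation by points with values in an algebra -/

section Translation

variable {k : Type*} [Field k] {A : Type*} [CommRing A] [HopfAlgebra k A]
  {E : Type*} [CommRing E] [Algebra k E]

/-- The extension of an invariant derivation to `E ⊗ A`. -/
def baseDer (E : Type*) [CommRing E] [Algebra k E] (X : pointDerivations k A) :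
    Derivation k (E ⊗[k] A) (E ⊗[k] A) :=
  Derivation.mk' ((invDer X).toLinearMap.lTensor E) (by
    intro z w
    induction z with
    | zero => simp
    | add x y hx hy => simp only [map_add, hx, hy, add_mul, add_smul, smul_add]; abel
    | tmul x y =>
      induction w with
      | zero => simp
      | add x y hx hy => simp only [map_add, hx, hy, mul_add, add_smul, smul_add]; abel
      | tmul p q =>
        simp [Algebra.TensorProduct.tmul_mul_tmul, tmul_add, mul_comm p x])

@[simp]
theorem baseDer_tmul (X : pointDerivations k A) (e : E) (a : A) :
    baseDer E X (e ⊗ₜ a) = e ⊗ₜ invDer X a := rfl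

/-- The evaluation `E ⊗ A → E` at an `E`-valued point. -/
def evalAt (y : A →ₐ[k] E) : E ⊗[k] A →ₐ[k] E :=
  Algebra.TensorProduct.lift (AlgHom.id k E) y fun _ _ => Commute.all _ _

@[simp]
theorem evalAt_tmul (y : A →ₐ[k] E) (e : E) (a : A) : evalAt y (e ⊗ₜ a) = e * y a := by
  simp [evalAt]

/-- Left translation by an `E`-valued point, `a ↦ y(a₍₁₎) ⊗ a₍₂₎`. -/
def translate (y : A →ₐ[k] E) : A →ₐ[k] E ⊗[k] A :=
  (Algebra.TensorProduct.map y (AlgHom.id k A)).comp (Bialgebra.comulAlgHom k A)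

theorem translate_eq (y : A →ₐ[k] E) : translate y =
    ((WithConv.toConv ((Algebra.TensorProduct.includeLeft : E →ₐ[k] E ⊗[k] A).comp y) *
      WithConv.toConv Algebra.TensorProduct.includeRight : Points k A (E ⊗[k] A))).ofConv := by
  rw [AlgHom.convMul_def]
  ext a
  simp only [translate, AlgHom.comp_apply, Bialgebra.comulAlgHom_apply]
  generalize Coalgebra.comul (R := k) a = z
  induction z with
  | zero => simp
  | add x y hx hy => simp only [map_add, hx, hy]
  | tmul p q => simp

/-- The inverse of left translation, as an endomorphism of `E ⊗ A`. -/
def translateInv (y : A →ₐ[k] E) : E ⊗[k] A →ₐ[k] E ⊗[k] A :=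
  Algebra.TensorProduct.lift Algebra.TensorProduct.includeLeft
    (((WithConv.toConv ((Algebra.TensorProduct.includeLeft : E →ₐ[k] E ⊗[k] A).comp y))⁻¹ *
      WithConv.toConv Algebra.TensorProduct.includeRight : Points k A (E ⊗[k] A))).ofConv
    fun _ _ => Commute.all _ _

theorem translateInv_comp_left (y : A →ₐ[k] E) :
    (translateInv y).comp Algebra.TensorProduct.includeLeft =
      Algebra.TensorProduct.includeLeft := by
  simp [translateInv]

theorem translateInv_comp_right (y : A →ₐ[k] E) :
    (translateInv y).comp Algebra.TensorProduct.includeRight =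
    (((WithConv.toConv ((Algebra.TensorProduct.includeLeft : E →ₐ[k] E ⊗[k] A).comp y))⁻¹ *
      WithConv.toConv Algebra.TensorProduct.includeRight : Points k A (E ⊗[k] A))).ofConv := by
  simp [translateInv]

theorem translateInv_translate (y : A →ₐ[k] E) (a : A) :
    translateInv y (translate y a) = 1 ⊗ₜ a := by
  have : (translateInv y).comp (translate y) = Algebra.TensorProduct.includeRight := by
    rw [translate_eq, AlgHom.comp_convMul_distrib]
    simp only [WithConv.ofConv_toConv, ← AlgHom.comp_assoc, translateInv_comp_left,
      translateInv_comp_right, WithConv.toConv_ofConv, mul_inv_cancel_left]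
  exact DFunLike.congr_fun this a

theorem translateInv_tmul_one (y : A →ₐ[k] E) (e : E) :
    translateInv y (e ⊗ₜ 1) = e ⊗ₜ 1 := DFunLike.congr_fun (translateInv_comp_left y) e

theorem comp_inv {E' : Type*} [CommRing E'] [Algebra k E'] (h : E →ₐ[k] E')
    (g : Points k A E) : h.comp (g⁻¹).ofConv = ((WithConv.toConv (h.comp g.ofConv))⁻¹ :
      Points k A E').ofConv := rfl

/-- Translation by `y⁻¹` carries the graph of `y` to the neutral section. -/
theorem evalAt_translateInv (y : A →ₐ[k] E) (z : E ⊗[k] A) :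
    evalAt y (translateInv y z) =
      evalAt ((Algebra.ofId k E).comp (Bialgebra.counitAlgHom k A)) z := by
  have h1 : (evalAt y).comp Algebra.TensorProduct.includeLeft = AlgHom.id k E := by
    ext; simp
  have h2 : (evalAt y).comp Algebra.TensorProduct.includeRight = y := by
    ext; simp
  have : (evalAt y).comp (translateInv y) =
      evalAt ((Algebra.ofId k E).comp (Bialgebra.counitAlgHom k A)) := by
    apply Algebra.TensorProduct.ext
    · rw [AlgHom.comp_assoc, translateInv_comp_left, h1]
      ext; simp
    · change ((evalAt y).comp (translateInv y)).comp Algebra.TensorProduct.includeRight =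
        (evalAt _).comp Algebra.TensorProduct.includeRight
      rw [AlgHom.comp_assoc, translateInv_comp_right, AlgHom.comp_convMul_distrib, comp_inv]
      simp only [← AlgHom.comp_assoc, h1, h2, WithConv.toConv_ofConv,
        AlgHom.id_comp, inv_mul_cancel]
      ext a
      simp
  exact DFunLike.congr_fun this z

theorem baseDer_translate (X : pointDerivations k A) (y : A →ₐ[k] E) (a : A) :
    baseDer E X (translate y a) = translate y (invDer X a) := by
  simp only [translate, AlgHom.comp_apply, Bialgebra.comulAlgHom_apply, invDer_apply,
    comul_contract]
  generalize Coalgebra.comul (R := k) a = z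
  induction z with
  | zero => simp
  | add x y hx hy => simp only [map_add, hx, hy]
  | tmul p q => simp [invDer_apply]

theorem evalAt_counit_translate (y : A →ₐ[k] E) (a : A) :
    evalAt ((Algebra.ofId k E).comp (Bialgebra.counitAlgHom k A)) (translate y a) = y a := by
  rw [← evalAt_translateInv y, translateInv_translate]
  simp

theorem sub_evalAt_counit_mem (z : E ⊗[k] A) :
    z - evalAt ((Algebra.ofId k E).comp (Bialgebra.counitAlgHom k A)) z ⊗ₜ 1 ∈
      (augIdeal k A).map (Algebra.TensorProduct.includeRight : A →ₐ[k] E ⊗[k] A) := by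
  induction z with
  | zero => simp
  | add x y hx hy =>
    rw [map_add, add_tmul, add_sub_add_comm]
    exact Ideal.add_mem _ hx hy
  | tmul e a =>
    have : e ⊗ₜ[k] a - evalAt ((Algebra.ofId k E).comp (Bialgebra.counitAlgHom k A)) (e ⊗ₜ a) ⊗ₜ 1 =
        (e ⊗ₜ[k] (1 : A)) * (Algebra.TensorProduct.includeRight : A →ₐ[k] E ⊗[k] A)
          (a - algebraMap k A (Coalgebra.counit (R := k) a)) := by
      simp only [evalAt_tmul, Algebra.TensorProduct.includeRight_apply, mul_one, tmul_sub,
        AlgHom.comp_apply, Bialgebra.counitAlgHom_apply, Algebra.ofId_apply,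
        Algebra.algebraMap_eq_smul_one, tmul_smul, smul_tmul, mul_smul_comm, mul_sub,
        Algebra.TensorProduct.tmul_mul_tmul, one_mul]
    rw [this]
    exact Ideal.mul_mem_left _ _ (Ideal.mem_map_of_mem _ (sub_counit_mem_augIdeal a))

/-- A family of functions on `G × Spec E` which vanishes on the neutral section and is stable
under the invariant derivations vanishes near that section; translated by a point `y`, this gives
vanishing near the graph of `y`. -/
theorem exists_evalAt_eq_one_mul_translateInv_eq_zero [CharZero k] [Algebra.FiniteType k A]
    [Algebra.FiniteType k E] (y : A →ₐ[k] E) {N : Set (E ⊗[k] A)}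
    (hN : ∀ z ∈ N, evalAt ((Algebra.ofId k E).comp (Bialgebra.counitAlgHom k A)) z = 0)
    (hD : ∀ X : pointDerivations k A, ∀ z ∈ N, baseDer E X z ∈ N) {z : E ⊗[k] A} (hz : z ∈ N) :
    ∃ σ : E ⊗[k] A, evalAt y σ = 1 ∧ σ * translateInv y z = 0 := by
  obtain ⟨n, n', c, -, -⟩ := exists_coordinates (k := k) (A := A) (I := ⊥) bot_le
  have : Algebra.FiniteType k (E ⊗[k] A) := Algebra.FiniteType.trans
    (inferInstanceAs (Algebra.FiniteType k E)) (inferInstance : Algebra.FiniteType E (E ⊗[k] A))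
  have : IsNoetherianRing (E ⊗[k] A) := Algebra.FiniteType.isNoetherianRing k _
  let ev : E ⊗[k] A →ₐ[k] E := evalAt ((Algebra.ofId k E).comp (Bialgebra.counitAlgHom k A))
  let ir : A →ₐ[k] E ⊗[k] A := Algebra.TensorProduct.includeRight
  have hev : ∀ a : A, ev (ir a) = algebraMap k E (Coalgebra.counit (R := k) a) := by
    intro a
    simp [ev, ir, Algebra.ofId_apply]
  -- The ideal of the neutral section is extended from the augmentation ideal, so the coordinates of
  -- `A` and their dual derivations also serve transversally to this section.
  have hle : (augIdeal k A).map ir ≤ RingHom.ker ev := by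
    rw [Ideal.map_le_iff_le_comap]
    intro a ha
    rw [Ideal.mem_comap, RingHom.mem_ker, hev, mem_augIdeal.1 ha, map_zero]
  have hge : RingHom.ker ev ≤ (augIdeal k A).map ir := by
    intro w hw
    have h1 := sub_evalAt_counit_mem w
    rw [RingHom.mem_ker] at hw
    change w - ev w ⊗ₜ 1 ∈ _ at h1
    rw [hw] at h1
    simpa using h1
  have hgen : RingHom.ker ev ≤ Ideal.span (Set.range (fun i => ir (c.x i))) ⊔
      RingHom.ker ev ^ 2 := by
    refine hge.trans ((Ideal.map_mono c.augIdeal_le).trans ?_)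
    rw [Ideal.map_sup, Ideal.map_span, Ideal.map_pow, ← Set.range_comp]
    exact sup_le_sup le_rfl (Ideal.pow_right_mono hle 2)
  have hmem := mem_iInf_pow_of_stable (k := k) (𝔪 := RingHom.ker ev)
    (x := fun i => ir (c.x i)) (D := fun i => baseDer E (c.Y i))
    (fun i => hle (Ideal.mem_map_of_mem _ (c.mem i))) hgen
    (fun i j => by
      have h := hle (Ideal.mem_map_of_mem ir (c.invDer_sub_mem i j))
      convert h using 1
      simp only [ir, map_sub, Algebra.TensorProduct.includeRight_apply, baseDer_tmul]
      split_ifs <;> simp [Algebra.TensorProduct.one_def])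
    hN (fun i => hD (c.Y i)) hz
  -- Krull's theorem gives `s`, equal to `1` along the neutral section, that kills `z`; its
  -- translate is `1` along the graph of `y`.
  obtain ⟨s, hs, hsz⟩ := exists_sub_one_mem_mul_eq_zero hmem
  refine ⟨translateInv y s, ?_, by rw [← map_mul, hsz, map_zero]⟩
  rw [evalAt_translateInv]
  change ev s = 1
  rw [RingHom.mem_ker, map_sub, map_one, sub_eq_zero] at hs
  exact hs.symm

/-- A derivation lowers the order of vanishing by at most one. -/
theorem invDer_mem_iInf_pow (X : pointDerivations k A) {f : A}
    (hf : f ∈ ⨅ n : ℕ, augIdeal k A ^ n) : invDer X f ∈ ⨅ n : ℕ, augIdeal k A ^ n := by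
  have key : ∀ n : ℕ, ∀ f ∈ augIdeal k A ^ (n + 1), invDer X f ∈ augIdeal k A ^ n := by
    intro n
    induction n with
    | zero => simp
    | succ n ih =>
      intro f hf
      rw [pow_succ] at hf
      refine Submodule.mul_induction_on hf (fun p hp q hq => ?_) (fun p q hp hq => ?_)
      · rw [Derivation.leibniz]
        refine Ideal.add_mem _ (Ideal.mul_mem_right _ _ hp) ?_
        rw [smul_eq_mul, mul_comm, pow_succ]
        exact Ideal.mul_mem_mul (ih p hp) hq
      · rw [map_add]; exact Ideal.add_mem _ hp hq
  rw [Ideal.mem_iInf] at hf ⊢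
  exact fun n => key n f (hf (n + 1))

theorem _root_.Derivation.isNilpotent_apply [CharZero k] {R : Type*} [CommRing R] [Algebra k R]
    (D : Derivation k R R) {f : R} (hf : IsNilpotent f) : IsNilpotent (D f) := by
  obtain ⟨n, hn⟩ := hf
  -- Differentiate `f ^ (l + 1) * D f ^ (2 * m) = 0` and multiply by `D f`: one factor `f` is traded
  -- for two factors `D f`, and the term with `D (D f)` vanishes by the induction hypothesis.
  have key : ∀ m ≤ n, f ^ (n - m) * D f ^ (2 * m) = 0 := by
    intro m
    induction m with
    | zero => simp [hn]
    | succ m ih =>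
      intro hm
      obtain ⟨l, hl⟩ : ∃ l, n - m = l + 1 := ⟨n - m - 1, by omega⟩
      have hl' : n - (m + 1) = l := by omega
      have h := ih (by omega)
      rw [hl] at h
      have h2 := congrArg D h
      rw [Derivation.leibniz, Derivation.leibniz_pow, Derivation.leibniz_pow, map_zero] at h2
      simp only [Nat.add_sub_cancel, smul_eq_mul, nsmul_eq_mul] at h2
      rw [hl']
      have h3 : ((l + 1 : ℕ) : R) * (f ^ l * D f ^ (2 * (m + 1))) = 0 := by
        rcases m with _ | m
        · simp only [mul_zero, pow_zero, mul_one, Nat.cast_zero, zero_mul, one_mul, zero_add] at h2 ⊢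
          calc _ = D f * ((((l + 1 : ℕ) : R)) * (f ^ l * D f)) := by push_cast; ring
            _ = 0 := by rw [h2, mul_zero]
        · have h4 : D f ^ (2 * (m + 1)) = D f ^ (2 * (m + 1) - 1) * D f := by
            rw [← pow_succ]; congr 1
          calc _ = D f * (f ^ (l + 1) * (((2 * (m + 1) : ℕ) : R) *
                (D f ^ (2 * (m + 1) - 1) * D (D f))) +
                D f ^ (2 * (m + 1)) * (((l + 1 : ℕ) : R) * (f ^ l * D f))) -
                ((2 * (m + 1) : ℕ) : R) * D (D f) *
                  (f ^ (l + 1) * (D f ^ (2 * (m + 1) - 1) * D f)) := by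
                push_cast; ring
            _ = 0 := by rw [h2, ← h4, h]; ring
      have h5 := congrArg (fun t => algebraMap k R ((l + 1 : ℕ) : k)⁻¹ * t) h3
      simp only [← mul_assoc, ← map_natCast (algebraMap k R), ← map_mul, mul_zero] at h5
      rw [inv_mul_cancel₀ (by exact_mod_cast Nat.succ_ne_zero l), map_one, one_mul] at h5
      exact h5
  exact ⟨2 * n, by simpa using key n le_rfl⟩

end Translation

/-! ### Consequences of connectedness: infinite order, reducedness, constants -/

section Constants

theorem eq_zero_or_one_of_isIdempotentElem {R : Type*} [CommRing R]
    [ConnectedSpace (PrimeSpectrum R)] {e : R} (he : IsIdempotentElem e) : e = 0 ∨ e = 1 := by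
  rcases isClopen_iff.1 (PrimeSpectrum.isClopen_iff.2 ⟨e, he, rfl⟩) with h | h
  · refine Or.inl (PrimeSpectrum.basicOpen_injOn_isIdempotentElem he IsIdempotentElem.zero ?_)
    exact SetLike.coe_injective (h.trans (by simp))
  · refine Or.inr (PrimeSpectrum.basicOpen_injOn_isIdempotentElem he IsIdempotentElem.one ?_)
    exact SetLike.coe_injective (h.trans (by simp))

variable {k : Type*} [Field k] [CharZero k] {A : Type*} [CommRing A] [HopfAlgebra k A]
  [Algebra.FiniteType k A]

-- The intersection `J` is stable under invariant derivations, so translating by the tautological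
-- point of `V(J)` shows that each `f ∈ J` is killed by a function congruent to `1` modulo `J`. Thus
-- `J` is idempotent, hence generated by an idempotent, and connectedness leaves only `0`.
variable (k A) in
theorem iInf_augIdeal_pow_eq_bot [ConnectedSpace (PrimeSpectrum A)] :
    ⨅ n : ℕ, augIdeal k A ^ n = ⊥ := by
  have hnoeth : IsNoetherianRing A := Algebra.FiniteType.isNoetherianRing k A
  set J : Ideal A := ⨅ n : ℕ, augIdeal k A ^ n with hJ
  have hJm : J ≤ augIdeal k A := (iInf_le _ 1).trans (by rw [pow_one])
  have key : ∀ f ∈ J, ∃ j ∈ J, j * f = f := by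
    intro f hf
    obtain ⟨σ, h1, h2⟩ := exists_evalAt_eq_one_mul_translateInv_eq_zero
      (E := A ⧸ J) (Ideal.Quotient.mkₐ k J) (N := translate (Ideal.Quotient.mkₐ k J) '' J)
      (by
        rintro _ ⟨g, hg, rfl⟩
        rw [evalAt_counit_translate]
        exact Ideal.Quotient.eq_zero_iff_mem.2 hg)
      (by
        rintro X _ ⟨g, hg, rfl⟩
        exact ⟨_, invDer_mem_iInf_pow X hg, (baseDer_translate _ _ _).symm⟩)
      ⟨f, hf, rfl⟩
    rw [translateInv_translate] at h2
    -- Write `σ = ∑ bᵢ ⊗ cᵢ`. Then `cᵢ f = 0` for all `i`, while `∑ tᵢ cᵢ` is `1` modulo `J` for any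
    -- lifts `tᵢ` of `bᵢ`.
    let b := Module.Basis.ofVectorSpace k (A ⧸ J)
    obtain ⟨c, rfl⟩ := TensorProduct.eq_repr_basis_left b σ
    have hc : ∀ i, c i * f = 0 := by
      have : c.mapRange (fun a => a * f) (zero_mul f) = 0 := by
        apply TensorProduct.sum_tmul_basis_left_eq_zero b
        rw [Finsupp.sum_mapRange_index (by simp)]
        rw [Finsupp.sum, Finset.sum_mul] at h2
        simpa [Finsupp.sum] using h2
      intro i
      simpa using DFunLike.congr_fun this i
    choose t ht using fun i => Ideal.Quotient.mk_surjective (I := J) (b i)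
    refine ⟨1 - c.sum fun i a => t i * a, ?_, ?_⟩
    · rw [← Ideal.Quotient.eq_zero_iff_mem, map_sub, map_one, ← h1, sub_eq_zero, Finsupp.sum,
        Finsupp.sum, map_sum, map_sum]
      simp [ht]
    · rw [sub_mul, one_mul, Finsupp.sum, Finset.sum_mul]
      simp [mul_assoc, hc]
  have hid : IsIdempotentElem J := by
    refine le_antisymm Ideal.mul_le_left fun f hf => ?_
    obtain ⟨j, hj, hjf⟩ := key f hf
    rw [← hjf]
    exact Ideal.mul_mem_mul hj hf
  obtain ⟨e, he, heJ⟩ := (Ideal.isIdempotentElem_iff_of_fg J (IsNoetherian.noetherian J)).1 hid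
  rcases eq_zero_or_one_of_isIdempotentElem he with rfl | rfl
  · simp at heJ; exact heJ
  · have : (1 : A) ∈ augIdeal k A := hJm (by rw [heJ]; exact Ideal.mem_span_singleton_self 1)
    rw [mem_augIdeal] at this
    simp at this

/-- On a connected group, a set of functions vanishing at the neutral element and stable under
the invariant derivations is trivial. -/
theorem eq_zero_of_stable [ConnectedSpace (PrimeSpectrum A)] {N : Set A}
    (hN : ∀ f ∈ N, Coalgebra.counit (R := k) f = 0)
    (hD : ∀ X : pointDerivations k A, ∀ f ∈ N, invDer X f ∈ N) {f : A} (hf : f ∈ N) : f = 0 := by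
  obtain ⟨n, n', c, -, -⟩ := exists_coordinates (k := k) (A := A) (I := ⊥) bot_le
  have := mem_iInf_pow_of_stable (k := k) c.mem c.augIdeal_le c.invDer_sub_mem hN
    (fun i => hD (c.Y i)) hf
  rwa [iInf_augIdeal_pow_eq_bot k A] at this

/-- In characteristic zero derivations preserve the nilradical, whose elements vanish at the
identity. -/
theorem isReduced_of_connected (k : Type*) [Field k] [CharZero k] (A : Type*) [CommRing A]
    [HopfAlgebra k A] [Algebra.FiniteType k A] [ConnectedSpace (PrimeSpectrum A)] :
    IsReduced A := by
  refine ⟨fun f₀ hf₀ => eq_zero_of_stable (k := k) (N := {f : A | IsNilpotent f}) ?_ ?_ hf₀⟩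
  · intro f hf
    exact (hf.map (Bialgebra.counitAlgHom k A)).eq_zero
  · intro X f hf
    exact (invDer X).isNilpotent_apply hf

/-- A function killed by the Lie algebra is locally constant, hence algebraic. -/
theorem isIntegral_of_invDer_eq_zero {b : A} (hb : ∀ X : pointDerivations k A, invDer X b = 0) :
    IsIntegral k b := by
  -- The function `b(gh) - b(g)` vanishes at `h = 1` and is killed by the derivations in `h`. Hence
  -- some `σ`, equal to `1` on the diagonal, kills `1 ⊗ b - b ⊗ 1`.
  obtain ⟨σ, h1, h2⟩ := exists_evalAt_eq_one_mul_translateInv_eq_zero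
    (E := A) (AlgHom.id k A) (N := {0, translate (AlgHom.id k A) b - b ⊗ₜ 1})
    (by
      rintro _ (rfl | rfl)
      · simp
      · rw [map_sub, evalAt_counit_translate]; simp)
    (by
      rintro X _ (rfl | rfl)
      · simp
      · simp [baseDer_translate, hb])
    (by simp : translate (AlgHom.id k A) b - b ⊗ₜ 1 ∈ _)
  rw [map_sub, translateInv_translate, translateInv_tmul_one, mul_sub, sub_eq_zero] at h2
  -- The slices of `σ` span a finite dimensional space stable under multiplication by `b`. By
  -- Cayley–Hamilton a monic polynomial in `b` kills all slices, hence `σ`; on the diagonal, where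
  -- `σ` is `1`, this polynomial in `b` is zero.
  let S : Submodule k A := LinearMap.range (slice.flip σ)
  have hfin : FiniteDimensional k S := finite_range_slice σ
  have hmul : ∀ (a : A) (φ : Module.Dual k A) (z : A ⊗[k] A),
      slice φ (z * a ⊗ₜ 1) = a * slice φ z := by
    intro a φ z
    induction z with
    | zero => simp
    | add x y hx hy => simp only [add_mul, map_add, hx, hy, mul_add]
    | tmul p q => simp [mul_comm]
  have hmul' : ∀ (a : A) (φ : Module.Dual k A) (z : A ⊗[k] A),
      slice φ (z * 1 ⊗ₜ a) = slice (φ ∘ₗ LinearMap.mulLeft k a) z := by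
    intro a φ z
    induction z with
    | zero => simp
    | add x y hx hy => simp only [add_mul, map_add, hx, hy]
    | tmul p q => simp [mul_comm]
  have hS : ∀ s ∈ S, LinearMap.mulLeft k b s ∈ S := by
    rintro _ ⟨φ, rfl⟩
    refine ⟨φ ∘ₗ LinearMap.mulLeft k b, ?_⟩
    simp only [LinearMap.flip_apply, LinearMap.mulLeft_apply]
    rw [← hmul, ← hmul', h2]
  let T : Module.End k S := (LinearMap.mulLeft k b).restrict hS
  refine ⟨T.charpoly, T.charpoly_monic, ?_⟩
  have hT : ∀ (p : Polynomial k) (s : S), ((Polynomial.aeval T p) s : A) =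
      Polynomial.aeval b p * s := by
    intro p s
    induction p using Polynomial.induction_on' with
    | add p q hp hq => simp [hp, hq, add_mul]
    | monomial n a =>
      have : ∀ (n : ℕ) (s : S), ((T ^ n) s : A) = b ^ n * s := by
        intro n
        induction n with
        | zero => simp
        | succ n ih =>
          intro s
          rw [pow_succ, Module.End.mul_apply, ih, pow_succ, mul_assoc]
          rfl
      simp [Polynomial.aeval_monomial, this, Algebra.smul_def, mul_assoc]
  have hz : σ * (Polynomial.aeval b T.charpoly) ⊗ₜ 1 = 0 := by
    apply eq_zero_of_slice_eq_zero
    intro φ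
    rw [hmul]
    have := hT T.charpoly ⟨slice φ σ, φ, rfl⟩
    rw [LinearMap.aeval_self_charpoly] at this
    simpa using this.symm
  have := congrArg (evalAt (AlgHom.id k A)) hz
  rw [map_mul, h1] at this
  simpa [Polynomial.aeval_def] using this

end Constants

/-! ### Completeness of `G / P`: functions killed by `Lie P` are constant -/

section Properness

variable {A : Type} [CommRing A] [HopfAlgebra ℚ A]

open Polynomial in
/-- If the right translates of `f` by the parabolic subgroup `P = Spec (A ⧸ I)` are integral over
the functions on `G`, then `f` is algebraic: the quotient `G / P` being complete, `f` cannot have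
poles. -/
theorem isAlgebraic_of_isIntegral_coaction {I : Ideal A} [I.IsHopfIdeal ℚ] (hP : IsParabolic I)
    {f : A} (hf : IsIntegral A (((Algebra.TensorProduct.map (AlgHom.id ℚ A)
      (Ideal.Quotient.mkₐ ℚ I)).comp (Bialgebra.comulAlgHom ℚ A)) f : A ⊗[ℚ] (A ⧸ I))) :
    IsAlgebraic ℚ f := by
  obtain ⟨_, s, π, hπ, hs⟩ := hP
  obtain ⟨P, hPmonic, hP0⟩ := hf
  let ρ : A →+* A ⊗[ℚ] (A ⧸ I) := ((Algebra.TensorProduct.map (AlgHom.id ℚ A)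
      (Ideal.Quotient.mkₐ ℚ I)).comp (Bialgebra.comulAlgHom ℚ A)).toRingHom
  let il : A →+* A ⊗[ℚ] (A ⧸ I) := (Algebra.TensorProduct.includeLeft : A →ₐ[ℚ] _).toRingHom
  let : Algebra ℚ[X] A[X] := Polynomial.algebra ℚ A
  let : Algebra A[X] (A ⊗[ℚ] (A ⧸ I))[X] := Polynomial.algebra A _
  let base : Spec (.of ℚ[X]) ⟶ Spec (.of ℚ) := Spec.map (CommRingCat.ofHom C)
  let a : Spec (.of A[X]) ⟶ Spec (.of A) := Spec.map (CommRingCat.ofHom C)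
  let b : Spec (.of (A ⊗[ℚ] (A ⧸ I))[X]) ⟶ Spec (.of (A ⊗[ℚ] (A ⧸ I))) :=
    Spec.map (CommRingCat.ofHom C)
  let t : Spec (.of A[X]) ⟶ Spec (.of ℚ[X]) :=
    Spec.map (CommRingCat.ofHom (mapRingHom (algebraMap ℚ A)))
  let pr : Spec (.of (A ⊗[ℚ] (A ⧸ I))[X]) ⟶ Spec (.of A[X]) :=
    Spec.map (CommRingCat.ofHom (mapRingHom il))
  let tr : Spec (.of (A ⊗[ℚ] (A ⧸ I))[X]) ⟶ Spec (.of A[X]) :=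
    Spec.map (CommRingCat.ofHom (mapRingHom ρ))
  have hG : IsPullback a t (π ≫ s) base := by
    rw [hπ.comm]
    exact isPullback_SpecMap_of_isPushout _ _ _ _ (CommRingCat.isPushout_of_isPushout ℚ A ℚ[X] A[X])
  have hZ : IsPullback b pr (projection I) a :=
    isPullback_SpecMap_of_isPushout _ _ _ _
      (CommRingCat.isPushout_of_isPushout A (A ⊗[ℚ] (A ⧸ I)) A[X] (A ⊗[ℚ] (A ⧸ I))[X])
  -- `q` is the base change `G × 𝔸¹ → G/P × 𝔸¹` of `π`. It is open and surjective, and its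
  -- self-fibre product is `G × P × 𝔸¹`.
  let q : Spec (.of A[X]) ⟶ Limits.pullback s base :=
    Limits.pullback.lift (a ≫ π) t (by rw [Category.assoc]; exact hG.w)
  have hq1 : q ≫ Limits.pullback.fst s base = a ≫ π := Limits.pullback.lift_fst _ _ _
  have hq2 : q ≫ Limits.pullback.snd s base = t := Limits.pullback.lift_snd _ _ _
  have hqpb : IsPullback a q π (Limits.pullback.fst s base) := by
    refine IsPullback.of_bot ?_ hq1.symm (IsPullback.of_hasPullback s base)
    rw [hq2]
    exact hG
  have htrb : tr ≫ a = b ≫ translation I := by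
    simp only [tr, a, b, translation, ← Spec.map_comp, ← CommRingCat.ofHom_comp]
    congr 2
    exact mapRingHom_comp_C ρ
  have hpt : tr ≫ t = pr ≫ t := by
    simp only [tr, t, pr, ← Spec.map_comp, ← CommRingCat.ofHom_comp, mapRingHom_comp]
    congr 3
    exact Subsingleton.elim _ _
  have hsq : IsPullback tr pr q q := by
    refine IsPullback.of_right ?_ ?_ hqpb
    · rw [htrb, hq1]
      exact hZ.paste_horiz hπ.isPullback.flip
    · apply Limits.pullback.hom_ext
      · simp only [Category.assoc, hq1]
        rw [← Category.assoc, htrb, Category.assoc, ← hπ.isPullback.w, ← Category.assoc, hZ.w,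
          Category.assoc]
      · simp only [Category.assoc, hq2, hpt]
  have := hπ.flat
  have := hπ.surjective
  have := hπ.finitePresentation
  have hqopen : UniversallyOpen q := MorphismProperty.of_isPullback hqpb inferInstance
  have hqsurj : Surjective q := MorphismProperty.of_isPullback hqpb hπ.surjective
  by_contra htrans
  -- `c` is the graph of `1 / f` over the locus `f ≠ 0`. The closure of its image in `G/P × 𝔸¹` is
  -- shown both to meet and to miss the fibre over `0`.
  let κ : A[X] →+* Localization.Away f :=
    eval₂RingHom (algebraMap A _) (IsLocalization.Away.invSelf f)
  let c : Spec (.of (Localization.Away f)) ⟶ Spec (.of A[X]) := Spec.map (CommRingCat.ofHom κ)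
  let V : Set (Spec (.of A[X])) := PrimeSpectrum.zeroLocus {P.reverse}
  have hVclosed : IsClosed V := PrimeSpectrum.isClosed_zeroLocus _
  -- A point `(g, t)` of this preimage satisfies `t f(gp) = 1` for some `p`. Since `f(gp)` is a root
  -- of the monic `P` with coefficients depending on `g` alone, `t` is a root of `P.reverse`.
  have hsub : q ⁻¹' (q '' Set.range c) ⊆ V := by
    rintro z ⟨_, ⟨y, rfl⟩, hy⟩
    obtain ⟨w, hw1, hw2⟩ := Scheme.exists_preimage_of_isPullback hsq _ _ hy
    rw [← hw2]
    have h1 : (1 - X * C f : A[X]) ∈ (c y).asIdeal := by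
      change κ (1 - X * C f) ∈ y.asIdeal
      have : κ (1 - X * C f) = 0 := by
        simp [κ, IsLocalization.Away.mul_invSelf]
      rw [this]
      exact zero_mem _
    have h2 : (1 - X * C (ρ f) : (A ⊗[ℚ] (A ⧸ I))[X]) ∈ w.asIdeal := by
      have h3 : (1 - X * C f : A[X]) ∈ (tr w).asIdeal := by
        have : (tr w) = c y := hw1
        rw [this]; exact h1
      have h4 : mapRingHom ρ (1 - X * C f) ∈ w.asIdeal := h3
      simpa using h4
    have hrev : ∀ p ∈ ({P.reverse} : Set A[X]), p ∈ (pr w).asIdeal := by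
      rintro _ rfl
      change mapRingHom il P.reverse ∈ w.asIdeal
      have hw : w.asIdeal.IsPrime := w.isPrime
      let Q := Ideal.Quotient.mk w.asIdeal
      have hinv : Q X * Q (C (ρ f)) = 1 := by
        rw [← map_mul, ← map_one Q, eq_comm, Ideal.Quotient.eq]
        exact h2
      let : Invertible (Q (C (ρ f))) := ⟨Q X, hinv, by rw [mul_comm]; exact hinv⟩
      have h5 := (eval₂_reverse_eq_zero_iff (Q.comp (C.comp il)) (Q (C (ρ f))) P).2 (by
        have h6 := congrArg (Q.comp C) hP0
        rw [hom_eval₂, map_zero] at h6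
        exact h6)
      rw [← Ideal.Quotient.eq_zero_iff_mem]
      change Q _ = 0
      have h7 : (mapRingHom il P.reverse) = eval₂ (C.comp il) X P.reverse := by
        rw [coe_mapRingHom, Polynomial.map]
      rw [h7, hom_eval₂]
      exact h5
    exact hrev
  have hD : q ⁻¹' closure (q '' Set.range c) ⊆ V := by
    rw [q.isOpenMap.preimage_closure_eq_closure_preimage q.continuous]
    exact closure_minimal hsub hVclosed
  have hclosed : IsClosed ((Limits.pullback.snd s base) '' closure (q '' Set.range c)) :=
    (Limits.pullback.snd s base).isClosedMap _ isClosed_closure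
  -- If the image in the affine line were not dense, `1 / f`, and with it `f`, would be algebraic.
  -- The image is also closed because `G/P` is proper, so it contains the origin.
  have hdense : Dense ((Limits.pullback.snd s base) '' closure (q '' Set.range c)) := by
    have h1 : DenseRange (PrimeSpectrum.comap (κ.comp (mapRingHom (algebraMap ℚ A)))) := by
      rw [PrimeSpectrum.denseRange_comap_iff_ker_le_nilRadical]
      intro p hp
      by_contra hp0
      have hp0 : p ≠ 0 := fun h => hp0 (h ▸ zero_mem _)
      apply htrans
      rw [RingHom.mem_ker] at hp
      have hp' : eval₂ ((algebraMap A (Localization.Away f)).comp (algebraMap ℚ A))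
          (IsLocalization.Away.invSelf f) p = 0 := by
        rw [← hp]
        simp [κ, eval₂_map]
      let : Invertible (algebraMap A (Localization.Away f) f) :=
        ⟨IsLocalization.Away.invSelf f, by rw [mul_comm, IsLocalization.Away.mul_invSelf],
          IsLocalization.Away.mul_invSelf f⟩
      let : Invertible (IsLocalization.Away.invSelf f : Localization.Away f) :=
        ⟨algebraMap A (Localization.Away f) f, IsLocalization.Away.mul_invSelf f, by
          rw [mul_comm, IsLocalization.Away.mul_invSelf]⟩
      have h2 := (eval₂_reverse_eq_zero_iff _ _ _).2 hp'
      have h3 : algebraMap A (Localization.Away f) (aeval f p.reverse) = 0 := by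
        rw [aeval_def, hom_eval₂]
        exact h2
      obtain ⟨⟨_, n, rfl⟩, hm⟩ := (IsLocalization.map_eq_zero_iff (Submonoid.powers f) _ _).1 h3
      refine ⟨X ^ n * p.reverse, mul_ne_zero (pow_ne_zero _ X_ne_zero) ?_, ?_⟩
      · simpa using hp0
      · simpa using hm
    refine h1.mono ?_
    rintro _ ⟨y, rfl⟩
    refine ⟨q (c y), subset_closure ⟨c y, ⟨y, rfl⟩, rfl⟩, ?_⟩
    rw [← Scheme.Hom.comp_apply, hq2]
    rfl
  have huniv := hdense.closure_eq
  rw [hclosed.closure_eq] at huniv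
  let o : PrimeSpectrum ℚ[X] := ⟨Ideal.span {X}, (Ideal.span_singleton_prime X_ne_zero).2 prime_X⟩
  obtain ⟨d, hd, hdo⟩ : o ∈ (Limits.pullback.snd s base) '' closure (q '' Set.range c) :=
    huniv ▸ Set.mem_univ o
  obtain ⟨z, rfl⟩ := q.surjective d
  have hz : P.reverse ∈ (z : PrimeSpectrum A[X]).asIdeal := hD hd rfl
  rw [← Scheme.Hom.comp_apply, hq2] at hdo
  have hX : (X : A[X]) ∈ (z : PrimeSpectrum A[X]).asIdeal := by
    have h1 : (X : ℚ[X]) ∈ o.asIdeal := Ideal.mem_span_singleton_self X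
    rw [← hdo] at h1
    have h2 : mapRingHom (algebraMap ℚ A) X ∈ (z : PrimeSpectrum A[X]).asIdeal := h1
    simpa using h2
  -- As `P` is monic, `P.reverse` has constant term `1` and cannot vanish at `t = 0`.
  have hone : (1 : A[X]) ∈ (z : PrimeSpectrum A[X]).asIdeal := by
    have h1 := divX_mul_X_add P.reverse
    rw [coeff_zero_reverse, hPmonic.leadingCoeff, map_one] at h1
    have h2 : (1 : A[X]) = P.reverse - P.reverse.divX * X := eq_sub_of_add_eq' h1
    rw [h2]
    exact Ideal.sub_mem _ hz (Ideal.mul_mem_left _ _ hX)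
  exact (z : PrimeSpectrum A[X]).isPrime.ne_top ((Ideal.eq_top_iff_one _).2 hone)

section Quotients

variable {k : Type*} [Field k] {A : Type*} [CommRing A] [HopfAlgebra k A]
  {I : Ideal A} [I.IsHopfIdeal k]

theorem comul_mk (a : A) : Coalgebra.comul (R := k) (Ideal.Quotient.mkₐ k I a) =
    TensorProduct.map (Ideal.Quotient.mkₐ k I).toLinearMap (Ideal.Quotient.mkₐ k I).toLinearMap
      (Coalgebra.comul (R := k) a) := rfl

theorem counit_mk (a : A) : Coalgebra.counit (R := k) (Ideal.Quotient.mkₐ k I a) =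
    Coalgebra.counit (R := k) a := rfl

variable (k) in
theorem le_augIdeal (I : Ideal A) [I.IsHopfIdeal k] : I ≤ augIdeal k A := by
  intro a ha
  rw [mem_augIdeal, ← counit_mk (I := I),
    show Ideal.Quotient.mkₐ k I a = 0 from Ideal.Quotient.eq_zero_iff_mem.2 ha, map_zero]

theorem contract_mk (X : (A ⧸ I) →ₗ[k] k) (a : A) :
    contract X (Ideal.Quotient.mkₐ k I a) =
      Ideal.Quotient.mkₐ k I (contract (X ∘ₗ (Ideal.Quotient.mkₐ k I).toLinearMap) a) := by
  rw [contract_apply, contract_apply, comul_mk]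
  generalize Coalgebra.comul (R := k) a = z
  induction z with
  | zero => simp
  | add x y hx hy => simp only [map_add, hx, hy]
  | tmul p q => simp

/-- The inclusion of the Lie algebra of a closed subgroup. -/
def liftDer (X : pointDerivations k (A ⧸ I)) : pointDerivations k A :=
  ⟨X.1 ∘ₗ (Ideal.Quotient.mkₐ k I).toLinearMap, fun a b => by
    simpa [counit_mk] using X.2 (Ideal.Quotient.mkₐ k I a) (Ideal.Quotient.mkₐ k I b)⟩

theorem liftDer_apply (X : pointDerivations k (A ⧸ I)) (a : A) :
    (liftDer X).1 a = X.1 (Ideal.Quotient.mkₐ k I a) := rfl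

theorem liftDer_of_mem (X : pointDerivations k (A ⧸ I)) {a : A} (ha : a ∈ I) :
    (liftDer X).1 a = 0 := by
  rw [liftDer_apply, show Ideal.Quotient.mkₐ k I a = 0 from Ideal.Quotient.eq_zero_iff_mem.2 ha,
    map_zero]

theorem exists_liftDer_eq {X : pointDerivations k A} (hX : ∀ a ∈ I, X.1 a = 0) :
    ∃ X' : pointDerivations k (A ⧸ I), liftDer X' = X := by
  let X' : (A ⧸ I) →ₗ[k] k := (I.restrictScalars k).liftQ X.1 hX
  have hX' : ∀ a : A, X' (Ideal.Quotient.mkₐ k I a) = X.1 a := fun a => rfl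
  refine ⟨⟨X', fun a b => ?_⟩, Subtype.ext (LinearMap.ext hX')⟩
  obtain ⟨a, rfl⟩ := Ideal.Quotient.mkₐ_surjective k I a
  obtain ⟨b, rfl⟩ := Ideal.Quotient.mkₐ_surjective k I b
  rw [← map_mul, hX', hX', hX', counit_mk, counit_mk]
  exact X.2 a b

theorem invDer_mk (X : pointDerivations k (A ⧸ I)) (a : A) :
    invDer X (Ideal.Quotient.mkₐ k I a) = Ideal.Quotient.mkₐ k I (invDer (liftDer X) a) :=
  contract_mk _ _

/-- The Lie algebra of a closed subgroup preserves its ideal. -/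
theorem invDer_mem {X : pointDerivations k A} (hX : ∀ a ∈ I, X.1 a = 0) {a : A} (ha : a ∈ I) :
    invDer X a ∈ I := by
  obtain ⟨X, rfl⟩ := exists_liftDer_eq hX
  rw [← Ideal.Quotient.eq_zero_iff_mem]
  refine (invDer_mk X a).symm.trans ?_
  rw [show Ideal.Quotient.mkₐ k I a = 0 from Ideal.Quotient.eq_zero_iff_mem.2 ha, map_zero]

/-- Expand `f(gp)` in a basis of the functions of `g`. The coefficients, as functions of `p`, are
killed by the Lie algebra of the subgroup, hence are algebraic constants. No connectedness of the
subgroup is needed. -/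
theorem isIntegral_coaction [CharZero k] [Algebra.FiniteType k A] {f : A}
    (hf : ∀ X : pointDerivations k A, (∀ a ∈ I, X.1 a = 0) → invDer X f = 0) :
    IsIntegral A (((Algebra.TensorProduct.map (AlgHom.id k A)
      (Ideal.Quotient.mkₐ k I)).comp (Bialgebra.comulAlgHom k A)) f : A ⊗[k] (A ⧸ I)) := by
  have : Algebra.FiniteType k (A ⧸ I) :=
    Algebra.FiniteType.of_surjective (Ideal.Quotient.mkₐ k I) (Ideal.Quotient.mkₐ_surjective k I)
  set h : A ⊗[k] (A ⧸ I) := ((Algebra.TensorProduct.map (AlgHom.id k A)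
      (Ideal.Quotient.mkₐ k I)).comp (Bialgebra.comulAlgHom k A)) f with hh
  have hD : ∀ X : pointDerivations k (A ⧸ I), (invDer X).toLinearMap.lTensor A h = 0 := by
    intro X
    have h1 : ∀ z : A ⊗[k] A, (invDer X).toLinearMap.lTensor A
        (Algebra.TensorProduct.map (AlgHom.id k A) (Ideal.Quotient.mkₐ k I) z) =
        Algebra.TensorProduct.map (AlgHom.id k A) (Ideal.Quotient.mkₐ k I)
          ((contract (liftDer X).1).lTensor A z) := by
      intro z
      induction z with
      | zero => simp
      | add x y hx hy => simp only [map_add, hx, hy]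
      | tmul p q =>
        simp only [Algebra.TensorProduct.map_tmul, LinearMap.lTensor_tmul]
        congr 1
        exact invDer_mk X q
    rw [hh, AlgHom.comp_apply, Bialgebra.comulAlgHom_apply, h1, ← comul_contract,
      ← invDer_apply, hf _ fun a ha => liftDer_of_mem X ha]
    simp
  let b := Module.Basis.ofVectorSpace k A
  obtain ⟨c, hc⟩ := TensorProduct.eq_repr_basis_left b h
  have hcX : ∀ i, IsIntegral k (c i) := by
    intro i
    refine isIntegral_of_invDer_eq_zero fun X => ?_
    have h1 : c.mapRange (invDer X) (map_zero _) = 0 := by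
      apply TensorProduct.sum_tmul_basis_left_eq_zero b
      rw [Finsupp.sum_mapRange_index (by simp), ← hD X, ← hc, Finsupp.sum, Finsupp.sum, map_sum]
      simp
    simpa using DFunLike.congr_fun h1 i
  rw [← hc]
  refine IsIntegral.sum _ fun i _ => ?_
  have : b i ⊗ₜ[k] c i = algebraMap A (A ⊗[k] (A ⧸ I)) (b i) *
      (Algebra.TensorProduct.includeRight : (A ⧸ I) →ₐ[k] A ⊗[k] (A ⧸ I)) (c i) := by
    simp [Algebra.TensorProduct.algebraMap_apply]
  beta_reduce
  rw [this]
  exact isIntegral_algebraMap.mul ((hcX i).map _).tower_top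

end Quotients

/-- An algebraic function on a connected group is constant. -/
theorem eq_algebraMap_of_isAlgebraic {k : Type*} [Field k] [CharZero k] {A : Type*} [CommRing A]
    [HopfAlgebra k A] [Algebra.FiniteType k A] [ConnectedSpace (PrimeSpectrum A)] {f : A}
    (hf : IsAlgebraic k f) : f = algebraMap k A (Coalgebra.counit (R := k) f) := by
  have hred := isReduced_of_connected k A
  rw [← sub_eq_zero]
  have hm := sub_counit_mem_augIdeal (k := k) f
  have hg : IsAlgebraic k (f - algebraMap k A (Coalgebra.counit (R := k) f)) :=
    hf.sub (isAlgebraic_algebraMap _)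
  generalize f - algebraMap k A (Coalgebra.counit (R := k) f) = g at hm hg
  obtain ⟨p, hp0, hp⟩ := hg
  obtain ⟨q, hpq, hq0⟩ := Polynomial.exists_eq_pow_rootMultiplicity_mul_and_not_dvd p hp0 0
  set n := p.rootMultiplicity 0
  rw [map_zero, sub_zero] at hpq hq0
  rw [Polynomial.X_dvd_iff] at hq0
  have h1 : g ^ n * Polynomial.aeval g q = 0 := by
    rw [hpq] at hp
    simpa using hp
  have h2 : Polynomial.aeval g q = Polynomial.aeval g q.divX * g + algebraMap k A (q.coeff 0) := by
    conv_lhs => rw [← q.divX_mul_X_add]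
    simp
  -- Write the relation for `g` as `gⁿ q(g) = 0` with `q(0) ≠ 0`. Then `gⁿ` is a multiple of `gⁿ⁺¹`,
  -- hence of all higher powers, and vanishes to infinite order at the identity.
  obtain ⟨r, hr⟩ : ∃ r : A, g ^ n = g ^ (n + 1) * r := by
    refine ⟨-(algebraMap k A (q.coeff 0)⁻¹ * Polynomial.aeval g q.divX), ?_⟩
    have h3 : algebraMap k A (q.coeff 0)⁻¹ * algebraMap k A (q.coeff 0) = 1 := by
      rw [← map_mul, inv_mul_cancel₀ hq0, map_one]
    rw [h2] at h1
    linear_combination (-(g ^ n)) * h3 + algebraMap k A (q.coeff 0)⁻¹ * h1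
  have h4 : ∀ j : ℕ, g ^ n = g ^ (n + j) * r ^ j := by
    intro j
    induction j with
    | zero => simp
    | succ j ih =>
      calc g ^ n = g ^ n * (g ^ j * r ^ j) := by rw [← mul_assoc, ← pow_add]; exact ih
        _ = g ^ (n + 1) * r * (g ^ j * r ^ j) := by rw [← hr]
        _ = _ := by ring
  have h5 : g ^ n ∈ ⨅ j : ℕ, augIdeal k A ^ j := by
    rw [Ideal.mem_iInf]
    intro j
    rw [h4 j, pow_add]
    exact Ideal.mul_mem_right _ _ (Ideal.mul_mem_left _ _ (Ideal.pow_mem_pow hm j))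
  rw [iInf_augIdeal_pow_eq_bot k A] at h5
  exact hred.eq_zero g ⟨n, h5⟩

/-- On a connected group, a function invariant under the Lie algebra of a parabolic subgroup is
constant. -/
theorem IsParabolic.eq_algebraMap [Algebra.FiniteType ℚ A] [ConnectedSpace (PrimeSpectrum A)]
    {I : Ideal A} [I.IsHopfIdeal ℚ] (hP : IsParabolic I) {f : A}
    (hf : ∀ X : pointDerivations ℚ A, (∀ a ∈ I, X.1 a = 0) → invDer X f = 0) :
    f = algebraMap ℚ A (Coalgebra.counit (R := ℚ) f) :=
  eq_algebraMap_of_isAlgebraic (isAlgebraic_of_isIntegral_coaction hP (isIntegral_coaction hf))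

end Properness

/-! ### Derivative of a determinant -/

section DetDerivation

variable {k R : Type*} [CommRing k] [CommRing R] [Algebra k R]

/-- The ring homomorphism `a ↦ a + ε D(a)` to the dual numbers. -/
def dualNumberHom (D : Derivation k R R) : R →+* TrivSqZeroExt R R where
  toFun a := TrivSqZeroExt.inl a + TrivSqZeroExt.inr (D a)
  map_one' := by ext <;> simp
  map_mul' a b := by ext <;> simp [mul_comm]
  map_zero' := by ext <;> simp
  map_add' a b := by ext <;> simp

/-- Jacobi's formula for a matrix satisfying a linear differential equation. -/
theorem _root_.Derivation.det_of_eq_mul {ι : Type*} [Fintype ι] [DecidableEq ι]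
    (D : Derivation k R R) {b M : Matrix ι ι R} (h : ∀ i j, D (b i j) = ∑ l, b i l * M l j) :
    D b.det = b.det * M.trace := by
  let φ := dualNumberHom D
  let inl : R →+* TrivSqZeroExt R R := TrivSqZeroExt.inlHom R R
  have h1 : φ.mapMatrix b =
      inl.mapMatrix b * (1 + (TrivSqZeroExt.inr (1 : R) : TrivSqZeroExt R R) • inl.mapMatrix M) := by
    rw [mul_add, mul_one]
    ext i j
    · simp [φ, inl, dualNumberHom, Matrix.mul_apply, TrivSqZeroExt.fst_sum]
    · simp [φ, inl, dualNumberHom, Matrix.mul_apply, TrivSqZeroExt.snd_sum,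
        TrivSqZeroExt.fst_sum, h]
  have h2 := congrArg Matrix.det h1
  rw [Matrix.det_mul, Matrix.det_one_add_smul, ← RingHom.map_det, ← RingHom.map_det] at h2
  have h3 := congrArg TrivSqZeroExt.snd h2
  have h4 : (inl.mapMatrix M).trace = inl M.trace := by
    simp [Matrix.trace, map_sum]
  rw [h4] at h3
  simpa [φ, inl, dualNumberHom, pow_two] using h3

end DetDerivation

/-! ### Matrix representations and Plücker coordinates -/

section MulMatrix

variable {k : Type*} [Field k] {A : Type*} [CommRing A] [HopfAlgebra k A]
  {ι κ : Type*} [Fintype ι] [DecidableEq ι] [Fintype κ] [DecidableEq κ]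

variable (k) in
/-- A matrix of regular functions which defines a representation of `Spec A`. -/
structure IsMulMatrix (a : Matrix ι ι A) : Prop where
  comul : ∀ i j, Coalgebra.comul (R := k) (a i j) = ∑ l, a i l ⊗ₜ[k] a l j
  counit : ∀ i j, Coalgebra.counit (R := k) (a i j) = if i = j then 1 else 0

theorem IsMulMatrix.invDer {a : Matrix ι ι A} (ha : IsMulMatrix k a) (X : pointDerivations k A)
    (i j : ι) : invDer X (a i j) = ∑ l, a i l * algebraMap k A (X.1 (a l j)) := by
  rw [invDer_apply, contract_apply, ha.comul]
  simp [Algebra.smul_def, mul_comm]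

theorem IsMulMatrix.isGroupLikeElem_det {a : Matrix ι ι A} (ha : IsMulMatrix k a) :
    IsGroupLikeElem k a.det := by
  constructor
  · have h1 : (Bialgebra.counitAlgHom k A).mapMatrix a = 1 := by
      ext i j
      simp [ha.counit, Matrix.one_apply]
    have h2 := AlgHom.map_det (Bialgebra.counitAlgHom k A) a
    rw [h1, Matrix.det_one] at h2
    exact h2
  · have h1 : (Bialgebra.comulAlgHom k A).mapMatrix a =
        (Algebra.TensorProduct.includeLeft : A →ₐ[k] A ⊗[k] A).mapMatrix a *
          (Algebra.TensorProduct.includeRight : A →ₐ[k] A ⊗[k] A).mapMatrix a := by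
      ext i j
      simp [ha.comul, Matrix.mul_apply]
    have h2 := AlgHom.map_det (Bialgebra.comulAlgHom k A) a
    rw [h1, Matrix.det_mul, ← AlgHom.map_det, ← AlgHom.map_det] at h2
    simpa using h2

/-- The determinant of the rows `τ i` of the first columns of a representation. -/
def rowDet (a : Matrix (ι ⊕ κ) (ι ⊕ κ) A) (τ : ι → ι ⊕ κ) : A :=
  Matrix.det (Matrix.of fun i j => a (τ i) (Sum.inl j))

/-- The minors `rowDet a τ` are Plücker coordinates of the translate by `g` of the span `U` of the
first basis vectors. If `X` preserves `U`, it acts on the line `Λ^top U` by its trace on `U`. -/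
theorem IsMulMatrix.invDer_rowDet {a : Matrix (ι ⊕ κ) (ι ⊕ κ) A} (ha : IsMulMatrix k a)
    {X : pointDerivations k A} (hX : ∀ r j, X.1 (a (Sum.inr r) (Sum.inl j)) = 0)
    (τ : ι → ι ⊕ κ) : LinAlgGroup.invDer X (rowDet a τ) =
      algebraMap k A (∑ j : ι, X.1 (a (Sum.inl j) (Sum.inl j))) * rowDet a τ := by
  rw [rowDet, (LinAlgGroup.invDer X).det_of_eq_mul
    (M := Matrix.of fun i j : ι => algebraMap k A (X.1 (a (Sum.inl i) (Sum.inl j))))]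
  · rw [mul_comm, map_sum]
    rfl
  · intro i j
    simp [ha.invDer, hX]

/-- These are the affine coordinates of the Grassmannian at `U` to first order: their differentials
at the identity are the matrix entries from `U` to its complement. If they vanish identically, the
whole Lie algebra preserves `U`. -/
theorem counit_rowDet_update {a : Matrix (ι ⊕ κ) (ι ⊕ κ) A} (ha : IsMulMatrix k a) (i : ι) (r : κ) :
    Coalgebra.counit (R := k) (rowDet a (Function.update Sum.inl i (Sum.inr r))) = 0 ∧
    ∀ Y : pointDerivations k A, Y.1 (rowDet a (Function.update Sum.inl i (Sum.inr r))) =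
      Y.1 (a (Sum.inr r) (Sum.inl i)) := by
  let b : Matrix ι ι A := a.toBlocks₁₁
  have h1 : rowDet a (Function.update Sum.inl i (Sum.inr r)) =
      ∑ j, a (Sum.inr r) (Sum.inl j) * b.adjugate j i := by
    have h2 : Matrix.of (fun i' j => a (Function.update Sum.inl i (Sum.inr r) i') (Sum.inl j)) =
        b.updateRow i (fun j => a (Sum.inr r) (Sum.inl j)) := by
      ext i' j
      by_cases h : i' = i
      · subst h; simp
      · simp [h, b, Matrix.toBlocks₁₁]
    rw [rowDet, h2, Matrix.det_eq_sum_mul_adjugate_row _ i]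
    refine Finset.sum_congr rfl fun j _ => ?_
    rw [Matrix.updateRow_self, Matrix.adjugate_apply, Matrix.adjugate_apply,
      Matrix.updateRow_idem]
  have h3 : ∀ j, Coalgebra.counit (R := k) (b.adjugate j i) = if j = i then 1 else 0 := by
    intro j
    have h4 : (Bialgebra.counitAlgHom k A).mapMatrix b = 1 := by
      ext i j
      simp [b, Matrix.toBlocks₁₁, ha.counit, Matrix.one_apply]
    have h5 := AlgHom.map_adjugate (Bialgebra.counitAlgHom k A) b
    rw [h4, Matrix.adjugate_one] at h5
    have h6 := congrFun (congrFun h5 j) i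
    simpa [Matrix.one_apply] using h6
  have h0 : ∀ j, Coalgebra.counit (R := k) (a (Sum.inr r) (Sum.inl j)) = 0 := by
    intro j; simp [ha.counit]
  constructor
  · rw [h1, map_sum]
    simp [h0]
  · intro Y
    rw [h1, map_sum]
    simp [Y.2 _ _, h0, h3]

end MulMatrix

/-! ### The adjoint representation by convolution -/

section Adjoint

variable {k : Type*} [Field k] {A : Type*} [CommRing A] [HopfAlgebra k A]
  {E : Type*} [CommRing E] [Algebra k E]

/-- `u` is a derivation along the point `g`. -/
def IsDerAlong (g : Points k A E) (u : WithConv (A →ₗ[k] E)) : Prop :=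
  ∀ a b : A, u.ofConv (a * b) = g.ofConv a * u.ofConv b + u.ofConv a * g.ofConv b

/-- A point, seen in the convolution algebra. -/
def linPoint (g : Points k A E) : WithConv (A →ₗ[k] E) := WithConv.toConv g.ofConv.toLinearMap

theorem linPoint_mul (g h : Points k A E) : linPoint (g * h) = linPoint g * linPoint h := rfl

theorem linPoint_one : linPoint (1 : Points k A E) = 1 := rfl

theorem IsDerAlong.mul_linPoint {g : Points k A E} {u : WithConv (A →ₗ[k] E)}
    (hu : IsDerAlong g u) (h : Points k A E) : IsDerAlong (g * h) (u * linPoint h) := by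
  intro a b
  have key : ∀ z w : A ⊗[k] A,
      LinearMap.mul' k E (TensorProduct.map u.ofConv h.ofConv.toLinearMap (z * w)) =
      LinearMap.mul' k E (TensorProduct.map g.ofConv.toLinearMap h.ofConv.toLinearMap z) *
        LinearMap.mul' k E (TensorProduct.map u.ofConv h.ofConv.toLinearMap w) +
      LinearMap.mul' k E (TensorProduct.map u.ofConv h.ofConv.toLinearMap z) *
        LinearMap.mul' k E (TensorProduct.map g.ofConv.toLinearMap h.ofConv.toLinearMap w) := by
    intro z w
    induction z with
    | zero => simp
    | add x y hx hy => simp only [map_add, hx, hy, add_mul]; ring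
    | tmul p q =>
      induction w with
      | zero => simp
      | add x y hx hy => simp only [map_add, hx, hy, mul_add]; ring
      | tmul r s =>
        simp only [Algebra.TensorProduct.tmul_mul_tmul, TensorProduct.map_tmul,
          LinearMap.mul'_apply, hu p r, AlgHom.toLinearMap_apply, map_mul]
        ring
  have := key (Coalgebra.comul a) (Coalgebra.comul b)
  rw [← Bialgebra.comul_mul] at this
  exact this

theorem IsDerAlong.linPoint_mul {g : Points k A E} {u : WithConv (A →ₗ[k] E)}
    (hu : IsDerAlong g u) (h : Points k A E) : IsDerAlong (h * g) (linPoint h * u) := by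
  intro a b
  have key : ∀ z w : A ⊗[k] A,
      LinearMap.mul' k E (TensorProduct.map h.ofConv.toLinearMap u.ofConv (z * w)) =
      LinearMap.mul' k E (TensorProduct.map h.ofConv.toLinearMap g.ofConv.toLinearMap z) *
        LinearMap.mul' k E (TensorProduct.map h.ofConv.toLinearMap u.ofConv w) +
      LinearMap.mul' k E (TensorProduct.map h.ofConv.toLinearMap u.ofConv z) *
        LinearMap.mul' k E (TensorProduct.map h.ofConv.toLinearMap g.ofConv.toLinearMap w) := by
    intro z w
    induction z with
    | zero => simp
    | add x y hx hy => simp only [map_add, hx, hy, add_mul]; ring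
    | tmul p q =>
      induction w with
      | zero => simp
      | add x y hx hy => simp only [map_add, hx, hy, mul_add]; ring
      | tmul r s =>
        simp only [Algebra.TensorProduct.tmul_mul_tmul, TensorProduct.map_tmul,
          LinearMap.mul'_apply, hu q s, AlgHom.toLinearMap_apply, map_mul]
        ring
  have := key (Coalgebra.comul a) (Coalgebra.comul b)
  rw [← Bialgebra.comul_mul] at this
  exact this

variable (E) in
/-- A linear form on `A` with values extended to `E`. -/
def extendForm (X : A →ₗ[k] k) : WithConv (A →ₗ[k] E) :=
  WithConv.toConv (Algebra.linearMap k E ∘ₗ X)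

/-- The adjoint action of `g` on a linear form. -/
def adjoint (g : Points k A E) (X : A →ₗ[k] k) : WithConv (A →ₗ[k] E) :=
  linPoint g * extendForm E X * linPoint g⁻¹

theorem isDerAlong_adjoint (g : Points k A E) (X : pointDerivations k A) :
    IsDerAlong 1 (adjoint g X.1) := by
  have h : IsDerAlong (1 : Points k A E) (extendForm E X.1) := by
    intro a b
    change algebraMap k E (X.1 (a * b)) = algebraMap k E (Coalgebra.counit (R := k) a) *
      algebraMap k E (X.1 b) + algebraMap k E (X.1 a) * algebraMap k E (Coalgebra.counit (R := k) b)
    rw [X.2 a b]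
    simp
  have := (h.linPoint_mul g).mul_linPoint g⁻¹
  rwa [mul_one, mul_inv_cancel] at this

/-- Naturality in the point: every adjoint action is a specialization of that of the universal
point, whose entries form `adjointMatrix`. -/
theorem comp_adjoint {E' : Type*} [CommRing E'] [Algebra k E'] (h : E →ₐ[k] E')
    (g : Points k A E) (X : A →ₗ[k] k) :
    h.toLinearMap ∘ₗ (adjoint g X).ofConv =
      (adjoint (WithConv.toConv (h.comp g.ofConv)) X).ofConv := by
  rw [adjoint, LinearMap.algHom_comp_convMul_distrib, LinearMap.algHom_comp_convMul_distrib]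
  have : h.toLinearMap ∘ₗ (extendForm E X).ofConv = (extendForm E' X).ofConv := by
    ext a
    simp [extendForm]
  rw [this]
  rfl

variable {ι : Type*} [Fintype ι] [DecidableEq ι]

/-- The matrix of the adjoint representation. -/
def Coordinates.adjointMatrix (c : Coordinates k A ι) : Matrix ι ι A :=
  Matrix.of fun i j => (adjoint (WithConv.toConv (AlgHom.id k A)) (c.Y j).1).ofConv (c.x i)

theorem Coordinates.apply_adjointMatrix (c : Coordinates k A ι) (g : Points k A E) (i j : ι) :
    g.ofConv (c.adjointMatrix i j) = (adjoint g (c.Y j).1).ofConv (c.x i) := by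
  have := comp_adjoint g.ofConv (WithConv.toConv (AlgHom.id k A)) (c.Y j).1
  rw [AlgHom.comp_id] at this
  exact LinearMap.congr_fun this (c.x i)

theorem Coordinates.adjoint_eq (c : Coordinates k A ι) (g : Points k A E) (j : ι) :
    adjoint g (c.Y j).1 = ∑ i, g.ofConv (c.adjointMatrix i j) • extendForm E (c.Y i).1 := by
  apply WithConv.ofConv_injective
  ext a
  rw [c.sum_smul (δ := (adjoint g (c.Y j).1).ofConv) (fun a b => ?_) a]
  · simp only [← c.apply_adjointMatrix]
    rw [WithConv.ofConv_sum, LinearMap.sum_apply]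
    refine Finset.sum_congr rfl fun i _ => ?_
    rw [WithConv.ofConv_smul, LinearMap.smul_apply, Algebra.smul_def, mul_comm, smul_eq_mul]
    rfl
  · rw [isDerAlong_adjoint g (c.Y j) a b]
    change algebraMap k E (Coalgebra.counit (R := k) a) * _ + _ *
      algebraMap k E (Coalgebra.counit (R := k) b) = _
    rw [Algebra.smul_def, Algebra.smul_def, mul_comm (algebraMap k E (Coalgebra.counit b))]

theorem adjoint_mul (c : Coordinates k A ι) (g h : Points k A E) (j : ι) :
    adjoint (g * h) (c.Y j).1 = ∑ l, h.ofConv (c.adjointMatrix l j) • adjoint g (c.Y l).1 := by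
  have h1 : adjoint (g * h) (c.Y j).1 = linPoint g * adjoint h (c.Y j).1 * linPoint g⁻¹ := by
    simp only [adjoint, linPoint_mul, mul_inv_rev, mul_assoc]
  rw [h1, c.adjoint_eq h j, Finset.mul_sum, Finset.sum_mul]
  simp only [mul_smul_comm, smul_mul_assoc, adjoint]

theorem Coordinates.isMulMatrix (c : Coordinates k A ι) : IsMulMatrix k c.adjointMatrix where
  comul i j := by
    let i₁ : Points k A (A ⊗[k] A) := WithConv.toConv Algebra.TensorProduct.includeLeft
    let i₂ : Points k A (A ⊗[k] A) := WithConv.toConv Algebra.TensorProduct.includeRight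
    have h1 : (i₁ * i₂).ofConv = Bialgebra.comulAlgHom k A := by
      have := translate_eq (k := k) (A := A) (E := A) (AlgHom.id k A)
      rw [AlgHom.comp_id] at this
      rw [← this]
      ext a
      simp [translate]
    have h2 := c.apply_adjointMatrix (i₁ * i₂) i j
    rw [h1, adjoint_mul, WithConv.ofConv_sum, LinearMap.sum_apply] at h2
    refine h2.trans (Finset.sum_congr rfl fun l _ => ?_)
    rw [WithConv.ofConv_smul, LinearMap.smul_apply, ← c.apply_adjointMatrix]
    simp [i₁, i₂]
  counit i j := by
    have h1 := c.apply_adjointMatrix (1 : Points k A k) i j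
    have h2 : adjoint (1 : Points k A k) (c.Y j).1 = extendForm k (c.Y j).1 := by
      rw [adjoint, inv_one, linPoint_one, one_mul, mul_one]
    rw [h2] at h1
    have h3 : (extendForm k (c.Y j).1).ofConv (c.x i) = if j = i then 1 else 0 := c.dual j i
    rw [h3] at h1
    simpa [eq_comm] using h1

end Adjoint

/-! ### Local finiteness of the regular representation -/

section LocallyFinite

variable {k : Type*} [Field k] {A : Type*} [CommRing A] [HopfAlgebra k A]

/-- The contraction `f ↦ π(f₍₁₎) f₍₂₎`, which commutes with right translations. -/
def leftContract (π : A →ₗ[k] k) : A →ₗ[k] A :=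
  (TensorProduct.lid k A).toLinearMap ∘ₗ π.rTensor A ∘ₗ Coalgebra.comul

theorem apply_leftContract (π φ : A →ₗ[k] k) (f : A) :
    φ (leftContract π f) = π (contract φ f) := by
  simp only [leftContract, contract, LinearMap.comp_apply]
  generalize Coalgebra.comul (R := k) f = z
  induction z with
  | zero => simp
  | add x y hx hy => simp only [map_add, hx, hy]
  | tmul x y => simp [mul_comm]

theorem leftContract_contract (π φ : A →ₗ[k] k) (f : A) :
    leftContract π (contract φ f) = contract φ (leftContract π f) := by
  rw [leftContract, LinearMap.comp_apply, LinearMap.comp_apply, comul_contract]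
  simp only [LinearMap.comp_apply]
  generalize Coalgebra.comul (R := k) f = z
  induction z with
  | zero => simp
  | add x y hx hy => simp only [map_add, hx, hy]
  | tmul x y => simp

theorem counit_leftContract (π : A →ₗ[k] k) (f : A) :
    Coalgebra.counit (R := k) (leftContract π f) = π f := by
  rw [apply_leftContract, contract_counit]

/-- A space of functions stable under the Lie algebra is stable under right translations. -/
theorem contract_mem_of_invDer_mem [CharZero k] [Algebra.FiniteType k A]
    [ConnectedSpace (PrimeSpectrum A)] {V : Submodule k A}
    (hV : ∀ X : pointDerivations k A, ∀ v ∈ V, invDer X v ∈ V) (φ : A →ₗ[k] k) {v : A}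
    (hv : v ∈ V) : contract φ v ∈ V := by
  by_contra hc
  obtain ⟨π, hπ, hπV⟩ := Submodule.exists_le_ker_of_notMem hc
  -- For a form `π` that vanishes on `V`, the functions `leftContract π v` vanish at the identity
  -- and are stable under the Lie algebra, because the two contractions commute. Connectedness makes
  -- them zero.
  have h0 : leftContract π v = 0 := by
    refine eq_zero_of_stable (k := k) (N := {f | ∃ v ∈ V, f = leftContract π v}) ?_ ?_ ⟨v, hv, rfl⟩
    · rintro _ ⟨v, hv, rfl⟩
      rw [counit_leftContract]
      exact hπV hv
    · rintro X _ ⟨v, hv, rfl⟩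
      exact ⟨invDer X v, hV X v hv, (leftContract_contract π X.1 v).symm⟩
  apply hπ
  rw [← apply_leftContract, h0, map_zero]

/-- Every finite set of functions is contained in a finite dimensional space of functions stable
under right translations. -/
theorem exists_finiteDimensional_stable (s : Finset A) :
    ∃ W : Submodule k A, FiniteDimensional k W ∧ (∀ f ∈ s, f ∈ W) ∧
      ∀ φ : A →ₗ[k] k, ∀ w ∈ W, contract φ w ∈ W := by
  classical
  induction s using Finset.induction_on with
  | empty => exact ⟨⊥, inferInstance, by simp, fun φ w hw => by
      rw [Submodule.mem_bot] at hw ⊢; rw [hw, map_zero]⟩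
  | insert f s _ ih =>
    obtain ⟨W, hW, hs, hc⟩ := ih
    let U : Submodule k A := LinearMap.range
      (slice.flip (Coalgebra.comul (R := k) f) : Module.Dual k A →ₗ[k] A)
    have hU : FiniteDimensional k U := finite_range_slice _
    have hcontract : ∀ φ : A →ₗ[k] k, contract φ f ∈ U := fun φ => ⟨φ, rfl⟩
    refine ⟨U ⊔ W, inferInstance, ?_, ?_⟩
    · intro g hg
      rcases Finset.mem_insert.1 hg with rfl | hg
      · exact Submodule.mem_sup_left (by simpa [contract_counit] using hcontract Coalgebra.counit)
      · exact Submodule.mem_sup_right (hs g hg)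
    · intro φ w hw
      obtain ⟨u, ⟨ψ, rfl⟩, w', hw', rfl⟩ := Submodule.mem_sup.1 hw
      rw [map_add]
      refine Submodule.add_mem_sup ?_ (hc φ w' hw')
      have := contract_contract φ ψ f
      exact this ▸ hcontract _

/-- The matrix of a finite dimensional space of functions stable under right translations. -/
theorem exists_isMulMatrix {W : Submodule k A} {ι : Type*} [Fintype ι] [DecidableEq ι]
    (b : Module.Basis ι k W) (hW : ∀ φ : A →ₗ[k] k, ∀ w ∈ W, contract φ w ∈ W) :
    ∃ a : Matrix ι ι A, IsMulMatrix k a ∧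
      (∀ (φ : A →ₗ[k] k) (j : ι), contract φ (b j : A) = ∑ i, φ (a i j) • (b i : A)) ∧
      ∀ (φ : A →ₗ[k] k) (i j : ι), φ (a i j) = b.repr ⟨contract φ (b j), hW φ _ (b j).2⟩ i := by
  choose π hπ using fun i => LinearMap.exists_extend (b.coord i)
  have hπ' : ∀ i (w : W), π i w = b.repr w i := fun i w => LinearMap.congr_fun (hπ i) w
  let a : Matrix ι ι A := Matrix.of fun i j => leftContract (π i) (b j)
  have h1 : ∀ (φ : A →ₗ[k] k) (i j : ι),
      φ (a i j) = b.repr ⟨contract φ (b j), hW φ _ (b j).2⟩ i := by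
    intro φ i j
    rw [← hπ']
    exact apply_leftContract _ _ _
  have h2 : ∀ (φ : A →ₗ[k] k) (j : ι), contract φ (b j : A) = ∑ i, φ (a i j) • (b i : A) := by
    intro φ j
    have := congrArg Subtype.val (b.sum_repr ⟨contract φ (b j), hW φ _ (b j).2⟩)
    simp only [h1]
    refine this.symm.trans ?_
    rw [AddSubmonoidClass.coe_finsetSum]
    rfl
  refine ⟨a, ⟨fun i j => ?_, fun i j => ?_⟩, h2, h1⟩
  · rw [← sub_eq_zero]
    refine eq_zero_of_slice_eq_zero fun φ => ?_
    rw [map_sub, map_sum, sub_eq_zero]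
    simp only [slice_tmul]
    change contract φ (leftContract (π i) (b j)) = _
    rw [← leftContract_contract, h2, map_sum]
    simp only [map_smul]
    rfl
  · rw [h1]
    simp only [contract_counit, Subtype.coe_eta, Module.Basis.repr_self]
    rw [Finsupp.single_apply]
    simp [eq_comm]

end LocallyFinite

/-! ### The eigenvalue lemma behind Lie's theorem -/

section LieLemma

variable {k V P : Type*} [Field k] [CharZero k] [AddCommGroup V] [Module k V]

/-- A common eigenvector `F` of a family `D` of operators normalized by `T` has an eigenvalue
vanishing on the commutators with `T`. -/
theorem eigenvalue_commutator_eq_zero (D : P → Module.End k V) (T : Module.End k V) (br : P → P)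
    (hbr : ∀ Z v, D (br Z) v = D Z (T v) - T (D Z v)) {θ : P → k} {F : V} (hF : F ≠ 0)
    (hθ : ∀ Z, D Z F = θ Z • F) {W : Submodule k V} [FiniteDimensional k W] (hFW : F ∈ W)
    (hTW : ∀ w ∈ W, T w ∈ W) (Z : P) : θ (br Z) = 0 := by
  let f : ℕ → V := fun i => (T ^ i) F
  have hf : ∀ i, T (f i) = f (i + 1) := fun i => by simp only [f, pow_succ', Module.End.mul_apply]
  let U : ℕ → Submodule k V := fun i => Submodule.span k (f '' Set.Iio i)
  have hUmono : ∀ {i j}, i ≤ j → U i ≤ U j := fun h =>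
    Submodule.span_mono (Set.image_mono (Set.Iio_subset_Iio h))
  have hfU : ∀ i, f i ∈ U (i + 1) := fun i =>
    Submodule.subset_span ⟨i, Set.mem_Iio.2 (Nat.lt_succ_self i), rfl⟩
  have hTU : ∀ i, ∀ u ∈ U i, T u ∈ U (i + 1) := by
    intro i u hu
    induction hu using Submodule.span_induction with
    | mem x hx =>
      obtain ⟨j, hj, rfl⟩ := hx
      rw [hf]
      exact hUmono (Nat.succ_le_succ (Nat.succ_le_of_lt (Set.mem_Iio.1 hj))) (hfU (j + 1))
    | zero => simp
    | add x y _ _ hx hy => rw [map_add]; exact add_mem hx hy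
    | smul c x _ hx => rw [map_smul]; exact Submodule.smul_mem _ _ hx
  have hDT : ∀ Z v, D Z (T v) = T (D Z v) + D (br Z) v := fun Z v => by rw [hbr]; abel
  have hP : ∀ i Z, D Z (f i) - θ Z • f i ∈ U i := by
    intro i
    induction i with
    | zero =>
      intro Z
      have : D Z (f 0) - θ Z • f 0 = 0 := by simp [f, hθ]
      rw [this]; exact zero_mem _
    | succ i ih =>
      intro Z
      have : D Z (f (i + 1)) - θ Z • f (i + 1) = T (D Z (f i) - θ Z • f i) +
          (D (br Z) (f i) - θ (br Z) • f i) + θ (br Z) • f i := by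
        rw [← hf, hDT, map_sub, map_smul]; abel
      rw [this]
      exact add_mem (add_mem (hTU _ _ (ih Z)) (hUmono (Nat.le_succ i) (ih (br Z))))
        (Submodule.smul_mem _ _ (hfU i))
  -- Each commutation past one of the `i + 1` factors `T` contributes `θ (br Z)` to the entry just
  -- above the diagonal. This entry replaces the usual trace argument, so the operators `D Z` need
  -- not preserve `W`.
  have hQ : ∀ i Z, D Z (f (i + 1)) - θ Z • f (i + 1) - ((i + 1 : ℕ) : k) • θ (br Z) • f i ∈ U i := by
    intro i
    induction i with
    | zero =>
      intro Z
      have : D Z (f (0 + 1)) - θ Z • f (0 + 1) - ((0 + 1 : ℕ) : k) • θ (br Z) • f 0 = 0 := by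
        rw [← hf, hDT]
        simp [f, hθ]
      rw [this]; exact zero_mem _
    | succ i ih =>
      intro Z
      have : D Z (f (i + 1 + 1)) - θ Z • f (i + 1 + 1) -
          ((i + 1 + 1 : ℕ) : k) • θ (br Z) • f (i + 1) =
          T (D Z (f (i + 1)) - θ Z • f (i + 1) - ((i + 1 : ℕ) : k) • θ (br Z) • f i) +
          (D (br Z) (f (i + 1)) - θ (br Z) • f (i + 1)) := by
        rw [← hf (i + 1), hDT]
        simp only [map_sub, map_smul, hf]
        push_cast
        module
      rw [this]
      exact add_mem (hTU _ _ (ih Z)) (hP (i + 1) (br Z))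
  have hfW : ∀ i, f i ∈ W := by
    intro i
    induction i with
    | zero => simpa [f] using hFW
    | succ i ih => rw [← hf]; exact hTW _ ih
  have hex : ∃ n, f n ∈ U n := by
    obtain ⟨n, hn⟩ := monotone_stabilizes_iff_noetherian.2 (inferInstanceAs (IsNoetherian k W))
      ⟨fun i => (U i).comap W.subtype, fun i j h => Submodule.comap_mono (hUmono h)⟩
    have h1 : (⟨f n, hfW n⟩ : W) ∈ (U (n + 1)).comap W.subtype := hfU n
    have h2 : (U n).comap W.subtype = (U (n + 1)).comap W.subtype := hn (n + 1) (Nat.le_succ n)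
    rw [← h2] at h1
    exact ⟨n, h1⟩
  classical
  obtain ⟨n, hn, hmin⟩ : ∃ n, f n ∈ U n ∧ ∀ m < n, f m ∉ U m :=
    ⟨Nat.find hex, Nat.find_spec hex, fun m hm => Nat.find_min hex hm⟩
  cases n with
  | zero =>
    refine absurd ?_ hF
    simpa [U, f] using hn
  | succ n =>
    -- At the first dependence `f (n + 1) ∈ U (n + 1)`, the operator `D Z - θ Z` sends `f (n + 1)`
    -- into `U n`. Comparison with `hQ` puts `(n + 1) θ(br Z) f n` in `U n`, while `f n` is not
    -- there.
    have hDU : ∀ u ∈ U (n + 1), D Z u - θ Z • u ∈ U n := by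
      intro u hu
      induction hu using Submodule.span_induction with
      | mem x hx =>
        obtain ⟨j, hj, rfl⟩ := hx
        exact hUmono (Nat.lt_succ_iff.1 (Set.mem_Iio.1 hj)) (hP j Z)
      | zero => simp
      | add x y _ _ hx hy =>
        have : D Z (x + y) - θ Z • (x + y) = (D Z x - θ Z • x) + (D Z y - θ Z • y) := by
          rw [map_add, smul_add]; abel
        rw [this]; exact add_mem hx hy
      | smul c x _ hx =>
        have : D Z (c • x) - θ Z • c • x = c • (D Z x - θ Z • x) := by
          rw [map_smul, smul_sub, smul_comm]
        rw [this]; exact Submodule.smul_mem _ _ hx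
    have h1 : (((n + 1 : ℕ) : k) * θ (br Z)) • f n ∈ U n := by
      have := sub_mem (hDU _ hn) (hQ n Z)
      rwa [sub_sub_cancel, smul_smul] at this
    by_contra hne
    refine hmin n (Nat.lt_succ_self n) ?_
    refine (Submodule.smul_mem_iff _ (mul_ne_zero (Nat.cast_ne_zero.2 (Nat.succ_ne_zero n)) hne)).1 h1

end LieLemma

/-! ### The differential of the adjoint representation -/

section BracketFormula

variable {k : Type*} [Field k] {A : Type*} [CommRing A] [HopfAlgebra k A]

theorem pointDerivation_comp_convMul (X : pointDerivations k A) (u v : WithConv (A →ₗ[k] A)) :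
    WithConv.toConv (X.1 ∘ₗ (u * v).ofConv) =
      WithConv.toConv (Coalgebra.counit ∘ₗ u.ofConv) * WithConv.toConv (X.1 ∘ₗ v.ofConv) +
      WithConv.toConv (X.1 ∘ₗ u.ofConv) * WithConv.toConv (Coalgebra.counit ∘ₗ v.ofConv) := by
  apply WithConv.ofConv_injective
  ext a
  change X.1 (LinearMap.mul' k A (TensorProduct.map u.ofConv v.ofConv (Coalgebra.comul a))) =
    LinearMap.mul' k k (TensorProduct.map _ _ (Coalgebra.comul a)) +
    LinearMap.mul' k k (TensorProduct.map _ _ (Coalgebra.comul a))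
  generalize Coalgebra.comul (R := k) a = z
  induction z with
  | zero => simp
  | add x y hx hy => simp only [map_add, hx, hy]; ring
  | tmul x y =>
    simp only [TensorProduct.map_tmul, LinearMap.mul'_apply, LinearMap.comp_apply]
    exact X.2 _ _

theorem convMul_apply_eq (φ ψ : A →ₗ[k] k) (f : A) :
    (WithConv.toConv φ * WithConv.toConv ψ).ofConv f = φ (contract ψ f) := by
  change LinearMap.mul' k k (TensorProduct.map φ ψ (Coalgebra.comul f)) = φ _
  rw [contract_apply]
  generalize Coalgebra.comul (R := k) f = z
  induction z with
  | zero => simp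
  | add x y hx hy => simp only [map_add, hx, hy]
  | tmul x y => simp [mul_comm]

theorem pointDerivation_comp_one (X : pointDerivations k A) :
    X.1 ∘ₗ (1 : WithConv (A →ₗ[k] A)).ofConv = 0 := by
  ext a
  change X.1 (algebraMap k A (Coalgebra.counit a)) = 0
  rw [Algebra.algebraMap_eq_smul_one, map_smul, pointDerivations_one X.2, smul_zero]

theorem counit_comp_linPoint (g : Points k A A) :
    WithConv.toConv (Coalgebra.counit ∘ₗ (linPoint g).ofConv) =
      linPoint (WithConv.toConv ((Bialgebra.counitAlgHom k A).comp g.ofConv)) := rfl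

/-- The differential of the adjoint representation is the bracket. -/
theorem Coordinates.apply_adjointMatrix_eq_pointBracket {ι : Type*} [Fintype ι] [DecidableEq ι]
    (c : Coordinates k A ι) (X : pointDerivations k A) (i j : ι) :
    X.1 (c.adjointMatrix i j) = (pointBracket X (c.Y j)).1 (c.x i) := by
  set e : Points k A A := WithConv.toConv (AlgHom.id k A)
  have he : (WithConv.toConv ((Bialgebra.counitAlgHom k A).comp e.ofConv) : Points k A k) = 1 := by
    rfl
  have he' : (WithConv.toConv ((Bialgebra.counitAlgHom k A).comp e⁻¹.ofConv) : Points k A k) =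
      1 := by
    have := comp_inv (Bialgebra.counitAlgHom k A) e
    rw [this, he, inv_one]
  have hXe : X.1 ∘ₗ (linPoint e).ofConv = X.1 := rfl
  -- Differentiating `e * e⁻¹ = 1` at the identity: inversion has differential `-1`.
  have hX : WithConv.toConv (X.1 ∘ₗ (linPoint e⁻¹).ofConv) = WithConv.toConv (-X.1) := by
    have h1 := pointDerivation_comp_convMul X (linPoint e) (linPoint e⁻¹)
    rw [← linPoint_mul, mul_inv_cancel, linPoint_one, pointDerivation_comp_one,
      counit_comp_linPoint, counit_comp_linPoint, he, he', linPoint_one, one_mul, mul_one, hXe] at h1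
    rw [WithConv.toConv_neg, eq_neg_iff_add_eq_zero, ← h1, WithConv.toConv_zero]
  have hY1 : Coalgebra.counit ∘ₗ (extendForm A (c.Y j).1).ofConv = (c.Y j).1 := by
    ext a; simp [extendForm]
  have hY2 : X.1 ∘ₗ (extendForm A (c.Y j).1).ofConv = 0 := by
    ext a
    change X.1 (algebraMap k A _) = 0
    rw [Algebra.algebraMap_eq_smul_one, map_smul, pointDerivations_one X.2, smul_zero]
  have hεY : WithConv.toConv (Coalgebra.counit ∘ₗ (linPoint e * extendForm A (c.Y j).1).ofConv) =
      WithConv.toConv (c.Y j).1 := by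
    have h1 := LinearMap.algHom_comp_convMul_distrib (Bialgebra.counitAlgHom k A)
      (linPoint e) (extendForm A (c.Y j).1)
    apply WithConv.ofConv_injective
    refine h1.trans ?_
    have h2 : (Bialgebra.counitAlgHom k A).toLinearMap ∘ₗ (extendForm A (c.Y j).1).ofConv =
      (c.Y j).1 := hY1
    have h3 : WithConv.toConv ((Bialgebra.counitAlgHom k A).toLinearMap ∘ₗ (linPoint e).ofConv) =
      (1 : WithConv (A →ₗ[k] k)) := rfl
    rw [h2, h3, one_mul]
  have hXY : WithConv.toConv (X.1 ∘ₗ (linPoint e * extendForm A (c.Y j).1).ofConv) =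
      WithConv.toConv X.1 * WithConv.toConv (c.Y j).1 := by
    rw [pointDerivation_comp_convMul, hY1, hY2, hXe, WithConv.toConv_zero, mul_zero, zero_add]
  have key := pointDerivation_comp_convMul X (linPoint e * extendForm A (c.Y j).1) (linPoint e⁻¹)
  rw [hεY, hXY, hX, counit_comp_linPoint, he', linPoint_one, mul_one] at key
  have h := LinearMap.congr_fun (congrArg WithConv.ofConv key) (c.x i)
  refine h.trans ?_
  have hneg : contract (-X.1) = -contract X.1 := by
    ext a
    simp [contract]
  rw [pointBracket_apply, WithConv.ofConv_add, LinearMap.add_apply, convMul_apply_eq,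
    convMul_apply_eq, hneg]
  simp only [invDer_apply, LinearMap.neg_apply, map_neg]
  ring

end BracketFormula

/-! ### The adjoint representation of a closed subgroup -/

section Subgroup

variable {k : Type*} [Field k] {A : Type*} [CommRing A] [HopfAlgebra k A]
  {I : Ideal A} [I.IsHopfIdeal k]

theorem subgroupInclusion_mul {E : Type*} [CommRing E] [Algebra k E] (g h : Points k (A ⧸ I) E) :
    subgroupInclusion I (g * h) = subgroupInclusion I g * subgroupInclusion I h := by
  apply WithConv.ofConv_injective
  ext a
  change LinearMap.mul' k E (TensorProduct.map g.ofConv.toLinearMap h.ofConv.toLinearMap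
    (TensorProduct.map (Ideal.Quotient.mkₐ k I).toLinearMap (Ideal.Quotient.mkₐ k I).toLinearMap
      (Coalgebra.comul (R := k) a))) = LinearMap.mul' k E (TensorProduct.map
        (g.ofConv.comp (Ideal.Quotient.mkₐ k I)).toLinearMap
        (h.ofConv.comp (Ideal.Quotient.mkₐ k I)).toLinearMap (Coalgebra.comul (R := k) a))
  generalize Coalgebra.comul (R := k) a = z
  induction z with
  | zero => simp
  | add x y hx hy => simp only [map_add, hx, hy]
  | tmul x y => simp

theorem subgroupInclusion_one {E : Type*} [CommRing E] [Algebra k E] :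
    subgroupInclusion I (1 : Points k (A ⧸ I) E) = 1 := rfl

theorem subgroupInclusion_inv {E : Type*} [CommRing E] [Algebra k E] (g : Points k (A ⧸ I) E) :
    subgroupInclusion I g⁻¹ = (subgroupInclusion I g)⁻¹ := by
  rw [eq_inv_iff_mul_eq_one, ← subgroupInclusion_mul, inv_mul_cancel, subgroupInclusion_one]

theorem adjoint_subgroupInclusion {E : Type*} [CommRing E] [Algebra k E] (g : Points k (A ⧸ I) E)
    (X : pointDerivations k (A ⧸ I)) (a : A) :
    (adjoint (subgroupInclusion I g) (liftDer X).1).ofConv a =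
      (adjoint g X.1).ofConv (Ideal.Quotient.mkₐ k I a) := by
  have key : ∀ u v : WithConv ((A ⧸ I) →ₗ[k] E),
      WithConv.toConv (u.ofConv ∘ₗ (Ideal.Quotient.mkₐ k I).toLinearMap) *
      WithConv.toConv (v.ofConv ∘ₗ (Ideal.Quotient.mkₐ k I).toLinearMap) =
      WithConv.toConv ((u * v).ofConv ∘ₗ (Ideal.Quotient.mkₐ k I).toLinearMap) := by
    intro u v
    apply WithConv.ofConv_injective
    ext a
    change LinearMap.mul' k E (TensorProduct.map _ _ (Coalgebra.comul (R := k) a)) =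
      LinearMap.mul' k E (TensorProduct.map _ _ (TensorProduct.map
        (Ideal.Quotient.mkₐ k I).toLinearMap (Ideal.Quotient.mkₐ k I).toLinearMap
          (Coalgebra.comul (R := k) a)))
    rw [TensorProduct.map_map]
  have h := key (linPoint g * extendForm E X.1) (linPoint g⁻¹)
  rw [← key] at h
  rw [adjoint, ← subgroupInclusion_inv]
  exact LinearMap.congr_fun (congrArg WithConv.ofConv h) a

/-- Points of a subgroup preserve its Lie algebra, so in adapted coordinates `Ad` is block
triangular on it. -/
theorem mk_adjointMatrix_eq_zero {n n' : ℕ} (c : Coordinates k A (Fin n ⊕ Fin n'))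
    (hx : ∀ j, c.x (Sum.inr j) ∈ I) (hY : ∀ i, ∀ a ∈ I, (c.Y (Sum.inl i)).1 a = 0)
    (r : Fin n') (j : Fin n) :
    Ideal.Quotient.mkₐ k I (c.adjointMatrix (Sum.inr r) (Sum.inl j)) = 0 := by
  obtain ⟨X, hX⟩ := exists_liftDer_eq (hY j)
  have h := c.apply_adjointMatrix
    (subgroupInclusion I (WithConv.toConv (AlgHom.id k (A ⧸ I)))) (Sum.inr r) (Sum.inl j)
  rw [← hX, adjoint_subgroupInclusion,
    show Ideal.Quotient.mkₐ k I (c.x (Sum.inr r)) = 0 from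
      Ideal.Quotient.eq_zero_iff_mem.2 (hx r), map_zero] at h
  exact h

/-- The matrix of the adjoint representation of a closed subgroup on its Lie algebra. -/
theorem isMulMatrix_mk_toBlocks {n n' : ℕ} (c : Coordinates k A (Fin n ⊕ Fin n'))
    (hx : ∀ j, c.x (Sum.inr j) ∈ I) (hY : ∀ i, ∀ a ∈ I, (c.Y (Sum.inl i)).1 a = 0) :
    IsMulMatrix k (c.adjointMatrix.toBlocks₁₁.map (Ideal.Quotient.mkₐ k I)) where
  comul i j := by
    rw [Matrix.map_apply, comul_mk]
    change TensorProduct.map _ _ (Coalgebra.comul (c.adjointMatrix (Sum.inl i) (Sum.inl j))) = _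
    rw [c.isMulMatrix.comul, map_sum]
    simp only [TensorProduct.map_tmul, Fintype.sum_sum_type, AlgHom.toLinearMap_apply,
      mk_adjointMatrix_eq_zero c hx hY, tmul_zero, Finset.sum_const_zero, add_zero]
    rfl
  counit i j := by
    rw [Matrix.map_apply, counit_mk]
    simp [Matrix.toBlocks₁₁, c.isMulMatrix.counit]

theorem IsMulMatrix.apply_det {ι : Type*} [Fintype ι] [DecidableEq ι] {a : Matrix ι ι A}
    (ha : IsMulMatrix k a) (X : pointDerivations k A) : X.1 a.det = ∑ i, X.1 (a i i) := by
  rw [← counit_invDer, (LinAlgGroup.invDer X).det_of_eq_mul (fun i j => ha.invDer X i j)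
    (M := Matrix.of fun i j => algebraMap k A (X.1 (a i j)))]
  rw [Bialgebra.counit_mul, ha.isGroupLikeElem_det.counit_eq_one, one_mul]
  simp [Matrix.trace]

end Subgroup

/-! ### Nontriviality of the modular character -/

section Unipotent

variable {A : Type} [CommRing A] [HopfAlgebra ℚ A] [Algebra.FiniteType ℚ A]
  [ConnectedSpace (PrimeSpectrum A)] {I : Ideal A} [I.IsHopfIdeal ℚ]

/-- If the modular character of a parabolic subgroup is trivial, its Lie algebra is an ideal. -/
theorem IsParabolic.pointBracket_eq_zero (hP : IsParabolic I) {n n' : ℕ}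
    (c : Coordinates ℚ A (Fin n ⊕ Fin n'))
    (hx : ∀ j, c.x (Sum.inr j) ∈ I) (hY : ∀ i, ∀ a ∈ I, (c.Y (Sum.inl i)).1 a = 0)
    (hχ : ∀ X : pointDerivations ℚ (A ⧸ I),
      X.1 (c.adjointMatrix.toBlocks₁₁.map (Ideal.Quotient.mkₐ ℚ I)).det = 0)
    (Y : pointDerivations ℚ A) {X : pointDerivations ℚ A} (hX : ∀ a ∈ I, X.1 a = 0)
    {a : A} (ha : a ∈ I) : (pointBracket Y X).1 a = 0 := by
  -- The trace of `ad X` on `Lie P` is `dχ(X) = 0`, so the Plücker coordinates of `Ad(g) Lie P` are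
  -- killed by `Lie P`. They are then constant, and their differentials, the components of `ad Y`
  -- transversal to `Lie P`, vanish.
  have h1 : ∀ r i, Y.1 (c.adjointMatrix (Sum.inr r) (Sum.inl i)) = 0 := by
    intro r i
    obtain ⟨h2, h3⟩ := counit_rowDet_update c.isMulMatrix i r
    rw [← h3, hP.eq_algebraMap (f := rowDet c.adjointMatrix _) ?_, h2, map_zero, map_zero]
    intro X hX
    obtain ⟨X, rfl⟩ := exists_liftDer_eq hX
    rw [c.isMulMatrix.invDer_rowDet]
    · have := hχ X
      rw [(isMulMatrix_mk_toBlocks c hx hY).apply_det] at this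
      rw [show ∑ j, (liftDer X).1 (c.adjointMatrix (Sum.inl j) (Sum.inl j)) = 0 from this,
        map_zero, zero_mul]
    · intro r j
      rw [liftDer_apply, mk_adjointMatrix_eq_zero c hx hY, map_zero]
  have hsum : ∀ (Z : pointDerivations ℚ A) (a : A), Z.1 a = ∑ i, (c.Y i).1 a * Z.1 (c.x i) := by
    intro Z a
    refine c.sum_smul (δ := Z.1) (fun a b => ?_) a
    rw [Z.2]
    simp [mul_comm]
  have hkill : ∀ Z : pointDerivations ℚ A, (∀ r, Z.1 (c.x (Sum.inr r)) = 0) → Z.1 a = 0 := by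
    intro Z hZ
    rw [hsum, Fintype.sum_sum_type]
    simp [hZ, hY _ a ha]
  obtain ⟨t, ht⟩ : ∃ t : Fin n → ℚ, X.1 = ∑ i, t i • (c.Y (Sum.inl i)).1 := by
    refine ⟨fun i => X.1 (c.x (Sum.inl i)), ?_⟩
    ext b
    rw [hsum, Fintype.sum_sum_type]
    simp [hX _ (hx _), mul_comm]
  have hbr : ∀ f, (pointBracket Y X).1 f = ∑ i, t i * (pointBracket Y (c.Y (Sum.inl i))).1 f := by
    intro f
    have hc : contract X.1 f = ∑ i, t i • contract (c.Y (Sum.inl i)).1 f := by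
      change slice X.1 (Coalgebra.comul f) = _
      rw [ht, map_sum, LinearMap.sum_apply]
      simp only [map_smul, LinearMap.smul_apply]
      rfl
    simp only [pointBracket_apply, invDer_apply]
    rw [hc, ht]
    simp [mul_sub, Finset.sum_sub_distrib]
  rw [hbr]
  refine Finset.sum_eq_zero fun i _ => ?_
  rw [hkill, mul_zero]
  intro r
  rw [← c.apply_adjointMatrix_eq_pointBracket, h1]

/-- A parabolic subgroup whose Lie algebra is an ideal has only the constant functions as
semi-invariants. -/
theorem IsParabolic.eq_zero_of_semiinvariant (hP : IsParabolic I)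
    (hideal : ∀ (Y X : pointDerivations ℚ A), (∀ a ∈ I, X.1 a = 0) →
      ∀ a ∈ I, (pointBracket Y X).1 a = 0) {θ : pointDerivations ℚ A → ℚ} {F : A}
    (hF : ∀ X : pointDerivations ℚ A, (∀ a ∈ I, X.1 a = 0) → invDer X F = θ X • F)
    (hεF : Coalgebra.counit (R := ℚ) F = 0) : F = 0 := by
  classical
  by_contra hF0
  have hred := isReduced_of_connected ℚ A
  obtain ⟨W, hW, hFW, hWc⟩ := exists_finiteDimensional_stable (k := ℚ) {F}
  replace hFW : F ∈ W := hFW F (Finset.mem_singleton_self F)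
  have hθ : ∀ X Y : pointDerivations ℚ A, (∀ a ∈ I, X.1 a = 0) → θ (pointBracket X Y) = 0 := by
    intro X Y hX
    have hXY : ∀ X : pointDerivations ℚ A, (∀ a ∈ I, X.1 a = 0) →
        ∀ a ∈ I, (pointBracket X Y).1 a = 0 := by
      intro X hX a ha
      have := hideal Y X hX a ha
      rw [pointBracket_apply] at this ⊢
      linarith
    exact eigenvalue_commutator_eq_zero
      (P := {X : pointDerivations ℚ A // ∀ a ∈ I, X.1 a = 0})
      (fun X => (invDer X.1).toLinearMap) (invDer Y).toLinearMap
      (fun X => ⟨pointBracket X.1 Y, hXY X.1 X.2⟩)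
      (fun Z v => invDer_pointBracket _ _ _) (θ := fun X => θ X.1) hF0 (fun Z => hF Z.1 Z.2) hFW
      (fun w hw => hWc Y.1 w hw) ⟨X, hX⟩
  -- Since `θ` kills `[Lie P, Lie G]`, this eigenspace is stable under all of `Lie G`, hence is a
  -- representation of `G`. Its determinant is a character `δ` of `G` on which `X ∈ Lie P` acts by
  -- `r θ(X)`.
  let V : Submodule ℚ A := W ⊓
    { carrier := {g | ∀ X : pointDerivations ℚ A, (∀ a ∈ I, X.1 a = 0) → invDer X g = θ X • g}
      add_mem' := fun ha hb X hX => by rw [map_add, ha X hX, hb X hX, smul_add]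
      zero_mem' := fun X hX => by simp
      smul_mem' := fun c a ha X hX => by rw [Derivation.map_smul, ha X hX, smul_comm] }
  have hFV : F ∈ V := ⟨hFW, hF⟩
  have hVD : ∀ Y : pointDerivations ℚ A, ∀ v ∈ V, invDer Y v ∈ V := by
    intro Y v hv
    refine ⟨hWc Y.1 v hv.1, fun X hX => ?_⟩
    have h1 := invDer_pointBracket X Y v
    have h2 : ∀ a ∈ I, (pointBracket X Y).1 a = 0 := by
      intro a ha
      have := hideal Y X hX a ha
      rw [pointBracket_apply] at this ⊢
      linarith
    rw [hv.2 _ h2, hθ X Y hX, zero_smul, hv.2 X hX, Derivation.map_smul] at h1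
    exact (sub_eq_zero.1 h1.symm)
  have hVfin : FiniteDimensional ℚ V := Submodule.finiteDimensional_inf_left _ _
  obtain ⟨r, ⟨b⟩⟩ : ∃ r, Nonempty (Module.Basis (Fin r) ℚ V) := ⟨_, ⟨Module.finBasis ℚ V⟩⟩
  obtain ⟨a, ha, -, ha'⟩ := exists_isMulMatrix b (fun φ w hw => contract_mem_of_invDer_mem hVD φ hw)
  have hr : r ≠ 0 := by
    rintro rfl
    have : Subsingleton V := b.repr.toEquiv.subsingleton
    exact hF0 (congrArg Subtype.val (Subsingleton.elim (⟨F, hFV⟩ : V) 0))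
  have hXa : ∀ X : pointDerivations ℚ A, (∀ a ∈ I, X.1 a = 0) → X.1 a.det = r * θ X := by
    intro X hX
    rw [ha.apply_det]
    have : ∀ i, X.1 (a i i) = θ X := by
      intro i
      rw [ha']
      have : (⟨contract X.1 (b i), contract_mem_of_invDer_mem hVD X.1 (b i).2⟩ : V) = θ X • b i :=
        Subtype.ext ((b i).2.2 X hX)
      rw [this]
      simp
    simp [this]
  have hg := ha.isGroupLikeElem_det
  set δ := a.det
  obtain ⟨δ', hδ⟩ : ∃ δ', δ * δ' = 1 := ⟨_, by
    have := HopfAlgebra.mul_antipode_lTensor_comul_apply (R := ℚ) δ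
    rw [hg.comul_eq_tmul_self, hg.counit_eq_one] at this
    simpa using this⟩
  have hDδ : ∀ X : pointDerivations ℚ A, (∀ a ∈ I, X.1 a = 0) → invDer X δ = (r * θ X) • δ := by
    intro X hX
    rw [invDer_apply, contract_apply, hg.comul_eq_tmul_self]
    simp [hXa X hX]
  have hDδ' : ∀ X : pointDerivations ℚ A, (∀ a ∈ I, X.1 a = 0) →
      invDer X δ' = -((r * θ X) • δ') := by
    intro X hX
    have h1 := congrArg (invDer X) hδ
    rw [Derivation.leibniz, hDδ X hX, Derivation.map_one_eq_zero] at h1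
    simp only [smul_eq_mul, Algebra.smul_def] at h1 ⊢
    linear_combination δ' * h1 - (invDer X δ' + algebraMap ℚ A (r * θ X) * δ') * hδ
  -- `F ^ r` and `δ` have the same weight, so their quotient is killed by `Lie P`, thus constant,
  -- and it vanishes at the identity.
  have hconst := hP.eq_algebraMap (f := F ^ r * δ') (fun X hX => by
    rw [Derivation.leibniz, Derivation.leibniz_pow, hDδ' X hX, hF X hX]
    obtain ⟨r', hr'⟩ := Nat.exists_eq_succ_of_ne_zero hr
    rw [hr']
    simp only [nsmul_eq_mul]
    simp only [smul_eq_mul, Algebra.smul_def, map_mul, map_natCast,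
      Nat.succ_sub_one, pow_succ, Nat.succ_eq_add_one]
    ring)
  rw [Bialgebra.counit_mul, Bialgebra.counit_pow, hεF, zero_pow hr, zero_mul, map_zero] at hconst
  have : F ^ r = 0 := by linear_combination δ * hconst - F ^ r * hδ
  exact hF0 (pow_eq_zero_iff hr |>.1 this)

/-- A proper parabolic subgroup has a nontrivial modular character. -/
theorem IsParabolic.exists_apply_det_ne_zero (hP : IsParabolic I) (hI : I ≠ ⊥) {n n' : ℕ}
    (c : Coordinates ℚ A (Fin n ⊕ Fin n'))
    (hx : ∀ j, c.x (Sum.inr j) ∈ I) (hY : ∀ i, ∀ a ∈ I, (c.Y (Sum.inl i)).1 a = 0) :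
    ∃ X : pointDerivations ℚ (A ⧸ I),
      X.1 (c.adjointMatrix.toBlocks₁₁.map (Ideal.Quotient.mkₐ ℚ I)).det ≠ 0 := by
  by_contra! hχ
  have hnoeth : IsNoetherianRing A := Algebra.FiniteType.isNoetherianRing ℚ A
  obtain ⟨s, hs⟩ := (isNoetherianRing_iff_ideal_fg A).1 hnoeth I
  obtain ⟨W, hW, hsW, hWc⟩ := exists_finiteDimensional_stable (k := ℚ) s
  -- `W ∩ I` contains generators of `I` and is preserved by `Lie P`; its Plücker coordinates are
  -- semi-invariants.
  obtain ⟨m, m', b, hbI, hbr⟩ := exists_basis_sum ((I.restrictScalars ℚ).comap W.subtype)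
  replace hbI : ∀ i, (b (Sum.inl i) : A) ∈ I := hbI
  obtain ⟨a, ha, hac, har⟩ := exists_isMulMatrix b hWc
  have hXa : ∀ X : pointDerivations ℚ A, (∀ a ∈ I, X.1 a = 0) →
      ∀ r j, X.1 (a (Sum.inr r) (Sum.inl j)) = 0 := by
    intro X hX r j
    rw [har]
    exact hbr _ (invDer_mem hX (hbI j)) r
  have hYa : ∀ (Y : pointDerivations ℚ A) r i, Y.1 (a (Sum.inr r) (Sum.inl i)) = 0 := by
    intro Y r i
    obtain ⟨h2, h3⟩ := counit_rowDet_update ha i r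
    rw [← h3, hP.eq_zero_of_semiinvariant (F := rowDet a _)
      (fun Y X hX a ha => hP.pointBracket_eq_zero c hx hY hχ Y hX ha)
      (θ := fun X => ∑ j, X.1 (a (Sum.inl j) (Sum.inl j))) ?_ h2, map_zero]
    intro X hX
    rw [ha.invDer_rowDet (hXa X hX), Algebra.smul_def]
  have hDs : ∀ (Y : pointDerivations ℚ A), ∀ f ∈ s, invDer Y f ∈ I := by
    intro Y f hf
    have hfI : f ∈ I := hs ▸ Ideal.subset_span hf
    have h1 : f = ∑ j, b.repr ⟨f, hsW f hf⟩ (Sum.inl j) • (b (Sum.inl j) : A) := by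
      have h2 := congrArg Subtype.val (b.sum_repr ⟨f, hsW f hf⟩)
      rw [Fintype.sum_sum_type] at h2
      simp only [hbr ⟨f, hsW f hf⟩ hfI, zero_smul, Finset.sum_const_zero, add_zero] at h2
      rw [AddSubmonoidClass.coe_finsetSum] at h2
      exact h2.symm
    rw [h1, map_sum]
    refine Ideal.sum_mem _ fun j _ => ?_
    rw [Derivation.map_smul]
    refine Submodule.smul_of_tower_mem I _ ?_
    rw [invDer_apply, hac, Fintype.sum_sum_type]
    simp only [hYa, zero_smul, Finset.sum_const_zero, add_zero]
    exact Ideal.sum_mem _ fun i _ => Submodule.smul_of_tower_mem I _ (hbI i)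
  refine hI ((Submodule.eq_bot_iff _).2 fun f hf => ?_)
  refine eq_zero_of_stable (k := ℚ) (N := I) (fun f hf => le_augIdeal ℚ I hf) ?_ hf
  intro Y f hf
  change f ∈ I at hf
  change invDer Y f ∈ I
  rw [← hs] at hf
  induction hf using Submodule.span_induction with
  | mem x hx => exact hDs Y x hx
  | zero => simp
  | add x y _ _ hx hy => rw [map_add]; exact add_mem hx hy
  | smul c x hx' hx =>
    rw [smul_eq_mul, Derivation.leibniz]
    refine add_mem (Ideal.mul_mem_left _ _ hx) ?_
    exact Ideal.mul_mem_right _ _ (hs ▸ hx')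

end Unipotent

/-! ### One-parameter subgroups of the real points -/

section Exponential

/-- Multiplication intertwines `D` with `D ⊗ 1 + 1 ⊗ D`, a sum of commuting operators, to which the
binomial formula applies. -/
theorem _root_.Derivation.pow_apply_mul {k R : Type*} [CommRing k] [CommRing R] [Algebra k R]
    (D : Derivation k R R) (n : ℕ) (a b : R) :
    (D.toLinearMap ^ n) (a * b) = ∑ p ∈ Finset.HasAntidiagonal.antidiagonal n,
      n.choose p.1 • ((D.toLinearMap ^ p.1) a * (D.toLinearMap ^ p.2) b) := by
  let x : Module.End k (R ⊗[k] R) := D.toLinearMap.rTensor R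
  let y : Module.End k (R ⊗[k] R) := D.toLinearMap.lTensor R
  have hxy : Commute x y := by
    apply TensorProduct.ext'
    intro a b
    rfl
  have h1 : ∀ n z, (D.toLinearMap ^ n) (LinearMap.mul' k R z) =
      LinearMap.mul' k R (((x + y) ^ n) z) := by
    intro n
    induction n with
    | zero => intro z; rfl
    | succ n ih =>
      intro z
      rw [pow_succ, pow_succ, Module.End.mul_apply, Module.End.mul_apply, ← ih]
      congr 1
      induction z with
      | zero => simp
      | add u v hu hv => simp only [map_add, hu, hv]
      | tmul u v => simp [x, y]; ring
  have hx : ∀ (n : ℕ) (a b : R), (x ^ n) (a ⊗ₜ b) = (D.toLinearMap ^ n) a ⊗ₜ b := by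
    intro n
    induction n with
    | zero => intro a b; rfl
    | succ n ih => intro a b; rw [pow_succ, pow_succ]; exact ih _ _
  have hy : ∀ (n : ℕ) (a b : R), (y ^ n) (a ⊗ₜ b) = a ⊗ₜ (D.toLinearMap ^ n) b := by
    intro n
    induction n with
    | zero => intro a b; rfl
    | succ n ih => intro a b; rw [pow_succ, pow_succ]; exact ih _ _
  have h2 := h1 n (a ⊗ₜ b)
  rw [hxy.add_pow', LinearMap.mul'_apply] at h2
  rw [h2, LinearMap.sum_apply, map_sum]
  refine Finset.sum_congr rfl fun p _ => ?_
  rw [LinearMap.smul_apply, map_nsmul, Module.End.mul_apply, hy, hx, LinearMap.mul'_apply]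

/-- Matrix coefficients of the powers of an operator grow at most exponentially. -/
theorem exists_abs_le_mul_pow {W : Type*} [AddCommGroup W] [Module ℚ W] [FiniteDimensional ℚ W]
    (T : Module.End ℚ W) (l : W →ₗ[ℚ] ℚ) (w : W) :
    ∃ C M : ℝ, ∀ n, |(l ((T ^ n) w) : ℝ)| ≤ C * M ^ n := by
  let b := Module.finBasis ℚ W
  let N : W → ℚ := fun w => ∑ i, |b.repr w i|
  let M : ℚ := ∑ i, ∑ j, |b.repr (T (b j)) i|
  let L : ℚ := ∑ i, |l (b i)|
  have hle : ∀ w i, |b.repr w i| ≤ N w := fun w i =>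
    Finset.single_le_sum (f := fun i => |b.repr w i|) (fun _ _ => abs_nonneg _) (Finset.mem_univ i)
  have hM0 : 0 ≤ M := Finset.sum_nonneg fun i _ => Finset.sum_nonneg fun j _ => abs_nonneg _
  have hl : ∀ w, |l w| ≤ L * N w := by
    intro w
    conv_lhs => rw [← b.sum_repr w, map_sum]
    refine (Finset.abs_sum_le_sum_abs _ _).trans ?_
    rw [Finset.sum_mul]
    refine Finset.sum_le_sum fun i _ => ?_
    rw [map_smul, smul_eq_mul, abs_mul, mul_comm]
    exact mul_le_mul_of_nonneg_left (hle w i) (abs_nonneg _)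
  have hT : ∀ w, N (T w) ≤ M * N w := by
    intro w
    simp only [N, M]
    rw [Finset.sum_mul]
    refine Finset.sum_le_sum fun i _ => ?_
    have : b.repr (T w) i = ∑ j, b.repr w j * b.repr (T (b j)) i := by
      conv_lhs => rw [← b.sum_repr w]
      rw [map_sum, map_sum, Finsupp.finsetSum_apply]
      refine Finset.sum_congr rfl fun j _ => ?_
      rw [map_smul, map_smul, Finsupp.smul_apply, smul_eq_mul]
    rw [this, Finset.sum_mul]
    refine (Finset.abs_sum_le_sum_abs _ _).trans (Finset.sum_le_sum fun j _ => ?_)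
    rw [abs_mul, mul_comm]
    exact mul_le_mul_of_nonneg_left (hle w j) (abs_nonneg _)
  have hn : ∀ n, N ((T ^ n) w) ≤ M ^ n * N w := by
    intro n
    induction n with
    | zero => simp
    | succ n ih =>
      rw [pow_succ', Module.End.mul_apply]
      refine (hT _).trans ?_
      rw [pow_succ', mul_assoc]
      exact mul_le_mul_of_nonneg_left ih hM0
  have hL0 : 0 ≤ L := Finset.sum_nonneg fun i _ => abs_nonneg _
  refine ⟨((L * N w : ℚ) : ℝ), (M : ℝ), fun n => ?_⟩
  have : |l ((T ^ n) w)| ≤ L * N w * M ^ n := by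
    refine (hl _).trans ?_
    rw [mul_assoc, mul_comm (N w)]
    exact mul_le_mul_of_nonneg_left (hn n) hL0
  exact_mod_cast this

variable {B : Type*} [CommRing B] [HopfAlgebra ℚ B] (X : pointDerivations ℚ B)

/-- The Taylor coefficients at the identity along an invariant vector field. -/
def taylorCoeff (b : B) (n : ℕ) : ℝ :=
  (Coalgebra.counit (R := ℚ) (((invDer X).toLinearMap ^ n) b) : ℝ) / n.factorial

/-- By local finiteness `b` lies in a finite dimensional space stable under the derivation, so its
Taylor series is dominated by an exponential series. -/
theorem exists_abs_taylorCoeff_le (b : B) :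
    ∃ C M : ℝ, ∀ n, |taylorCoeff X b n| ≤ C * (M ^ n / n.factorial) := by
  obtain ⟨W, hW, hbW, hWc⟩ := exists_finiteDimensional_stable (k := ℚ) {b}
  let T : Module.End ℚ W := (invDer X).toLinearMap.restrict (fun w hw => hWc X.1 w hw)
  obtain ⟨C, M, h⟩ := exists_abs_le_mul_pow T (Coalgebra.counit ∘ₗ W.subtype)
    ⟨b, hbW b (Finset.mem_singleton_self b)⟩
  refine ⟨C, M, fun n => ?_⟩
  have hT : ∀ (n : ℕ) (w : W), ((T ^ n) w : B) = ((invDer X).toLinearMap ^ n) (w : B) := by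
    intro n
    induction n with
    | zero => intro w; rfl
    | succ n ih => intro w; rw [pow_succ, pow_succ]; exact ih _
  have hn := h n
  rw [LinearMap.comp_apply, Submodule.subtype_apply, hT] at hn
  rw [taylorCoeff, abs_div, Nat.abs_cast, ← mul_div_assoc]
  exact div_le_div_of_nonneg_right hn (Nat.cast_nonneg _)

theorem exists_summable_bound (b : B) (r : ℝ) :
    ∃ u : ℕ → ℝ, Summable u ∧ ∀ n, ∀ s : ℝ, |s| ≤ r → ‖s ^ n * taylorCoeff X b n‖ ≤ u n := by
  obtain ⟨C, M, h⟩ := exists_abs_taylorCoeff_le X b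
  refine ⟨fun n => C * ((r * M) ^ n / n.factorial),
    (Real.summable_pow_div_factorial (r * M)).mul_left C, fun n s hs => ?_⟩
  rw [Real.norm_eq_abs, abs_mul, abs_pow]
  calc |s| ^ n * |taylorCoeff X b n| ≤ r ^ n * (C * (M ^ n / n.factorial)) :=
        mul_le_mul (pow_le_pow_left₀ (abs_nonneg s) hs n) (h n) (abs_nonneg _)
          (pow_nonneg ((abs_nonneg s).trans hs) n)
    _ = C * ((r * M) ^ n / n.factorial) := by rw [mul_pow]; ring

theorem summable_norm_taylor (b : B) (s : ℝ) : Summable fun n => ‖s ^ n * taylorCoeff X b n‖ := by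
  obtain ⟨u, hu, h⟩ := exists_summable_bound X b |s|
  exact Summable.of_nonneg_of_le (fun n => norm_nonneg _) (fun n => h n s le_rfl) hu

theorem taylorCoeff_mul (a b : B) (n : ℕ) : taylorCoeff X (a * b) n =
    ∑ p ∈ Finset.HasAntidiagonal.antidiagonal n, taylorCoeff X a p.1 * taylorCoeff X b p.2 := by
  simp only [taylorCoeff]
  rw [Derivation.pow_apply_mul, map_sum, Rat.cast_sum, Finset.sum_div]
  refine Finset.sum_congr rfl fun p hp => ?_
  rw [Finset.HasAntidiagonal.mem_antidiagonal] at hp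
  subst hp
  rw [map_nsmul, Bialgebra.counit_mul, nsmul_eq_mul]
  have h' : ((p.1 + p.2).choose p.1 : ℝ) * p.1.factorial * p.2.factorial =
    (p.1 + p.2).factorial := by
    rw [← Nat.add_choose_mul_factorial_mul_factorial p.1 p.2, Nat.choose_symm_add]
    push_cast
    rfl
  push_cast
  rw [← h']
  have h1 : ((p.1 + p.2).choose p.1 : ℝ) ≠ 0 :=
    Nat.cast_ne_zero.2 (Nat.choose_pos (Nat.le_add_right _ _)).ne'
  have h2 : (p.1.factorial : ℝ) ≠ 0 := Nat.cast_ne_zero.2 (Nat.factorial_ne_zero _)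
  have h3 : (p.2.factorial : ℝ) ≠ 0 := Nat.cast_ne_zero.2 (Nat.factorial_ne_zero _)
  field_simp

theorem taylorCoeff_algebraMap (q : ℚ) (n : ℕ) :
    taylorCoeff X (algebraMap ℚ B q) n = if n = 0 then (q : ℝ) else 0 := by
  cases n with
  | zero => simp [taylorCoeff]
  | succ n =>
    rw [taylorCoeff, pow_succ, Module.End.mul_apply]
    simp

/-- The one-parameter group `s ↦ exp (s X)`. -/
def expPoint (s : ℝ) : Points ℚ B ℝ := WithConv.toConv
  { toFun := fun b => ∑' n, s ^ n * taylorCoeff X b n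
    map_one' := by
      have := taylorCoeff_algebraMap X 1
      rw [map_one] at this
      simp only [this]
      rw [tsum_eq_single 0 (by intro n hn; simp [hn])]
      simp
    map_mul' := fun a b => by
      rw [tsum_mul_tsum_eq_tsum_sum_antidiagonal_of_summable_norm
        (summable_norm_taylor X a s) (summable_norm_taylor X b s)]
      refine tsum_congr fun n => ?_
      rw [taylorCoeff_mul, Finset.mul_sum]
      refine Finset.sum_congr rfl fun p hp => ?_
      rw [← Finset.HasAntidiagonal.mem_antidiagonal.1 hp, pow_add]
      ring
    map_zero' := by simp [taylorCoeff]
    map_add' := fun a b => by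
      rw [← (summable_norm_taylor X a s).of_norm.tsum_add (summable_norm_taylor X b s).of_norm]
      refine tsum_congr fun n => ?_
      simp only [taylorCoeff, map_add, Rat.cast_add]
      ring
    commutes' := fun q => by
      simp only [taylorCoeff_algebraMap]
      rw [tsum_eq_single 0 (by intro n hn; simp [hn])]
      simp }

theorem expPoint_apply (s : ℝ) (b : B) :
    (expPoint X s).ofConv b = ∑' n, s ^ n * taylorCoeff X b n := rfl

theorem expPoint_zero : expPoint X 0 = 1 := by
  apply WithConv.ofConv_injective
  ext b
  rw [expPoint_apply, tsum_eq_single 0 (by intro n hn; simp [hn])]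
  simp [taylorCoeff]

theorem tendsto_expPoint (b : B) :
    Filter.Tendsto (fun s => (expPoint X s).ofConv b) (nhds 0)
      (nhds (algebraMap ℚ ℝ (Coalgebra.counit b))) := by
  obtain ⟨u, hu, h⟩ := exists_summable_bound X b 1
  have hc : ContinuousOn (fun s : ℝ => ∑' n, s ^ n * taylorCoeff X b n) (Metric.closedBall 0 1) := by
    refine continuousOn_tsum (fun n => by fun_prop) hu fun n s hs => h n s ?_
    simpa using hs
  have h0 := (hc.continuousAt (Metric.closedBall_mem_nhds 0 one_pos)).tendsto
  have h1 := congrArg (fun g : Points ℚ B ℝ => g.ofConv b) (expPoint_zero X)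
  simp only [expPoint_apply] at h1
  rw [h1] at h0
  exact h0

theorem expPoint_groupLike {χ : B} (hχ : IsGroupLikeElem ℚ χ) (s : ℝ) :
    (expPoint X s).ofConv χ = Real.exp (s * X.1 χ) := by
  have hD : ∀ n : ℕ, ((invDer X).toLinearMap ^ n) χ = (X.1 χ) ^ n • χ := by
    intro n
    induction n with
    | zero => simp
    | succ n ih =>
      rw [pow_succ', Module.End.mul_apply, ih, map_smul]
      have : (invDer X).toLinearMap χ = X.1 χ • χ := by
        change invDer X χ = _
        rw [invDer_apply, contract_apply, hχ.comul_eq_tmul_self]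
        simp
      rw [this, smul_smul, pow_succ]
  rw [expPoint_apply, Real.exp_eq_exp_ℝ, NormedSpace.exp_eq_tsum_div]
  refine tsum_congr fun n => ?_
  rw [taylorCoeff, hD, map_smul, hχ.counit_eq_one, mul_pow]
  simp [mul_div_assoc]

theorem tendsto_mul_expPoint (p : Points ℚ B ℝ) (b : B) :
    Filter.Tendsto (fun s => (p * expPoint X s).ofConv b) (nhds 0) (nhds (p.ofConv b)) := by
  have key : ∀ z : B ⊗[ℚ] B, Filter.Tendsto (fun s => LinearMap.mul' ℚ ℝ
      (TensorProduct.map p.ofConv.toLinearMap (expPoint X s).ofConv.toLinearMap z)) (nhds 0)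
      (nhds (LinearMap.mul' ℚ ℝ (TensorProduct.map p.ofConv.toLinearMap
        (1 : Points ℚ B ℝ).ofConv.toLinearMap z))) := by
    intro z
    induction z with
    | zero => simp
    | add x y hx hy => simpa only [map_add] using hx.add hy
    | tmul x y =>
      simp only [TensorProduct.map_tmul, LinearMap.mul'_apply, AlgHom.toLinearMap_apply]
      exact (tendsto_expPoint X y).const_mul _
  have := key (Coalgebra.comul b)
  have h1 : LinearMap.mul' ℚ ℝ (TensorProduct.map p.ofConv.toLinearMap
        (1 : Points ℚ B ℝ).ofConv.toLinearMap (Coalgebra.comul b)) = (p * 1).ofConv b := rfl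
  rw [h1, mul_one] at this
  exact this

end Exponential

/-! ### The ring of virtual characters -/

section Characters

variable {G : Type*} [Group G] [TopologicalSpace G]

/-- The character of a continuous finite dimensional complex representation. -/
def IsCharacter (f : G → ℂ) : Prop :=
  ∃ (n : ℕ) (σ : G →ₜ* GL (Fin n) ℂ), ∀ x, f x = Matrix.trace (σ x : Matrix (Fin n) (Fin n) ℂ)

/-- The topology of `GL` also involves the inverse matrix; its continuity comes from that of
inversion in `G`. -/
theorem isCharacter_of_matrix [ContinuousInv G] {ι : Type*} [Fintype ι] [DecidableEq ι]
    (ρ : G →* Matrix ι ι ℂ) (hρ : ∀ i j, Continuous fun x => ρ x i j) :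
    IsCharacter fun x => Matrix.trace (ρ x) := by
  let e := Fintype.equivFin ι
  let ρ' : G →* Matrix (Fin (Fintype.card ι)) (Fin (Fintype.card ι)) ℂ :=
    ((Matrix.reindexAlgEquiv ℂ ℂ e : Matrix ι ι ℂ →* _)).comp ρ
  have hρ' : Continuous ρ' := by
    refine continuous_pi fun i => continuous_pi fun j => ?_
    exact hρ (e.symm i) (e.symm j)
  refine ⟨Fintype.card ι, ⟨ρ'.toHomUnits, ?_⟩, fun x => ?_⟩
  · rw [Units.continuous_iff]
    exact ⟨hρ', hρ'.comp continuous_inv⟩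
  · change _ = Matrix.trace (ρ' x)
    simp only [Matrix.trace, Matrix.diag]
    exact (Equiv.sum_comp e.symm fun i => ρ x i i).symm

/-- The underlying matrix representation. -/
def toMatrixHom {n : ℕ} (σ : G →ₜ* GL (Fin n) ℂ) : G →* Matrix (Fin n) (Fin n) ℂ :=
  (Units.coeHom _).comp σ.toMonoidHom

theorem continuous_toMatrixHom {n : ℕ} (σ : G →ₜ* GL (Fin n) ℂ) (i j : Fin n) :
    Continuous fun x => toMatrixHom σ x i j := by
  have h : Continuous fun x => toMatrixHom σ x :=
    Units.continuous_val.comp σ.continuous_toFun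
  exact (continuous_apply j).comp ((continuous_apply i).comp h)

theorem exists_tr_eq_iff {f : G → ℂ} : (∃ ψ : VirtualRepresentation G, ψ.tr = f) ↔
    ∃ g h : G → ℂ, IsCharacter g ∧ IsCharacter h ∧ f = g - h := by
  constructor
  · rintro ⟨ψ, rfl⟩
    exact ⟨_, _, ⟨_, ψ.pos, fun x => rfl⟩, ⟨_, ψ.neg, fun x => rfl⟩, rfl⟩
  · rintro ⟨g, h, ⟨n, σ, hσ⟩, ⟨m, τ, hτ⟩, rfl⟩
    refine ⟨⟨n, m, σ, τ⟩, ?_⟩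
    funext x
    simp only [VirtualRepresentation.tr, Pi.sub_apply, hσ, hτ]

theorem IsCharacter.continuous {f : G → ℂ} (hf : IsCharacter f) : Continuous f := by
  obtain ⟨n, σ, hσ⟩ := hf
  rw [show f = _ from funext hσ]
  exact continuous_finsetSum _ fun i _ => continuous_toMatrixHom σ i i

theorem IsCharacter.conj {f : G → ℂ} (hf : IsCharacter f) (x y : G) :
    f (x * y * x⁻¹) = f y := by
  obtain ⟨n, σ, hσ⟩ := hf
  rw [hσ, hσ]
  change Matrix.trace (toMatrixHom σ (x * y * x⁻¹)) = Matrix.trace (toMatrixHom σ y)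
  rw [map_mul, Matrix.trace_mul_comm, ← map_mul, ← mul_assoc, inv_mul_cancel, one_mul]

variable [ContinuousInv G]

theorem IsCharacter.add {f g : G → ℂ} (hf : IsCharacter f) (hg : IsCharacter g) :
    IsCharacter (f + g) := by
  obtain ⟨n, σ, hσ⟩ := hf
  obtain ⟨m, τ, hτ⟩ := hg
  have := isCharacter_of_matrix (G := G) (ι := Fin n ⊕ Fin m)
    { toFun := fun x => Matrix.fromBlocks (toMatrixHom σ x) 0 0 (toMatrixHom τ x)
      map_one' := by simp
      map_mul' := fun x y => by simp [Matrix.fromBlocks_multiply] } (by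
    rintro (i | i) (j | j)
    · exact continuous_toMatrixHom σ i j
    · exact continuous_const
    · exact continuous_const
    · exact continuous_toMatrixHom τ i j)
  convert this using 1
  funext x
  simp only [Pi.add_apply, hσ, hτ]
  simp only [Matrix.trace, Matrix.diag, Fintype.sum_sum_type]
  rfl

open Kronecker in
theorem IsCharacter.mul {f g : G → ℂ} (hf : IsCharacter f) (hg : IsCharacter g) :
    IsCharacter (f * g) := by
  obtain ⟨n, σ, hσ⟩ := hf
  obtain ⟨m, τ, hτ⟩ := hg
  have := isCharacter_of_matrix (G := G) (ι := Fin n × Fin m)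
    { toFun := fun x => toMatrixHom σ x ⊗ₖ toMatrixHom τ x
      map_one' := by simp
      map_mul' := fun x y => by simp [Matrix.mul_kronecker_mul] } (by
    rintro ⟨i, i'⟩ ⟨j, j'⟩
    exact (continuous_toMatrixHom σ i j).mul (continuous_toMatrixHom τ i' j'))
  convert this using 1
  funext x
  simp only [Pi.mul_apply, hσ, hτ]
  exact (Matrix.trace_kronecker _ _).symm

theorem isCharacter_zero : IsCharacter (0 : G → ℂ) := by
  have := isCharacter_of_matrix (G := G) (ι := Fin 0) 1 fun i => i.elim0
  convert this using 1
  funext x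
  simp

theorem isCharacter_one : IsCharacter (1 : G → ℂ) := by
  have := isCharacter_of_matrix (G := G) (ι := Fin 1) 1 fun i j => continuous_const
  convert this using 1
  funext x
  simp

variable (G) in
/-- The ring of virtual characters. -/
def virtualCharacters : Subring (G → ℂ) where
  carrier := {f | ∃ ψ : VirtualRepresentation G, ψ.tr = f}
  zero_mem' := exists_tr_eq_iff.2 ⟨0, 0, isCharacter_zero, isCharacter_zero, (sub_zero _).symm⟩
  one_mem' := exists_tr_eq_iff.2 ⟨1, 0, isCharacter_one, isCharacter_zero, (sub_zero _).symm⟩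
  add_mem' ha hb := by
    obtain ⟨g, h, hg, hh, rfl⟩ := exists_tr_eq_iff.1 ha
    obtain ⟨g', h', hg', hh', rfl⟩ := exists_tr_eq_iff.1 hb
    exact exists_tr_eq_iff.2 ⟨g + g', h + h', hg.add hg', hh.add hh', by ring⟩
  mul_mem' ha hb := by
    obtain ⟨g, h, hg, hh, rfl⟩ := exists_tr_eq_iff.1 ha
    obtain ⟨g', h', hg', hh', rfl⟩ := exists_tr_eq_iff.1 hb
    exact exists_tr_eq_iff.2 ⟨g * g' + h * h', g * h' + h * g', (hg.mul hg').add (hh.mul hh'),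
      (hg.mul hh').add (hh.mul hg'), by ring⟩
  neg_mem' ha := by
    obtain ⟨g, h, hg, hh, rfl⟩ := exists_tr_eq_iff.1 ha
    exact exists_tr_eq_iff.2 ⟨h, g, hh, hg, by ring⟩

theorem IsCharacter.mem_virtualCharacters {f : G → ℂ} (hf : IsCharacter f) :
    f ∈ virtualCharacters G :=
  exists_tr_eq_iff.2 ⟨f, 0, hf, isCharacter_zero, (sub_zero _).symm⟩

theorem continuous_of_mem_virtualCharacters {f : G → ℂ} (hf : f ∈ virtualCharacters G) :
    Continuous f := by
  obtain ⟨g, h, hg, hh, rfl⟩ := exists_tr_eq_iff.1 hf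
  exact hg.continuous.sub hh.continuous

theorem conj_of_mem_virtualCharacters {f : G → ℂ} (hf : f ∈ virtualCharacters G) (x y : G) :
    f (x * y * x⁻¹) = f y := by
  obtain ⟨g, h, hg, hh, rfl⟩ := exists_tr_eq_iff.1 hf
  simp only [Pi.sub_apply, hg.conj, hh.conj]

end Characters

/-! ### Exterior powers and characteristic polynomials -/

section ExteriorPowers

variable {G : Type*} [Group G] [TopologicalSpace G] {V : Type*} [AddCommGroup V] [Module ℂ V]

/-- The matrix coefficients of `ρ` are continuous. -/
def IsContinuousRep (ρ : G →* Module.End ℂ V) : Prop :=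
  ∀ (v : V) (l : Module.Dual ℂ V), Continuous fun x => l (ρ x v)

theorem isContinuousRep_of_basis {ι : Type*} [Fintype ι] (b : Module.Basis ι ℂ V)
    {ρ : G →* Module.End ℂ V} (h : ∀ i j, Continuous fun x => b.repr (ρ x (b j)) i) :
    IsContinuousRep ρ := by
  intro v l
  have : ∀ x, l (ρ x v) = ∑ j, ∑ i, b.repr v j * (b.repr (ρ x (b j)) i * l (b i)) := by
    intro x
    conv_lhs => rw [← b.sum_repr v, map_sum, map_sum]
    refine Finset.sum_congr rfl fun j _ => ?_
    rw [map_smul, map_smul, smul_eq_mul, ← Finset.mul_sum]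
    conv_lhs => rw [← b.sum_repr (ρ x (b j)), map_sum]
    simp only [map_smul, smul_eq_mul]
  simp only [this]
  exact continuous_finsetSum _ fun j _ => continuous_finsetSum _ fun i _ =>
    continuous_const.mul ((h i j).mul continuous_const)

/-- The exterior power of a representation. -/
def extPow (k : ℕ) (ρ : G →* Module.End ℂ V) : G →* Module.End ℂ (⋀[ℂ]^k V) where
  toFun x := exteriorPower.map k (ρ x)
  map_one' := by rw [map_one]; exact exteriorPower.map_id
  map_mul' x y := by rw [map_mul]; exact exteriorPower.map_comp _ _

theorem repr_exteriorPower_map {ι : Type*} [LinearOrder ι] (b : Module.Basis ι ℂ V) (k : ℕ)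
    (f : Module.End ℂ V) (s t : Set.powersetCard ι k) :
    (b.exteriorPower k).repr (exteriorPower.map k f (b.exteriorPower k s)) t =
      (Matrix.of fun i j => b.repr (f (b (Set.powersetCard.ofFinEmbEquiv.symm s i)))
        (Set.powersetCard.ofFinEmbEquiv.symm t j)).det := by
  rw [exteriorPower.basis_apply, exteriorPower.map_apply_ιMulti_family,
    exteriorPower.basis_repr_apply, exteriorPower.ιMulti_family,
    exteriorPower.ιMultiDual_apply_ιMulti]
  rfl

theorem IsContinuousRep.extPow [FiniteDimensional ℂ V] {ρ : G →* Module.End ℂ V}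
    (hρ : IsContinuousRep ρ) (k : ℕ) : IsContinuousRep (extPow k ρ) := by
  let b := Module.finBasis ℂ V
  refine isContinuousRep_of_basis (b.exteriorPower k) fun t s => ?_
  have h : ∀ x, (b.exteriorPower k).repr (LinAlgGroup.extPow k ρ x (b.exteriorPower k s)) t = _ :=
    fun x => repr_exteriorPower_map b k (ρ x) s t
  simp only [h]
  refine Continuous.matrix_det ?_
  refine continuous_pi fun i => continuous_pi fun j => ?_
  exact hρ _ (b.coord _)

theorem IsContinuousRep.trace_mem [ContinuousInv G] [FiniteDimensional ℂ V]
    {ρ : G →* Module.End ℂ V} (hρ : IsContinuousRep ρ) :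
    (fun x => LinearMap.trace ℂ V (ρ x)) ∈ virtualCharacters G := by
  classical
  let b := Module.finBasis ℂ V
  let σ : G →* Matrix _ _ ℂ := (LinearMap.toMatrixAlgEquiv b).toMulEquiv.toMonoidHom.comp ρ
  have := isCharacter_of_matrix σ fun i j => by
    have h : ∀ x, σ x i j = b.coord i (ρ x (b j)) := fun x =>
      LinearMap.toMatrixAlgEquiv_apply b (ρ x) i j
    simp only [h]
    exact hρ _ _
  convert this.mem_virtualCharacters using 1
  funext x
  rw [LinearMap.trace_eq_matrix_trace ℂ b]
  rfl

/-- Both sides are, up to the sign, the sum of the principal `k × k` minors. -/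
theorem trace_exteriorPower_map [FiniteDimensional ℂ V] (f : Module.End ℂ V) {k : ℕ}
    (hk : k ≤ Module.finrank ℂ V) :
    f.charpoly.coeff (Module.finrank ℂ V - k) =
      (-1) ^ k * LinearMap.trace ℂ _ (exteriorPower.map k f) := by
  classical
  let b := Module.finBasis ℂ V
  rw [← LinearMap.charpoly_toMatrix f b]
  have h1 := Matrix.charpoly_coeff_eq_sum_minors (LinearMap.toMatrix b b f) k (by simpa using hk)
  rw [Fintype.card_fin] at h1
  rw [h1, LinearMap.trace_eq_matrix_trace ℂ (b.exteriorPower k)]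
  congr 1
  simp only [Matrix.trace, Matrix.diag, LinearMap.toMatrix_apply, repr_exteriorPower_map]
  refine Finset.sum_bij' (fun s hs => (⟨s, (Finset.mem_powersetCard.1 hs).2⟩ :
      Set.powersetCard (Fin (Module.finrank ℂ V)) k)) (fun s _ => s.1) ?_ ?_ ?_ ?_ ?_
  · intro s hs; exact Finset.mem_univ _
  · intro s _; exact Finset.mem_powersetCard.2 ⟨Finset.subset_univ _, s.2⟩
  · intro s hs; rfl
  · intro s hs; rfl
  · intro s hs
    have hc : s.card = k := (Finset.mem_powersetCard.1 hs).2
    rw [← Matrix.det_submatrix_equiv_self (s.orderIsoOfFin hc).toEquiv, ← Matrix.det_transpose]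
    congr 1
    ext i j
    simp only [Matrix.transpose_apply, Matrix.submatrix_apply, LinearMap.toMatrix_apply]
    rfl

/-- The characteristic polynomial of a representation has virtual characters as coefficients. -/
theorem IsContinuousRep.exists_charpoly [ContinuousInv G] [FiniteDimensional ℂ V]
    {ρ : G →* Module.End ℂ V} (hρ : IsContinuousRep ρ) :
    ∃ P : Polynomial (virtualCharacters G),
      ∀ x, P.map ((Pi.evalRingHom (fun _ => ℂ) x).comp (virtualCharacters G).subtype) =
        (ρ x).charpoly := by
  set d := Module.finrank ℂ V
  have hmem : ∀ i, (fun x => (ρ x).charpoly.coeff i) ∈ virtualCharacters G := by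
    intro i
    by_cases hi : i ≤ d
    · have h1 : (fun x => (ρ x).charpoly.coeff i) =
          (-1) ^ (d - i) * fun x => LinearMap.trace ℂ _ (LinAlgGroup.extPow (d - i) ρ x) := by
        funext x
        have := trace_exteriorPower_map (ρ x) (k := d - i) (Nat.sub_le _ _)
        rw [Nat.sub_sub_self hi] at this
        rw [this]
        simp [LinAlgGroup.extPow]
      rw [h1]
      exact mul_mem (pow_mem (neg_mem (one_mem _)) _) (hρ.extPow _).trace_mem
    · have h1 : (fun x => (ρ x).charpoly.coeff i) = 0 := by
        funext x
        refine Polynomial.coeff_eq_zero_of_natDegree_lt ?_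
        rw [LinearMap.charpoly_natDegree]
        exact not_le.1 hi
      rw [h1]
      exact zero_mem _
  refine ⟨∑ i ∈ Finset.range (d + 1), Polynomial.monomial i ⟨_, hmem i⟩, fun x => ?_⟩
  rw [Polynomial.map_sum]
  simp only [Polynomial.map_monomial]
  conv_rhs => rw [(ρ x).charpoly.as_sum_range' (d + 1)
    (by rw [LinearMap.charpoly_natDegree]; exact Nat.lt_succ_self d)]
  rfl

end ExteriorPowers

/-! ### Continuous representations of the real points -/

section RealPoints

variable {A : Type} [CommRing A] [HopfAlgebra ℚ A]

theorem continuous_eval_realPoints (a : A) : Continuous fun g : Points ℚ A ℝ => g.ofConv a :=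
  (continuous_apply a).comp continuous_induced_dom

instance instContinuousInvRealPoints : ContinuousInv (Points ℚ A ℝ) where
  continuous_inv := continuous_induced_rng.2 (continuous_pi fun a =>
    continuous_eval_realPoints (HopfAlgebra.antipode ℚ a))

theorem tendsto_realPoints {α : Type*} {l : Filter α} {y : α → Points ℚ A ℝ} {p : Points ℚ A ℝ}
    (h : ∀ a, Filter.Tendsto (fun s => (y s).ofConv a) l (nhds (p.ofConv a))) :
    Filter.Tendsto y l (nhds p) := by
  rw [nhds_induced, Filter.tendsto_comap_iff, tendsto_pi_nhds]
  exact h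

variable {ι : Type*} [Fintype ι] [DecidableEq ι]

theorem IsMulMatrix.mul_apply {a : Matrix ι ι A} (ha : IsMulMatrix ℚ a) (x y : Points ℚ A ℝ)
    (i j : ι) : (x * y).ofConv (a i j) = ∑ l, x.ofConv (a i l) * y.ofConv (a l j) := by
  change LinearMap.mul' ℚ ℝ (TensorProduct.map x.ofConv.toLinearMap y.ofConv.toLinearMap
    (Coalgebra.comul (a i j))) = _
  rw [ha.comul]
  simp

theorem IsMulMatrix.one_apply {a : Matrix ι ι A} (ha : IsMulMatrix ℚ a) (i j : ι) :
    (1 : Points ℚ A ℝ).ofConv (a i j) = if i = j then 1 else 0 := by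
  change algebraMap ℚ ℝ (Coalgebra.counit (a i j)) = _
  rw [ha.counit]
  split_ifs <;> simp

/-- The complex representation of `G(ℝ)` defined by a multiplicative matrix. -/
def IsMulMatrix.rep {a : Matrix ι ι A} (ha : IsMulMatrix ℚ a) :
    Points ℚ A ℝ →* Module.End ℂ (ι → ℂ) where
  toFun x := Matrix.toLin' (Matrix.of fun i j => ((x.ofConv (a i j) : ℝ) : ℂ))
  map_one' := by
    refine Eq.trans ?_ Matrix.toLin'_one
    congr 1
    ext i j
    rw [Matrix.of_apply, ha.one_apply, Matrix.one_apply]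
    split_ifs <;> simp
  map_mul' x y := by
    rw [Module.End.mul_eq_comp, ← Matrix.toLin'_mul]
    congr 1
    ext i j
    simp [ha.mul_apply, Matrix.mul_apply]

theorem IsMulMatrix.rep_apply {a : Matrix ι ι A} (ha : IsMulMatrix ℚ a) (x : Points ℚ A ℝ)
    (v : ι → ℂ) (i : ι) : ha.rep x v i = ∑ j, ((x.ofConv (a i j) : ℝ) : ℂ) * v j := rfl

theorem IsMulMatrix.isContinuousRep {a : Matrix ι ι A} (ha : IsMulMatrix ℚ a) :
    IsContinuousRep ha.rep := by
  refine isContinuousRep_of_basis (Pi.basisFun ℂ ι) fun i j => ?_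
  have : ∀ x, (Pi.basisFun ℂ ι).repr (ha.rep x (Pi.basisFun ℂ ι j)) i =
      ((x.ofConv (a i j) : ℝ) : ℂ) := by
    intro x
    rw [Pi.basisFun_repr, Pi.basisFun_apply, ha.rep_apply]
    simp [Pi.single_apply]
  simp only [this]
  exact Complex.continuous_ofReal.comp (continuous_eval_realPoints (a i j))

end RealPoints

/-! ### The modular character as an eigenvalue -/

section Eigenvalue

theorem _root_.AlternatingMap.map_sum_smul_eq_det {K V N ι : Type*} [CommRing K] [AddCommGroup V]
    [Module K V] [AddCommGroup N] [Module K N] [Fintype ι] [DecidableEq ι]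
    (g : V [⋀^ι]→ₗ[K] N) (u : ι → V) (M : Matrix ι ι K) :
    g (fun j => ∑ l, M l j • u l) = M.det • g u := by
  let e := Pi.basisFun K ι
  let L : (ι → K) →ₗ[K] V := Fintype.linearCombination K u
  have h : g.compLinearMap L =
      (LinearMap.toSpanSingleton K N (g u)).compAlternatingMap e.det := by
    refine Module.Basis.ext_alternating e fun i hi => ?_
    let σ : Equiv.Perm ι := Equiv.ofBijective i (Finite.injective_iff_bijective.1 hi)
    change g (fun j => L (e (σ j))) = e.det (fun j => e (σ j)) • g u
    have h1 : (fun j => L (e (σ j))) = u ∘ σ := by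
      funext j
      simp [L, e, Fintype.linearCombination_apply_single]
    have h2 : e.det (fun j => e (σ j)) = Equiv.Perm.sign σ := by
      change e.det (e ∘ σ) = _
      rw [AlternatingMap.map_perm, e.det_self]
      simp [Units.smul_def]
    rw [h1, h2, AlternatingMap.map_perm, Units.smul_def, Int.cast_smul_eq_zsmul]
  have h3 := DFunLike.congr_fun h (fun j => fun l => M l j)
  have h4 : e.det (fun j => fun l => M l j) = M.det := by
    rw [Module.Basis.det_apply]
    congr 1
  change g (fun j => L (fun l => M l j)) = e.det (fun j => fun l => M l j) • g u at h3
  rw [h4] at h3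
  rw [← h3]
  congr 1

variable {A : Type} [CommRing A] [HopfAlgebra ℚ A] {ι : Type*} [Fintype ι] [DecidableEq ι]

theorem Coordinates.apply_eq_sum (c : Coordinates ℚ A ι) (Z : pointDerivations ℚ A) (a : A) :
    Z.1 a = ∑ i, Z.1 (c.x i) * (c.Y i).1 a := by
  have := c.sum_smul (δ := Z.1) (fun a b => by rw [Z.2]; simp [mul_comm]) a
  rw [this]
  simp [mul_comm]

/-- The adjoint representation in two systems of coordinates. -/
theorem Coordinates.sum_adjointMatrix_mul {κ : Type*} [Fintype κ] [DecidableEq κ]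
    (c₀ : Coordinates ℚ A ι) (c : Coordinates ℚ A κ) (g : Points ℚ A ℝ) (i : ι) (j : κ) :
    ∑ l, g.ofConv (c₀.adjointMatrix i l) * ((c.Y j).1 (c₀.x l) : ℝ) =
      ∑ l, g.ofConv (c.adjointMatrix l j) * ((c.Y l).1 (c₀.x i) : ℝ) := by
  have h1 : (adjoint g (c.Y j).1).ofConv (c₀.x i) =
      ∑ l, g.ofConv (c.adjointMatrix l j) * ((c.Y l).1 (c₀.x i) : ℝ) := by
    rw [c.adjoint_eq, WithConv.ofConv_sum, LinearMap.sum_apply]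
    rfl
  have h2 : adjoint g (c.Y j).1 = ∑ l, (c.Y j).1 (c₀.x l) • adjoint g (c₀.Y l).1 := by
    have h3 : extendForm ℝ (c.Y j).1 = ∑ l, (c.Y j).1 (c₀.x l) • extendForm ℝ (c₀.Y l).1 := by
      apply WithConv.ofConv_injective
      rw [WithConv.ofConv_sum]
      ext a
      rw [LinearMap.sum_apply]
      change (((c.Y j).1 a : ℚ) : ℝ) = _
      rw [c₀.apply_eq_sum (c.Y j) a, Rat.cast_sum]
      refine Finset.sum_congr rfl fun l _ => ?_
      rw [WithConv.ofConv_smul, LinearMap.smul_apply, Rat.cast_mul, Rat.smul_def]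
      rfl
    rw [adjoint, h3, Finset.mul_sum, Finset.sum_mul]
    simp only [mul_smul_comm, smul_mul_assoc, adjoint]
  rw [← h1, h2, WithConv.ofConv_sum, LinearMap.sum_apply]
  refine Finset.sum_congr rfl fun l _ => ?_
  rw [WithConv.ofConv_smul, LinearMap.smul_apply, ← c₀.apply_adjointMatrix, Rat.smul_def, mul_comm]

/-- The modular character of a closed subgroup is an eigenvalue of an exterior power of the
adjoint representation. -/
theorem Coordinates.hasEigenvalue {I : Ideal A} [I.IsHopfIdeal ℚ] (c₀ : Coordinates ℚ A ι)
    {n n' : ℕ} (c : Coordinates ℚ A (Fin n ⊕ Fin n')) (hx : ∀ j, c.x (Sum.inr j) ∈ I)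
    (hY : ∀ i, ∀ a ∈ I, (c.Y (Sum.inl i)).1 a = 0) (y : Points ℚ (A ⧸ I) ℝ) :
    n ≤ Fintype.card ι ∧ (extPow n c₀.isMulMatrix.rep (subgroupInclusion I y)).HasEigenvalue
      ((y.ofConv (c.adjointMatrix.toBlocks₁₁.map (Ideal.Quotient.mkₐ ℚ I)).det : ℝ) : ℂ) := by
  let u : Fin n → ι → ℂ := fun j i => (((c.Y (Sum.inl j)).1 (c₀.x i) : ℝ) : ℂ)
  have hu : LinearIndependent ℂ u := by
    -- The coordinates `c₀` are fixed once for all parabolics, while `c` is adapted to `I`. The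
    -- forms `d` are the coordinates `c.x (Sum.inl l)` written in terms of `c₀`, dual to the vectors
    -- `u`.
    let d : Fin n → (ι → ℂ) →ₗ[ℂ] ℂ := fun l =>
      ∑ i, (((c₀.Y i).1 (c.x (Sum.inl l)) : ℝ) : ℂ) • LinearMap.proj i
    have hd : ∀ l j, d l (u j) = if j = l then 1 else 0 := by
      intro l j
      have h1 := c₀.apply_eq_sum (c.Y (Sum.inl j)) (c.x (Sum.inl l))
      rw [c.dual] at h1
      have h2 : d l (u j) = ((∑ i, (c.Y (Sum.inl j)).1 (c₀.x i) *
          (c₀.Y i).1 (c.x (Sum.inl l)) : ℚ) : ℂ) := by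
        simp [d, u, mul_comm]
      rw [h2, ← h1]
      simp only [Sum.inl.injEq]
      split_ifs
      · exact Rat.cast_one
      · exact Rat.cast_zero
    refine LinearIndependent.of_pairwise_dual_eq_zero_one u d ?_ ?_
    · intro l j hlj
      simp [hd, hlj.symm]
    · intro l
      simp [hd]
  refine ⟨by simpa using hu.fintype_card_le_finrank, ?_⟩
  let M : Matrix (Fin n) (Fin n) ℂ := Matrix.of fun l j =>
    ((y.ofConv (Ideal.Quotient.mkₐ ℚ I (c.adjointMatrix (Sum.inl l) (Sum.inl j))) : ℝ) : ℂ)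
  have hact : ∀ j, c₀.isMulMatrix.rep (subgroupInclusion I y) (u j) = ∑ l, M l j • u l := by
    intro j
    funext i
    rw [IsMulMatrix.rep_apply, Finset.sum_apply]
    have h1 := c₀.sum_adjointMatrix_mul c (subgroupInclusion I y) i (Sum.inl j)
    rw [Fintype.sum_sum_type] at h1
    have h2 : ∀ r, (subgroupInclusion I y).ofConv (c.adjointMatrix (Sum.inr r) (Sum.inl j)) = 0 := by
      intro r
      change y.ofConv (Ideal.Quotient.mkₐ ℚ I _) = 0
      rw [mk_adjointMatrix_eq_zero c hx hY, map_zero]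
    simp only [h2, zero_mul, Finset.sum_const_zero, add_zero] at h1
    have h3 := congrArg (fun r : ℝ => (r : ℂ)) h1
    simp only [Complex.ofReal_sum, Complex.ofReal_mul] at h3
    exact h3
  have hdet : M.det =
      ((y.ofConv (c.adjointMatrix.toBlocks₁₁.map (Ideal.Quotient.mkₐ ℚ I)).det : ℝ) : ℂ) := by
    rw [AlgHom.map_det]
    change _ = Complex.ofRealHom _
    rw [RingHom.map_det]
    rfl
  refine Module.End.hasEigenvalue_of_hasEigenvector (x := exteriorPower.ιMulti ℂ n u)
    ⟨Module.End.mem_eigenspace_iff.2 ?_, ?_⟩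
  · change exteriorPower.map n _ _ = _
    rw [exteriorPower.map_apply_ιMulti, ← hdet, ← AlternatingMap.map_sum_smul_eq_det]
    congr 1
    funext j
    exact hact j
  · have h1 := exteriorPower.ιMulti_family_linearIndependent_field n hu
    have h2 := h1.ne_zero (Set.powersetCard.ofFinEmbEquiv (RelEmbedding.refl _))
    rw [exteriorPower.ιMulti_family, Equiv.symm_apply_apply] at h2
    exact h2

end Eigenvalue

/-! ### The trailing coefficient and the conclusion -/

section TrailingCoefficient

open Polynomial

variable {G : Type*} [Group G] [TopologicalSpace G] [ContinuousInv G]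

/-- The ring homomorphism evaluating virtual characters at `x`. -/
def evalCharacter (x : G) : virtualCharacters G →+* ℂ :=
  (Pi.evalRingHom (fun _ => ℂ) x).comp (virtualCharacters G).subtype

/-- The lowest nonzero coefficient of a family of polynomials vanishes at a limit point of
parameters where the polynomials have nonzero roots tending to zero. -/
theorem trailingCoeff_apply_eq_zero (P : (virtualCharacters G)[X]) {α : Type*} {l : Filter α}
    [l.NeBot] {y : α → G} {p : G} (hy : Filter.Tendsto y l (nhds p)) {u : α → ℂ}
    (hu : Filter.Tendsto u l (nhds 0)) (hu0 : ∀ᶠ s in l, u s ≠ 0)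
    (hroot : ∀ s, (P.map (evalCharacter (y s))).eval (u s) = 0) :
    (P.trailingCoeff : G → ℂ) p = 0 := by
  obtain ⟨Q, hQ⟩ : X ^ P.natTrailingDegree ∣ P :=
    X_pow_dvd_iff.2 fun d hd => coeff_eq_zero_of_lt_natTrailingDegree hd
  have h0 : P.trailingCoeff = Q.coeff 0 := by
    have h1 := coeff_X_pow_mul Q P.natTrailingDegree 0
    rw [← hQ, zero_add] at h1
    exact h1
  have hev : ∀ (x : G) (t : ℂ), (Q.map (evalCharacter x)).eval t =
      ∑ i ∈ Finset.range (Q.natDegree + 1), (Q.coeff i : G → ℂ) x * t ^ i := by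
    intro x t
    rw [Polynomial.eval_map, eval₂_eq_sum_range]
    rfl
  have hlim : Filter.Tendsto (fun s => (Q.map (evalCharacter (y s))).eval (u s)) l
      (nhds ((Q.map (evalCharacter p)).eval 0)) := by
    simp only [hev]
    refine tendsto_finsetSum _ fun i _ => Filter.Tendsto.mul ?_ (hu.pow i)
    exact ((continuous_of_mem_virtualCharacters (Q.coeff i).2).tendsto p).comp hy
  -- As `u s ≠ 0`, the factor `X ^ P.natTrailingDegree` can be cancelled at each point, even where
  -- the coefficient of `P` in that degree vanishes.
  have hzero : ∀ᶠ s in l, (Q.map (evalCharacter (y s))).eval (u s) = 0 := by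
    filter_upwards [hu0] with s hs
    have h1 := hroot s
    rw [hQ, Polynomial.map_mul, Polynomial.map_pow, map_X, eval_mul, eval_pow, eval_X] at h1
    exact (mul_eq_zero.1 h1).resolve_left (pow_ne_zero _ hs)
  have h1 : (Q.map (evalCharacter p)).eval 0 = 0 :=
    tendsto_nhds_unique (hlim.congr' hzero) tendsto_const_nhds
  rw [h0]
  rw [← coeff_zero_eq_eval_zero, coeff_map] at h1
  exact h1

end TrailingCoefficient

open Polynomial in
theorem exists_virtualRepresentation (A : Type) [CommRing A] [HopfAlgebra ℚ A]
    [Algebra.FiniteType ℚ A] [ConnectedSpace (PrimeSpectrum A)] :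
    ∃ ψ : VirtualRepresentation (Points ℚ A ℝ),
      (∃ x : Points ℚ A ℝ, ψ.tr x ≠ 0) ∧ IsParabolicallyRegular ψ.tr := by
  obtain ⟨d, d', c₀, -, -⟩ := exists_coordinates (k := ℚ) (A := A) (I := ⊥) bot_le
  choose P hP using fun k => (c₀.isMulMatrix.isContinuousRep.extPow k).exists_charpoly
  -- The product over all exterior powers treats all dimensions of parabolics at once; the two
  -- shifts move the possible values `1` and `-1` of the modular character on `P¹` to the root `0`.
  let Φ : (virtualCharacters (Points ℚ A ℝ))[X] :=
    ∏ k ∈ Finset.range (Fintype.card (Fin d ⊕ Fin d') + 1), (P k).comp (X + 1) * (P k).comp (X - 1)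
  have hΦ : ∀ x, Φ.map (evalCharacter x) =
      ∏ k ∈ Finset.range (Fintype.card (Fin d ⊕ Fin d') + 1),
        (extPow k c₀.isMulMatrix.rep x).charpoly.comp (X + 1) *
        (extPow k c₀.isMulMatrix.rep x).charpoly.comp (X - 1) := by
    intro x
    rw [Polynomial.map_prod]
    refine Finset.prod_congr rfl fun k _ => ?_
    rw [Polynomial.map_mul, Polynomial.map_comp, Polynomial.map_comp, ← hP k x]
    simp [evalCharacter]
  have hΦ0 : Φ ≠ 0 := by
    intro h
    have h1 := hΦ 1
    rw [h, Polynomial.map_zero] at h1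
    refine (Finset.prod_ne_zero_iff.2 fun k _ => ?_) h1.symm
    have hm := LinearMap.charpoly_monic (extPow k c₀.isMulMatrix.rep 1)
    refine mul_ne_zero ?_ ?_
    · exact (hm.comp_X_add_C 1).ne_zero
    · exact (hm.comp_X_sub_C 1).ne_zero
  obtain ⟨ψ, hψ⟩ := Φ.trailingCoeff.2
  refine ⟨ψ, ?_, ?_⟩
  · by_contra! h
    refine hΦ0 (trailingCoeff_eq_zero.1 (Subtype.ext ?_))
    rw [← hψ]
    exact funext h
  · intro I _ hpar hI x p hp
    rw [hψ, conj_of_mem_virtualCharacters Φ.trailingCoeff.2]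
    obtain ⟨n, n', c, hx, hY⟩ := exists_coordinates (k := ℚ) (A := A) (le_augIdeal ℚ I)
    obtain ⟨X, hX⟩ := hpar.exists_apply_det_ne_zero hI c hx hY
    have hχ := (isMulMatrix_mk_toBlocks c hx hY).isGroupLikeElem_det
    have hroot := c₀.hasEigenvalue c hx hY
    set χ := (c.adjointMatrix.toBlocks₁₁.map (Ideal.Quotient.mkₐ ℚ I)).det
    have hη := hp χ hχ
    set η := p.ofConv χ
    have hηsq : η = 1 ∨ η = -1 := (abs_eq zero_le_one).1 hη
    have hη0 : η ≠ 0 := by rintro h; simp [h] at hη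
    -- A path in `P(ℝ)` through `p` along which the modular character is not constant, as `dχ(X) ≠
    -- 0`; for `s ≠ 0` it leaves `P¹`.
    let y : ℝ → Points ℚ (A ⧸ I) ℝ := fun s => p * expPoint X s
    have hyχ : ∀ s, (y s).ofConv χ = η * Real.exp (s * X.1 χ) := by
      intro s
      rw [← expPoint_groupLike X hχ]
      change LinearMap.mul' ℚ ℝ (TensorProduct.map p.ofConv.toLinearMap
        (expPoint X s).ofConv.toLinearMap (Coalgebra.comul χ)) = _
      rw [hχ.comul_eq_tmul_self]
      simp [η]
    refine trailingCoeff_apply_eq_zero Φ (l := nhdsWithin (0 : ℝ) {0}ᶜ)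
      (y := fun s => subgroupInclusion I (y s)) (u := fun s => (((y s).ofConv χ - η : ℝ) : ℂ))
      ?_ ?_ ?_ ?_
    · refine Filter.Tendsto.mono_left ?_ nhdsWithin_le_nhds
      exact tendsto_realPoints fun a => tendsto_mul_expPoint X p _
    · refine Filter.Tendsto.mono_left ?_ nhdsWithin_le_nhds
      have h1 := (tendsto_mul_expPoint X p χ).sub_const η
      rw [sub_self] at h1
      have h2 := (Complex.continuous_ofReal.tendsto 0).comp h1
      rwa [Complex.ofReal_zero] at h2
    · filter_upwards [self_mem_nhdsWithin] with s hs
      rw [Complex.ofReal_ne_zero, hyχ, sub_ne_zero]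
      intro h
      have h1 : Real.exp (s * X.1 χ) = 1 := mul_left_cancel₀ hη0 (h.trans (mul_one η).symm)
      rw [Real.exp_eq_one_iff, mul_eq_zero] at h1
      rcases h1 with h1 | h1
      · exact hs h1
      · exact hX (by exact_mod_cast h1)
    · intro s
      obtain ⟨hn, hev⟩ := hroot (y s)
      rw [Module.End.hasEigenvalue_iff_isRoot_charpoly, IsRoot.def] at hev
      rw [hΦ, eval_prod]
      refine Finset.prod_eq_zero (Finset.mem_range.2 (Nat.lt_succ_of_le hn)) ?_
      rw [eval_mul, eval_comp, eval_comp, mul_eq_zero]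
      rcases hηsq with h | h
      · left
        rw [h]
        simpa using hev
      · right
        rw [h]
        simpa using hev

end

end LinAlgGroup

theorem mainTheorem12 (A : Type) [CommRing A] [HopfAlgebra ℚ A]
    (hA : LinAlgGroup.IsConnectedSemisimple A) :
    ∃ ψ : LinAlgGroup.VirtualRepresentation (LinAlgGroup.Points ℚ A ℝ),
      (∃ x : LinAlgGroup.Points ℚ A ℝ, ψ.tr x ≠ 0) ∧
        LinAlgGroup.IsParabolicallyRegular ψ.tr := by
  have := hA.finiteType
  have := hA.connected
  exact LinAlgGroup.exists_virtualRepresentation A
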